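/- **Setting.** Let $\Omega\subset\mathbb R^d$ be compact and $D\subseteq\mathbb R^k$ open (for instance $D=\mathbb R^k$), and let $\varphi:D\times\Omega\to\mathbb R$ be twice differentiable in $\theta$, with $\nabla_\theta\nabla_\theta\varphi(\theta,x)$ Lipschitz in $\theta\in D$ uniformly in $x\in\Omega$. Let $\hat\nu=\frac1n\sum_{l=1}^n\delta_{x_l}$ be the empirical measure of $n\ge1$ points of $\Omega$, $f_*:\Omega\to\mathbb R$ a target function, $\lambda\in\mathbb R$, and $r:D\to\mathbb R$ twice continuously differentiable. Put $$F(\theta)=\int_\Omega f_*(x)\varphi(\theta,x)\,\hat\nu(dx)-\lambda r(\theta),\quad K(\theta,\theta')=\int_\Omega\varphi(\theta,x)\varphi(\theta',x)\,\hat\nu(dx),\quad V(\theta,\mu)=-F(\theta)+\int_D K(\theta,\theta')\,\mu(d\theta'),$$ and let $\nabla V,\nabla\nabla V$ be the gradient and the Hessian of $V$ in $\theta$. Let $\mu_0$ be a probability measure with compact support contained in $D$, and let $\theta_1^0,\theta_2^0,\dots$ be i.i.d. with law $\mu_0$, defined on a probability space with measure $\mathbb P_0$. Let $I\subseteq[0,\infty)$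 be an interval containing $0$ (for instance $I=[0,\infty)$) on which the following dynamics exist: * for each $m$, $\mathbb P_0$-almost surely, the particles $\theta_1(t),\dots,\theta_m(t)\in D$ solve $\dot\theta_i=-\nabla V(\theta_i,\mu_t^{(m)})$, $\theta_i(0)=\theta_i^0$, where $\mu_t^{(m)}=\frac1m\sum_{i=1}^m\delta_{\theta_i(t)}$; * the characteristic flow $\Theta_t(\theta)\in D$, continuous in $(t,\theta)\in I\times\operatorname{supp}\mu_0$, solves $\dot\Theta_t(\theta)=-\nabla V(\Theta_t(\theta),\mu_t)$, $\Theta_0(\theta)=\theta$, where $\mu_t$ is the image of $\mu_0$ under $\Theta_t$. Write $f_t^{(m)}(x)=\int_D\varphi(\theta,x)\,\mu_t^{(m)}(d\theta)$, $f_t(x)=\int_D\varphi(\theta,x)\,\mu_t(d\theta)$ and $g_t^{(m)}=m^{1/2}(f_t^{(m)}-f_t)$. For $s\le t$ in $I$ and $\theta\in\operatorname{supp}\mu_0$ let $J_{t,s}(\theta)$ be the solution of $$\frac{d}{dt}J_{t,s}(\theta)=-\nabla\nabla V(\Theta_t(\theta),\mu_t)\,J_{t,s}(\theta),\qquad J_{s,s}(\theta)=\mathrm{Id},$$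 and set $$\Gamma_{t,s}(x,x')=\int_D\big\langle\nabla_\theta\varphi(\Theta_t(\theta),x),\,J_{t,s}(\theta)\nabla_\theta\varphi(\Theta_s(\theta),x')\big\rangle\,\mu_0(d\theta).$$ Let $\omega_0$ be the centered Gaussian random measure with covariance $\mathbb E[\omega_0(d\theta)\omega_0(d\theta')]=\mu_0(d\theta)\delta_\theta(d\theta')-\mu_0(d\theta)\mu_0(d\theta')$; that is, its integrals against test functions $\chi$ continuous on $\operatorname{supp}\mu_0$ form a centered Gaussian process with covariance $\int\chi\chi'\,d\mu_0-\int\chi\,d\mu_0\int\chi'\,d\mu_0$. Define $$\bar g_t(x)=\int_D\varphi(\Theta_t(\theta),x)\,\omega_0(d\theta)$$ (each $\bar g_t(x)$ is determined up to a null set). **Claim.** On the probability space of $\omega_0$ there are a version of $\bar g$ and a process $g$ such that, for every $x\in\Omega$, almost surely the paths $t\mapsto\bar g_t(x)$ and $t\mapsto g_t(x)$ are continuous on $I$ and, for all $t\in I$, the Volterra equation $$g_t(x)+\int_0^t\int_\Omega\Gamma_{t,s}(x,x')\,g_s(x')\,\hat\nu(dx')\,ds=\bar g_t(x)$$ holds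 (with an integrable integrand in $s$); and for every $t\in I$ and every $x\in\Omega$, $g_t^{(m)}(x)\to g_t(x)$ in law with respect to $\mathbb P_0$ as $m\to\infty$. -/

import Mathlib

namespace MeanFieldCLT

open MeasureTheory ProbabilityTheory Set Filter Topology
open scoped ENNReal

noncomputable section

/-- The Euclidean space `ℝᵏ`. -/
abbrev Euc (k : ℕ) : Type := EuclideanSpace ℝ (Fin k)

/-- The empirical measure `n⁻¹ ∑ δ_{a i}` of finitely many points. -/
def empiricalMeasure {k n : ℕ} (a : Fin n → Euc k) : Measure (Euc k) :=
  (n : ℝ≥0∞)⁻¹ • ∑ i, Measure.dirac (a i)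

/-- The Hessian `∇∇ f` at `θ`, as a linear map: the derivative of the gradient. -/
def hessian {k : ℕ} (f : Euc k → ℝ) (θ : Euc k) : Euc k →L[ℝ] Euc k :=
  fderiv ℝ (gradient f) θ

/-- The data of a regularized least-squares problem: the unit `φ(θ, x)`, the data points `x_l`, the
target function `f_*`, the regularization strength `λ` and the regularizer `r`. -/
structure Problem (k d n : ℕ) where
  φ : Euc k → Euc d → ℝ
  data : Fin n → Euc d
  target : Euc d → ℝ
  lam : ℝ
  reg : Euc k → ℝ

namespace Problem

variable {k d n : ℕ} (p : Problem k d n)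

/-- The empirical data measure `ν̂`. -/
def ν : Measure (Euc d) := empiricalMeasure p.data

/-- The function `f[μ](x) = ∫ φ(θ, x) μ(dθ)` represented by a measure `μ` on parameters. -/
def net (μ : Measure (Euc k)) (x : Euc d) : ℝ := ∫ θ, p.φ θ x ∂μ

/-- `F(θ) = ∫ f_*(x) φ(θ, x) ν̂(dx) - λ r(θ)`. -/
def F (θ : Euc k) : ℝ := ∫ x, p.target x * p.φ θ x ∂p.ν - p.lam * p.reg θ

/-- `K(θ, θ') = ∫ φ(θ, x) φ(θ', x) ν̂(dx)`. -/
def K (θ θ' : Euc k) : ℝ := ∫ x, p.φ θ x * p.φ θ' x ∂p.ν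

/-- The potential `V(θ, μ) = - F(θ) + ∫ K(θ, θ') μ(dθ')`. -/
def V (θ : Euc k) (μ : Measure (Euc k)) : ℝ := - p.F θ + ∫ θ', p.K θ θ' ∂μ

/-- `∇V(θ, μ)`, the gradient being taken in `θ`. -/
def gradV (θ : Euc k) (μ : Measure (Euc k)) : Euc k := gradient (fun z => p.V z μ) θ

/-- `∇∇V(θ, μ)`, the Hessian being taken in `θ`. -/
def hessV (θ : Euc k) (μ : Measure (Euc k)) : Euc k →L[ℝ] Euc k := hessian (fun z => p.V z μ) θ

/-- Regularity of the problem on the parameter domain `D` and the input domain `Ω`: each `φ(·, x)`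
is twice differentiable on `D` with a Hessian that is Lipschitz on `D` uniformly in `x ∈ Ω`, and
the regularizer is twice continuously differentiable on `D`. -/
structure Regular (D : Set (Euc k)) (Ω : Set (Euc d)) : Prop where
  differentiable : ∀ x ∈ Ω, ∀ θ ∈ D, DifferentiableAt ℝ (fun z => p.φ z x) θ
  twice_differentiable : ∀ x ∈ Ω, ∀ θ ∈ D, DifferentiableAt ℝ (gradient fun z => p.φ z x) θ
  lipschitz : ∃ L : NNReal, ∀ x ∈ Ω, LipschitzOnWith L (hessian fun z => p.φ z x) D
  reg : ContDiffOn ℝ 2 p.reg D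

/-- `X` solves, on the time interval `I` and inside `D`, the gradient flow of `m` particles
`θ_i' = - ∇V(θ_i, μ^(m)_t)`, where `μ^(m)_t` is the empirical measure of the particles, started
from `a`. -/
structure IsParticleFlow (D : Set (Euc k)) (I : Set ℝ) {m : ℕ} (a : Fin m → Euc k)
    (X : Fin m → ℝ → Euc k) : Prop where
  init : ∀ i, X i 0 = a i
  mem : ∀ i, ∀ t ∈ I, X i t ∈ D
  ode : ∀ i, ∀ t ∈ I,
    HasDerivWithinAt (X i) (- p.gradV (X i t) (empiricalMeasure fun j => X j t)) I t

/-- The mean-field measure `μ_t`, the image of `μ₀` under the characteristic flow. -/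
def mfMeasure (μ₀ : Measure (Euc k)) (Θ : ℝ → Euc k → Euc k) (t : ℝ) : Measure (Euc k) :=
  μ₀.map (Θ t)

/-- `Θ` is the characteristic flow of the mean-field gradient flow started from `μ₀`, on the time
interval `I` and inside `D`: a continuous flow `Θ_t(θ)`, `θ ∈ supp μ₀`, such that
`d/dt Θ_t(θ) = - ∇V(Θ_t(θ), μ_t)` and `Θ_0(θ) = θ`, where `μ_t` is the image of `μ₀` under `Θ_t`. -/
structure IsMeanFieldFlow (D : Set (Euc k)) (I : Set ℝ) (μ₀ : Measure (Euc k))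
    (Θ : ℝ → Euc k → Euc k) : Prop where
  init : ∀ θ ∈ μ₀.support, Θ 0 θ = θ
  continuous : ContinuousOn (fun q : ℝ × Euc k => Θ q.1 q.2) (I ×ˢ μ₀.support)
  mem : ∀ t ∈ I, ∀ θ ∈ μ₀.support, Θ t θ ∈ D
  ode : ∀ t ∈ I, ∀ θ ∈ μ₀.support,
    HasDerivWithinAt (fun u => Θ u θ) (- p.gradV (Θ t θ) (mfMeasure μ₀ Θ t)) I t

/-- `J t s θ` is the Jacobian `J_{t,s}(θ)` of the linearized flow: for `t ≥ s` it solves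
`d/dt J_{t,s}(θ) = - ∇∇V(Θ_t(θ), μ_t) J_{t,s}(θ)` with `J_{s,s}(θ) = Id`. -/
structure IsJacobian (I : Set ℝ) (μ₀ : Measure (Euc k)) (Θ : ℝ → Euc k → Euc k)
    (J : ℝ → ℝ → Euc k → Euc k →L[ℝ] Euc k) : Prop where
  init : ∀ s ∈ I, ∀ θ ∈ μ₀.support, J s s θ = ContinuousLinearMap.id ℝ (Euc k)
  ode : ∀ s ∈ I, ∀ t ∈ I, s ≤ t → ∀ θ ∈ μ₀.support,
    HasDerivWithinAt (fun u => J u s θ)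
      (- (p.hessV (Θ t θ) (mfMeasure μ₀ Θ t)).comp (J t s θ)) (I ∩ Ici s) t

/-- The Volterra kernel
`Γ_{t,s}(x, x') = ∫ ⟨∇φ(Θ_t(θ), x), J_{t,s}(θ) ∇φ(Θ_s(θ), x')⟩ μ₀(dθ)`. -/
def Γ (μ₀ : Measure (Euc k)) (Θ : ℝ → Euc k → Euc k) (J : ℝ → ℝ → Euc k → Euc k →L[ℝ] Euc k)
    (t s : ℝ) (x x' : Euc d) : ℝ :=
  ∫ θ, inner ℝ (gradient (fun z => p.φ z x) (Θ t θ))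
    (J t s θ (gradient (fun z => p.φ z x') (Θ s θ))) ∂μ₀

/-- The rescaled deviation `g^(m)_t(x) = m^(1/2) (f^(m)_t(x) - f_t(x))` of the network with
parameters `X 0 t, …, X (m-1) t` from the mean-field network. -/
def deviation (μ₀ : Measure (Euc k)) (Θ : ℝ → Euc k → Euc k) {m : ℕ} (X : Fin m → ℝ → Euc k)
    (t : ℝ) (x : Euc d) : ℝ :=
  √(m : ℝ) * (p.net (empiricalMeasure fun i => X i t) x - p.net (mfMeasure μ₀ Θ t) x)

/-- `g` solves, at the point `x` and for all times in `I`, the Volterra equation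
`g_t(x) + ∫₀ᵗ ∫ Γ_{t,s}(x, x') g_s(x') ν̂(dx') ds = ḡ_t(x)`. -/
structure SolvesVolterra (I : Set ℝ) (μ₀ : Measure (Euc k)) (Θ : ℝ → Euc k → Euc k)
    (J : ℝ → ℝ → Euc k → Euc k →L[ℝ] Euc k) (gbar g : ℝ → Euc d → ℝ) (x : Euc d) : Prop where
  integrable : ∀ t ∈ I, IntervalIntegrable
    (fun s => ∫ x', p.Γ μ₀ Θ J t s x x' * g s x' ∂p.ν) volume 0 t
  equation : ∀ t ∈ I,
    g t x + ∫ s in (0 : ℝ)..t, ∫ x', p.Γ μ₀ Θ J t s x x' * g s x' ∂p.ν = gbar t x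

end Problem

/-- `ω χ`, to be read as `∫ χ dω₀`, is the centered Gaussian random measure `ω₀` with covariance
`E[ω₀(dθ) ω₀(dθ')] = μ₀(dθ) δ_θ(dθ') - μ₀(dθ) μ₀(dθ')`: integrated against test functions that are
continuous on the support of `μ₀` it is a centered Gaussian process with the covariance
`∫ χ χ' dμ₀ - ∫ χ dμ₀ ∫ χ' dμ₀`. -/
structure IsGaussianFluctuation {k : ℕ} {S : Type*} [MeasurableSpace S] (μ₀ : Measure (Euc k))
    (Q : Measure S) (ω : (Euc k → ℝ) → S → ℝ) : Prop where
  gaussian : IsGaussianProcess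
    (fun χ : {χ : Euc k → ℝ // ContinuousOn χ μ₀.support} => ω χ.1) Q
  mean : ∀ χ, ContinuousOn χ μ₀.support → ∫ σ, ω χ σ ∂Q = 0
  cov : ∀ χ χ', ContinuousOn χ μ₀.support → ContinuousOn χ' μ₀.support →
    ∫ σ, ω χ σ * ω χ' σ ∂Q = ∫ θ, χ θ * χ' θ ∂μ₀ - (∫ θ, χ θ ∂μ₀) * ∫ θ, χ' θ ∂μ₀

end

end MeanFieldCLT

/-!
The particles are compared with the characteristics of the mean-field flow started from the same
initial positions. Write `W = ℝⁿ` for the values of the network at the data points: `-∇V(θ, μ)` is a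
field `b(θ, w)` that depends on `μ` only through `w ∈ W`.

*Linear response.* Let `G` be the deviation, at the data points and uniformly on `[0, T]`, of the
empirical mean of the unit along the characteristics of the sample from its expectation. By
Gronwall, the displacement of the particles from the characteristics is `O(‖G‖)`, and variation of
constants with the Jacobian `J` expresses it, up to `o(‖G‖)`, through the deviation of the field.
The latter therefore solves a Volterra equation driven by `G`, whose kernel is an empirical average
converging to `- Γ`; so the deviation of the network is an explicit continuous linear functional of
the fluctuations along the characteristics, up to `o(‖G‖)`
(`IsCharacteristics.exists_linear_response`).

*Probability.* The leading term is the normalized deviation from its mean of the empirical average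
of a single continuous function of the initial position, the *influence function*, so the classical
central limit theorem gives its limit. The remainder vanishes in probability, since `√m ‖G‖` is
bounded in mean (`IsSample.exists_lintegral_le`) and since the law of large numbers in spaces of
continuous functions makes `G` and the errors of the kernels tend to zero almost surely.

*The limit.* Both `ω₀` and the normalized empirical deviations are *fluctuation fields*: linear up
to null sets and bounded from the sup norm to `L¹`. A fluctuation field along a continuously
differentiable curve of test functions `χ_t = χ_0 + ∫₀ᵗ c_s ds` has a continuous version: replacing
`c` by its Bernstein polynomials leaves finitely many values of the field, and these approximations
converge uniformly in time. The same approximations give the bound on `√m ‖G‖`, and show that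
continuous linear functionals of the continuous version are the field at the functional of the curve
(`IsC1Curve.ae_apply_version`). Hence the solution `g` of the Volterra equation with right-hand side
`ḡ` is, at each time, almost surely `ω₀` of the influence function, which is the Gaussian limit.
-/

namespace MeanFieldCLT

open MeasureTheory ProbabilityTheory Set Filter Topology
open scoped ENNReal

noncomputable section

/-! ### Volterra operators on spaces of continuous paths -/

section Volterra

variable {W F : Type*} [NormedAddCommGroup W] [NormedSpace ℝ W] [NormedAddCommGroup F]
  [NormedSpace ℝ F] {T : ℝ}

/-- The Volterra operator `f ↦ (t ↦ ∫₀ᵗ N(t, s) f(s) ds)` on continuous paths on `[0, T]`. The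
kernel is given on the whole square, but only its values for `s ≤ t` matter. -/
def volterra (hT : 0 ≤ T) (N : C(Icc 0 T × Icc 0 T, W →L[ℝ] F)) :
    C(Icc 0 T, W) →L[ℝ] C(Icc 0 T, F) :=
  LinearMap.mkContinuous
    { toFun := fun f =>
        ⟨fun t => ∫ s in (0 : ℝ)..t, N (t, projIcc 0 T hT s) (f (projIcc 0 T hT s)), by
          refine intervalIntegral.continuous_parametric_intervalIntegral_of_continuous ?_
            continuous_subtype_val
          have h : Continuous fun q : Icc (0 : ℝ) T × ℝ =>
              N (q.1, projIcc 0 T hT q.2) (f (projIcc 0 T hT q.2)) :=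
            (N.continuous.comp (continuous_fst.prodMk
              (continuous_projIcc.comp continuous_snd))).clm_apply
              (f.continuous.comp (continuous_projIcc.comp continuous_snd))
          exact h⟩
      map_add' := fun f g => by
        ext t
        simp only [ContinuousMap.coe_mk, ContinuousMap.add_apply, map_add]
        refine intervalIntegral.integral_add ?_ ?_ <;>
        · refine Continuous.intervalIntegrable ?_ _ _
          refine Continuous.clm_apply ?_ ?_
          · exact N.continuous.comp (continuous_const.prodMk continuous_projIcc)
          · exact (ContinuousMap.continuous _).comp continuous_projIcc
      map_smul' := fun c f => by
        ext t
        simp [intervalIntegral.integral_smul] }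
    (T * ‖N‖) (fun f => by
      refine (ContinuousMap.norm_le _ (by positivity)).2 fun t => ?_
      refine (intervalIntegral.norm_integral_le_of_norm_le_const
        (C := ‖N‖ * ‖f‖) fun s _ => ?_).trans ?_
      · exact (ContinuousLinearMap.le_opNorm _ _).trans
          (mul_le_mul (N.norm_coe_le_norm _) (f.norm_coe_le_norm _) (norm_nonneg _)
            (by positivity))
      · rw [sub_zero, abs_of_nonneg t.2.1, mul_comm, mul_assoc]
        exact mul_le_mul_of_nonneg_right t.2.2 (by positivity))

lemma volterra_apply (hT : 0 ≤ T) (N : C(Icc 0 T × Icc 0 T, W →L[ℝ] F)) (f : C(Icc 0 T, W))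
    (t : Icc 0 T) : volterra hT N f t =
      ∫ s in (0 : ℝ)..t, N (t, projIcc 0 T hT s) (f (projIcc 0 T hT s)) := rfl

/-- A Volterra operator only depends on the values of the kernel and of the path under the
integral sign. -/
lemma volterra_eq_of_eqOn (hT : 0 ≤ T) {N : C(Icc 0 T × Icc 0 T, W →L[ℝ] F)} {f : C(Icc 0 T, W)}
    {t : Icc 0 T} {h : ℝ → F}
    (hh : ∀ s (hs : s ∈ Icc 0 T), s ≤ t → N (t, ⟨s, hs⟩) (f ⟨s, hs⟩) = h s) :
    volterra hT N f t = ∫ s in (0 : ℝ)..t, h s := by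
  rw [volterra_apply]
  refine intervalIntegral.integral_congr fun s hs => ?_
  rw [uIcc_of_le t.2.1] at hs
  have hs' : s ∈ Icc 0 T := ⟨hs.1, hs.2.trans t.2.2⟩
  simp only [projIcc_of_mem hT hs']
  exact hh s hs' hs.2

lemma norm_volterra_apply_le (hT : 0 ≤ T) (N : C(Icc 0 T × Icc 0 T, W →L[ℝ] F))
    (f : C(Icc 0 T, W)) : ‖volterra hT N f‖ ≤ T * ‖N‖ * ‖f‖ :=
  LinearMap.mkContinuous_norm_le _ (by positivity) _ |> fun h =>
    (ContinuousLinearMap.le_opNorm _ _).trans (mul_le_mul_of_nonneg_right h (norm_nonneg _))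

lemma volterra_sub_kernel (hT : 0 ≤ T) (N N' : C(Icc 0 T × Icc 0 T, W →L[ℝ] F))
    (f : C(Icc 0 T, W)) : volterra hT (N - N') f = volterra hT N f - volterra hT N' f := by
  ext t
  simp only [volterra_apply, ContinuousMap.sub_apply, sub_apply]
  refine intervalIntegral.integral_sub ?_ ?_ <;>
  · refine Continuous.intervalIntegrable ?_ _ _
    refine Continuous.clm_apply ?_ ?_
    · exact (ContinuousMap.continuous _).comp (continuous_const.prodMk continuous_projIcc)
    · exact (ContinuousMap.continuous _).comp continuous_projIcc

end Volterra

section Resolvent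

variable {W : Type*} [NormedAddCommGroup W] [NormedSpace ℝ W] {T : ℝ}

/-- Multiplication of paths by `e^{c t}`. -/
def expMul (T c : ℝ) (f : C(Icc 0 T, W)) : C(Icc 0 T, W) :=
  ⟨fun t => Real.exp (c * t) • f t, by fun_prop⟩

/-- The kernel `e^{-c (t - s)} N(t, s)`. The Volterra operator only sees times `s ≤ t`, where the
weight is at most `1`. -/
def expKernel (c : ℝ) (N : C(Icc 0 T × Icc 0 T, W →L[ℝ] W)) :
    C(Icc 0 T × Icc 0 T, W →L[ℝ] W) :=
  ⟨fun q => Real.exp (-(c * (q.1 - q.2))) • N q, by fun_prop⟩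

lemma integral_exp_neg_le {c : ℝ} (hc : 0 < c) (t : ℝ) :
    ∫ s in (0 : ℝ)..t, Real.exp (-(c * (t - s))) ≤ c⁻¹ := by
  have h : ∀ s ∈ uIcc 0 t, HasDerivAt (fun s => c⁻¹ * Real.exp (-(c * (t - s))))
      (Real.exp (-(c * (t - s)))) s := fun s _ => by
    have h1 : HasDerivAt (fun s => -(c * (t - s))) c s := by
      simpa using (((hasDerivAt_id s).const_sub t).const_mul c).fun_neg
    have := (h1.exp).const_mul c⁻¹
    rwa [mul_comm (Real.exp _), inv_mul_cancel_left₀ hc.ne'] at this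
  rw [intervalIntegral.integral_eq_sub_of_hasDerivAt h
    (Continuous.intervalIntegrable (by fun_prop) _ _)]
  have : 0 ≤ c⁻¹ * Real.exp (-(c * (t - 0))) := by positivity
  simp only [sub_self, mul_zero, neg_zero, Real.exp_zero, mul_one]
  linarith

lemma norm_volterra_expKernel_apply_le (hT : 0 ≤ T) {c : ℝ} (hc : 0 < c)
    (N : C(Icc 0 T × Icc 0 T, W →L[ℝ] W)) (f : C(Icc 0 T, W)) :
    ‖volterra hT (expKernel c N) f‖ ≤ c⁻¹ * ‖N‖ * ‖f‖ := by
  refine (ContinuousMap.norm_le _ (by positivity)).2 fun t => ?_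
  rw [volterra_apply]
  have hb : ∀ s ∈ Ioc (0 : ℝ) t, ‖expKernel c N (t, projIcc 0 T hT s) (f (projIcc 0 T hT s))‖ ≤
      Real.exp (-(c * (t - s))) * (‖N‖ * ‖f‖) := fun s hs => by
    have hs' : s ∈ Icc 0 T := ⟨hs.1.le, hs.2.trans t.2.2⟩
    rw [projIcc_of_mem hT hs']
    simp only [expKernel, ContinuousMap.coe_mk, smul_apply, norm_smul,
      Real.norm_eq_abs, Real.abs_exp]
    refine mul_le_mul_of_nonneg_left ?_ (Real.exp_nonneg _)
    exact (ContinuousLinearMap.le_opNorm _ _).trans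
      (mul_le_mul (N.norm_coe_le_norm _) (f.norm_coe_le_norm _) (norm_nonneg _) (by positivity))
  refine (intervalIntegral.norm_integral_le_of_norm_le t.2.1 (ae_of_all _ hb)
    (Continuous.intervalIntegrable (by fun_prop) _ _)).trans ?_
  rw [intervalIntegral.integral_mul_const, mul_assoc]
  exact mul_le_mul_of_nonneg_right (integral_exp_neg_le hc _) (by positivity)

lemma expMul_volterra (hT : 0 ≤ T) (c : ℝ) (N : C(Icc 0 T × Icc 0 T, W →L[ℝ] W))
    (f : C(Icc 0 T, W)) :
    expMul T c (volterra hT (expKernel c N) f) = volterra hT N (expMul T c f) := by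
  ext t
  simp only [expMul, ContinuousMap.coe_mk]
  rw [volterra_apply, ← intervalIntegral.integral_smul]
  symm
  refine volterra_eq_of_eqOn hT fun s hs _ => ?_
  rw [projIcc_of_mem hT hs]
  simp only [expKernel, ContinuousMap.coe_mk, smul_apply, map_smul, smul_smul,
    ← Real.exp_add]
  ring_nf

variable [CompleteSpace W]

/-- The Volterra equation `u = f + 𝒩 u` has a unique solution in the space of continuous paths,
and it depends linearly and continuously on `f`: for large `c` the weight `e^{-c t}` turns the
Volterra operator `𝒩` into a contraction. -/
lemma exists_volterra_resolvent (hT : 0 ≤ T) (N : C(Icc 0 T × Icc 0 T, W →L[ℝ] W)) :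
    ∃ R : C(Icc 0 T, W) →L[ℝ] C(Icc 0 T, W), (∀ f, R f = f + volterra hT N (R f)) ∧
      ∀ f u, u = f + volterra hT N u → u = R f := by
  set c : ℝ := 2 * ‖N‖ + 1
  have hc : 0 < c := by positivity
  set V := volterra hT (expKernel c N)
  have hV : ‖V‖ < 1 := by
    refine (ContinuousLinearMap.opNorm_le_bound _ (M := c⁻¹ * ‖N‖) (by positivity) fun f =>
      norm_volterra_expKernel_apply_le hT hc N f).trans_lt ?_
    rw [inv_mul_lt_one₀ hc]
    simp only [c]
    linarith [norm_nonneg N]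
  have hcancel : ∀ (d : ℝ) (f : C(Icc 0 T, W)), expMul T d (expMul T (-d) f) = f := fun d f => by
    ext t
    simp [expMul, smul_smul, ← Real.exp_add]
  let M (d : ℝ) : C(Icc 0 T, W) →L[ℝ] C(Icc 0 T, W) :=
    { toFun := expMul T d
      map_add' := fun f g => by ext t; simp [expMul]
      map_smul' := fun a f => by ext t; exact smul_comm _ _ _
      cont := by
        refine ContinuousMap.continuous_of_continuous_uncurry _ ?_
        change Continuous fun q : C(Icc 0 T, W) × Icc 0 T => Real.exp (d * q.2) • q.1 q.2
        fun_prop }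
  have hM : ∀ d f, M d f = expMul T d f := fun _ _ => rfl
  let U := Units.oneSub V hV
  have hU1 : ∀ f, (↑U⁻¹ : C(Icc 0 T, W) →L[ℝ] C(Icc 0 T, W)) f -
      V ((↑U⁻¹ : C(Icc 0 T, W) →L[ℝ] C(Icc 0 T, W)) f) = f := fun f => by
    have := congrArg (fun A : C(Icc 0 T, W) →L[ℝ] C(Icc 0 T, W) => A f) U.mul_inv
    simpa [U] using this
  have hU2 : ∀ f, (↑U⁻¹ : C(Icc 0 T, W) →L[ℝ] C(Icc 0 T, W)) (f - V f) = f := fun f => by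
    have := congrArg (fun A : C(Icc 0 T, W) →L[ℝ] C(Icc 0 T, W) => A f) U.inv_mul
    simpa [U] using this
  refine ⟨(M c).comp ((↑U⁻¹ : C(Icc 0 T, W) →L[ℝ] C(Icc 0 T, W)).comp (M (-c))), fun f => ?_,
    fun f u hu => ?_⟩
  · simp only [ContinuousLinearMap.comp_apply]
    have h := congrArg (M c) (hU1 (M (-c) f))
    rw [map_sub] at h
    simp only [hM, hcancel] at h ⊢
    rw [← expMul_volterra]
    exact sub_eq_iff_eq_add.1 h
  · simp only [ContinuousLinearMap.comp_apply]
    have h : M (-c) f = M (-c) u - V (M (-c) u) := by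
      have h1 : f = u - volterra hT N u := eq_sub_of_add_eq hu.symm
      have h2 : M c (V (M (-c) u)) = volterra hT N u := by
        rw [hM, expMul_volterra, hM, hcancel]
      rw [h1, map_sub, ← h2, hM (-c) (M c _), hM c]
      congr 1
      simpa using hcancel (-c) (V (M (-c) u))
    rw [h, hU2, hM, hM, hcancel]

/-- The solution operator `f ↦ u` of the Volterra equation `u = f + 𝒩 u`. -/
def resolvent (hT : 0 ≤ T) (N : C(Icc 0 T × Icc 0 T, W →L[ℝ] W)) :
    C(Icc 0 T, W) →L[ℝ] C(Icc 0 T, W) :=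
  (exists_volterra_resolvent hT N).choose

lemma resolvent_eq (hT : 0 ≤ T) (N : C(Icc 0 T × Icc 0 T, W →L[ℝ] W)) (f : C(Icc 0 T, W)) :
    resolvent hT N f = f + volterra hT N (resolvent hT N f) :=
  (exists_volterra_resolvent hT N).choose_spec.1 f

lemma eq_resolvent (hT : 0 ≤ T) {N : C(Icc 0 T × Icc 0 T, W →L[ℝ] W)} {f u : C(Icc 0 T, W)}
    (h : u = f + volterra hT N u) : u = resolvent hT N f :=
  (exists_volterra_resolvent hT N).choose_spec.2 f u h

end Resolvent

/-! ### Averages and uniform differentiability -/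

section Average

variable {F G : Type*} [NormedAddCommGroup F] [NormedSpace ℝ F] [NormedAddCommGroup G]
  [NormedSpace ℝ G] {m : ℕ}

/-- The average `m⁻¹ ∑ v_i` of finitely many vectors. -/
def avg (v : Fin m → F) : F := (m : ℝ)⁻¹ • ∑ i, v i

lemma norm_avg_le {v : Fin m → F} {M : ℝ} (hM : 0 ≤ M) (hv : ∀ i, ‖v i‖ ≤ M) : ‖avg v‖ ≤ M := by
  rcases Nat.eq_zero_or_pos m with rfl | hm
  · simpa [avg] using hM
  have h : ‖∑ i, v i‖ ≤ m * M := by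
    simpa using norm_sum_le_of_le Finset.univ fun i _ => hv i
  rw [avg, norm_smul, norm_inv, Real.norm_natCast, inv_mul_le_iff₀ (by positivity)]
  exact h

lemma avg_sub (v w : Fin m → F) : (avg fun i => v i - w i) = avg v - avg w := by
  simp [avg, smul_sub]

lemma map_avg (A : F →L[ℝ] G) (v : Fin m → F) : A (avg v) = avg fun i => A (v i) := by
  simp [avg]

end Average

section UniformDifferentiability

variable {E F : Type*} [NormedAddCommGroup E] [NormedSpace ℝ E] [NormedAddCommGroup F]
  [NormedSpace ℝ F]

/-- A continuously differentiable function is differentiable uniformly on compact sets. -/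
lemma exists_forall_norm_sub_sub_fderiv_le {f : E → F} {D K : Set E} (hD : IsOpen D)
    (hf : ContDiffOn ℝ 1 f D) (hK : IsCompact K) (hKD : K ⊆ D) {η : ℝ} (hη : 0 < η) :
    ∃ δ > 0, ∀ y ∈ K, ∀ x, ‖x - y‖ ≤ δ → ‖f x - f y - fderiv ℝ f y (x - y)‖ ≤ η * ‖x - y‖ := by
  obtain ⟨δ₁, hδ₁, h₁⟩ := hK.exists_thickening_subset_open hD hKD
  have hc : ∀ y ∈ K, ContinuousAt (fderiv ℝ f) y := fun y hy =>
    (hf.continuousOn_fderiv_of_isOpen hD le_rfl).continuousAt (hD.mem_nhds (hKD hy))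
  obtain ⟨δ₂, hδ₂, h₂⟩ := Metric.mem_uniformity_dist.1
    (hK.uniformContinuousAt_of_continuousAt _ hc (Metric.dist_mem_uniformity hη))
  refine ⟨min δ₁ δ₂ / 2, by positivity, fun y hy x hx => ?_⟩
  have hlt : ∀ z ∈ Metric.closedBall y (min δ₁ δ₂ / 2), dist z y < δ₁ ∧ dist z y < δ₂ :=
    fun z hz => by
      have hpos : 0 < min δ₁ δ₂ := by positivity
      have := lt_min_iff.1 ((Metric.mem_closedBall.1 hz).trans_lt (half_lt_self hpos))
      exact this
  refine (convex_closedBall y (min δ₁ δ₂ / 2)).norm_image_sub_le_of_norm_fderiv_le' (𝕜 := ℝ)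
    (fun z hz => ?_) (fun z hz => ?_) (Metric.mem_closedBall_self (by positivity))
    (by rwa [Metric.mem_closedBall, dist_eq_norm])
  · have hzD : z ∈ D := h₁ (Metric.mem_thickening_iff.2 ⟨y, hy, (hlt z hz).1⟩)
    exact (hf.differentiableOn one_ne_zero).differentiableAt (hD.mem_nhds hzD)
  · have := h₂ (show dist y z < δ₂ by rw [dist_comm]; exact (hlt z hz).2) hy
    rw [← dist_eq_norm, dist_comm]
    exact le_of_lt this

lemma exists_forall_norm_sub_le {f : E → F} {D K : Set E} (hD : IsOpen D)
    (hf : ContDiffOn ℝ 1 f D) (hK : IsCompact K) (hKD : K ⊆ D) :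
    ∃ L > 0, ∃ δ > 0, ∀ y ∈ K, ∀ x, ‖x - y‖ ≤ δ → ‖f x - f y‖ ≤ L * ‖x - y‖ := by
  obtain ⟨δ, hδ, h⟩ := exists_forall_norm_sub_sub_fderiv_le hD hf hK hKD one_pos
  obtain ⟨M, hM⟩ := hK.exists_bound_of_continuousOn
    ((hf.continuousOn_fderiv_of_isOpen hD le_rfl).mono hKD)
  refine ⟨1 + |M|, by positivity, δ, hδ, fun y hy x hx => ?_⟩
  calc ‖f x - f y‖ = ‖(f x - f y - fderiv ℝ f y (x - y)) + fderiv ℝ f y (x - y)‖ := by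
        rw [sub_add_cancel]
    _ ≤ 1 * ‖x - y‖ + |M| * ‖x - y‖ := norm_add_le_of_le (h y hy x hx)
        ((fderiv ℝ f y).le_of_opNorm_le ((hM y hy).trans (le_abs_self M)) _)
    _ = (1 + |M|) * ‖x - y‖ := by ring

end UniformDifferentiability

/-! ### Grönwall estimates -/

section Gronwall

variable {E : Type*} [NormedAddCommGroup E] [NormedSpace ℝ E]

lemma gronwallBound_zero_eq_mul (K ε x : ℝ) :
    gronwallBound 0 K ε x = ε * gronwallBound 0 K 1 x := by
  unfold gronwallBound
  split_ifs <;> ring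

/-- A quantity whose derivative along the right is at most `K ‖u‖ + ε` and that starts from `0` is
of order `ε`. -/
lemma norm_le_mul_gronwallBound {u u' : ℝ → E} {T K ε : ℝ} (hK : 0 ≤ K) (hε : 0 ≤ ε)
    (hu : ContinuousOn u (Icc 0 T))
    (hu' : ∀ t ∈ Ico 0 T, HasDerivWithinAt u (u' t) (Icc 0 T) t) (h0 : u 0 = 0)
    (hb : ∀ t ∈ Ico 0 T, ‖u' t‖ ≤ K * ‖u t‖ + ε) {t : ℝ} (ht : t ∈ Icc 0 T) :
    ‖u t‖ ≤ ε * gronwallBound 0 K 1 T := by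
  refine (norm_le_gronwallBound_of_norm_deriv_right_le hu (fun x hx =>
    (hu' x hx).mono_of_mem_nhdsWithin (Icc_mem_nhdsGE_of_mem hx))
    (by rw [h0, norm_zero]) hb t ht).trans ?_
  rw [← gronwallBound_zero_eq_mul, sub_zero]
  exact gronwallBound_mono le_rfl hε hK ht.2

lemma gronwallBound_zero_one_nonneg {K x : ℝ} (hK : 0 ≤ K) (hx : 0 ≤ x) :
    0 ≤ gronwallBound 0 K 1 x := by
  have := gronwallBound_mono (δ := 0) (ε := 1) le_rfl zero_le_one hK hx
  rwa [gronwallBound_x0] at this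

end Gronwall

/-! ### Particle systems close to their characteristics -/

section Particles

variable {E W : Type*} [NormedAddCommGroup E] [NormedSpace ℝ E] [NormedAddCommGroup W]
  [NormedSpace ℝ W]

/-- A compact family of characteristics, on the time interval `[0, T]`, of a mean-field system
`y' = b(y, w)` whose field `w = f t` is prescribed. The particles of the system create the field
`w` through the average of the observable `φ`; `b` and `φ` are continuously differentiable. -/
structure IsCharacteristics (D K : Set E) (T : ℝ) (φ : E → W) (b : E × W → E)
    (Y : ℝ → E → E) (f : ℝ → W) : Prop where
  isOpen : IsOpen D
  isCompact : IsCompact K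
  nonneg : 0 ≤ T
  contDiffOn_obs : ContDiffOn ℝ 1 φ D
  contDiffOn_field : ContDiffOn ℝ 1 b (D ×ˢ univ)
  continuousOn : ContinuousOn (fun q : ℝ × E => Y q.1 q.2) (Icc 0 T ×ˢ K)
  mem : ∀ t ∈ Icc 0 T, ∀ θ ∈ K, Y t θ ∈ D
  ode : ∀ t ∈ Icc 0 T, ∀ θ ∈ K, HasDerivWithinAt (fun s => Y s θ) (b (Y t θ, f t)) (Icc 0 T) t
  continuousOn_mean : ContinuousOn f (Icc 0 T)

/-- A system of `m` particles `x_i' = b(x_i, w)` on `[0, T]`, coupled through the field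
`w = m⁻¹ ∑ φ(x_j)`. -/
structure IsParticleSystem (T : ℝ) (φ : E → W) (b : E × W → E) {m : ℕ} (X : Fin m → ℝ → E) :
    Prop where
  ode : ∀ i, ∀ t ∈ Icc 0 T,
    HasDerivWithinAt (X i) (b (X i t, avg fun j => φ (X j t))) (Icc 0 T) t

variable {D K : Set E} {T : ℝ} {φ : E → W} {b : E × W → E} {Y : ℝ → E → E} {f : ℝ → W}

namespace IsCharacteristics

lemma isCompact_image (h : IsCharacteristics D K T φ b Y f) :
    IsCompact ((fun q : ℝ × E => Y q.1 q.2) '' (Icc 0 T ×ˢ K)) :=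
  (isCompact_Icc.prod h.isCompact).image_of_continuousOn h.continuousOn

lemma image_subset (h : IsCharacteristics D K T φ b Y f) :
    (fun q : ℝ × E => Y q.1 q.2) '' (Icc 0 T ×ˢ K) ⊆ D := by
  rintro _ ⟨q, hq, rfl⟩
  exact h.mem _ hq.1 _ hq.2

lemma continuousOn_pair (h : IsCharacteristics D K T φ b Y f) :
    ContinuousOn (fun q : ℝ × E => (Y q.1 q.2, f q.1)) (Icc 0 T ×ˢ K) :=
  h.continuousOn.prodMk (h.continuousOn_mean.comp continuousOn_fst fun _ hq => hq.1)

lemma isCompact_image_pair (h : IsCharacteristics D K T φ b Y f) :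
    IsCompact ((fun q : ℝ × E => (Y q.1 q.2, f q.1)) '' (Icc 0 T ×ˢ K)) :=
  (isCompact_Icc.prod h.isCompact).image_of_continuousOn h.continuousOn_pair

lemma image_pair_subset (h : IsCharacteristics D K T φ b Y f) :
    (fun q : ℝ × E => (Y q.1 q.2, f q.1)) '' (Icc 0 T ×ˢ K) ⊆ D ×ˢ univ := by
  rintro _ ⟨q, hq, rfl⟩
  exact ⟨h.mem _ hq.1 _ hq.2, mem_univ _⟩

/-- Particles that start on the characteristics stay within a distance of order `ε` of them, if
`ε` bounds the fluctuation of the average of the observable along the characteristics. -/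
lemma exists_norm_sub_le (h : IsCharacteristics D K T φ b Y f) :
    ∃ C > 0, ∃ ε₀ > 0, ∀ {m : ℕ} (a : Fin m → E) (X : Fin m → ℝ → E),
      (∀ i, a i ∈ K) → IsParticleSystem T φ b X → (∀ i, X i 0 = Y 0 (a i)) →
      ∀ ε, 0 ≤ ε → ε ≤ ε₀ → (∀ t ∈ Icc 0 T, ‖(avg fun j => φ (Y t (a j))) - f t‖ ≤ ε) →
      ∀ t ∈ Icc 0 T, (∀ i, ‖X i t - Y t (a i)‖ ≤ C * ε) ∧
        ‖(avg fun j => φ (X j t)) - f t‖ ≤ C * ε := by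
  obtain ⟨Lφ, hLφ, δφ, hδφ, hφ⟩ := exists_forall_norm_sub_le h.isOpen h.contDiffOn_obs
    h.isCompact_image h.image_subset
  obtain ⟨Lb, hLb, δb, hδb, hb⟩ := exists_forall_norm_sub_le (h.isOpen.prod isOpen_univ)
    h.contDiffOn_field h.isCompact_image_pair h.image_pair_subset
  set Kg := Lb * (1 + Lφ)
  have hKg : 0 ≤ Kg := by positivity
  set G := gronwallBound 0 Kg 1 T
  have hG : 0 ≤ G := gronwallBound_zero_one_nonneg hKg h.nonneg
  -- the linearization radius, in which the Lipschitz estimates for `φ` and `b` hold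
  set δ := min δφ (δb / (2 * (1 + Lφ)))
  have hδ : 0 < δ := by positivity
  set C := Lb * G with hC
  have hC0 : 0 ≤ C := by positivity
  refine ⟨C + (Lφ * C + 1), by positivity, min (δb / 2) (δ / (C + 1) / 2), by positivity,
    fun {m} a X ha hX h0 ε hε hεle hfl => ?_⟩
  have hε1 : ε ≤ δb / 2 := hεle.trans (min_le_left _ _)
  have hε2 : C * ε < δ := by
    have h1 : ε ≤ δ / (C + 1) / 2 := hεle.trans (min_le_right _ _)
    have h2 : ε < δ / (C + 1) := h1.trans_lt (half_lt_self (by positivity))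
    rw [lt_div_iff₀ (by positivity)] at h2
    nlinarith
  -- the field created by the particles
  have hfield : ∀ t ∈ Icc 0 T, ∀ e, 0 ≤ e → e ≤ δ → (∀ i, ‖X i t - Y t (a i)‖ ≤ e) →
      ‖(avg fun j => φ (X j t)) - f t‖ ≤ Lφ * e + ε := fun t ht e he0 he hi => by
    have h1 : ‖avg fun j => φ (X j t) - φ (Y t (a j))‖ ≤ Lφ * e :=
      norm_avg_le (by positivity) fun j => (hφ _ ⟨(t, a j), ⟨ht, ha j⟩, rfl⟩ _
        ((hi j).trans (he.trans (min_le_left _ _)))).trans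
          (mul_le_mul_of_nonneg_left (hi j) hLφ.le)
    rw [avg_sub] at h1
    calc _ = ‖((avg fun j => φ (X j t)) - avg fun j => φ (Y t (a j))) +
            ((avg fun j => φ (Y t (a j))) - f t)‖ := by rw [sub_add_sub_cancel]
      _ ≤ _ := norm_add_le_of_le h1 (hfl t ht)
  let R : ℝ → Fin m → E := fun t i => X i t - Y t (a i)
  let R' : ℝ → Fin m → E := fun t i =>
    b (X i t, avg fun j => φ (X j t)) - b (Y t (a i), f t)
  have hR : ∀ t ∈ Icc 0 T, HasDerivWithinAt R (R' t) (Icc 0 T) t := fun t ht =>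
    hasDerivWithinAt_pi.2 fun i => (hX.ode i t ht).sub (h.ode t ht _ (ha i))
  have hRc : ContinuousOn R (Icc 0 T) := fun t ht => (hR t ht).continuousWithinAt
  have hR' : ∀ t ∈ Icc 0 T, ‖R t‖ ≤ δ → ‖R' t‖ ≤ Kg * ‖R t‖ + Lb * ε := fun t ht hle => by
    refine (pi_norm_le_iff_of_nonneg (by positivity)).2 fun i => ?_
    have h1 := hfield t ht ‖R t‖ (norm_nonneg _) hle fun i => norm_le_pi_norm (R t) i
    have h2 : ‖(X i t, avg fun j => φ (X j t)) - (Y t (a i), f t)‖ ≤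
        (1 + Lφ) * ‖R t‖ + ε := by
      refine norm_prod_le_iff.2 ⟨?_, ?_⟩
      · have : ‖R t i‖ ≤ ‖R t‖ := norm_le_pi_norm (R t) i
        have h3 : 0 ≤ Lφ * ‖R t‖ := by positivity
        change ‖R t i‖ ≤ _
        linarith
      · have h3 := norm_nonneg (R t)
        change ‖(avg fun j => φ (X j t)) - f t‖ ≤ _
        linarith
    have h3 : (1 + Lφ) * ‖R t‖ + ε ≤ δb := by
      have h4 : ‖R t‖ ≤ δb / (2 * (1 + Lφ)) := hle.trans (min_le_right _ _)
      rw [le_div_iff₀ (by positivity)] at h4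
      linarith
    refine (hb _ ⟨(t, a i), ⟨ht, ha i⟩, rfl⟩ _ (h2.trans h3)).trans ?_
    calc _ ≤ Lb * ((1 + Lφ) * ‖R t‖ + ε) := mul_le_mul_of_nonneg_left h2 hLb.le
      _ = _ := by simp only [Kg]; ring
  have hR0 : R 0 = 0 := by
    ext i
    simp [R, h0 i]
  have hgr : ∀ τ ∈ Icc 0 T, (∀ t ∈ Ico 0 τ, ‖R t‖ ≤ δ) → ∀ t ∈ Icc 0 τ, ‖R t‖ ≤ C * ε :=
    fun τ hτ hle t ht => by
      have hsub : Icc 0 τ ⊆ Icc 0 T := Icc_subset_Icc_right hτ.2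
      have h1 := norm_le_mul_gronwallBound hKg (ε := Lb * ε) (by positivity) (hRc.mono hsub)
        (fun s hs => (hR s (hsub (Ico_subset_Icc_self hs))).mono hsub) hR0
        (fun s hs => hR' s (hsub (Ico_subset_Icc_self hs)) (hle s hs)) ht
      refine h1.trans ?_
      have h2 : gronwallBound 0 Kg 1 τ ≤ G := gronwallBound_mono le_rfl zero_le_one hKg hτ.2
      calc _ ≤ Lb * ε * G := mul_le_mul_of_nonneg_left h2 (by positivity)
        _ = C * ε := by rw [hC]; ring
  -- there is no first time at which the distance reaches `δ`
  have hlt : ∀ t ∈ Icc 0 T, ‖R t‖ < δ := by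
    by_contra! hcon
    have hcl : IsCompact (Icc 0 T ∩ (fun t => ‖R t‖) ⁻¹' Ici δ) :=
      isCompact_Icc.of_isClosed_subset
        (hRc.norm.preimage_isClosed_of_isClosed isClosed_Icc isClosed_Ici) inter_subset_left
    obtain ⟨τ, hτ, hmin⟩ := hcl.exists_isLeast ⟨_, hcon.choose_spec.1, hcon.choose_spec.2⟩
    have h1 := hgr τ hτ.1 (fun t ht => by
      by_contra! h2
      exact absurd (hmin ⟨⟨ht.1, ht.2.le.trans hτ.1.2⟩, h2.le⟩) (not_le.2 ht.2)) τ
      ⟨hτ.1.1, le_rfl⟩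
    exact absurd hτ.2 (not_le.2 (h1.trans_lt hε2))
  intro t ht
  have hfin : ‖R t‖ ≤ C * ε :=
    hgr T ⟨h.nonneg, le_rfl⟩ (fun s hs => (hlt s (Ico_subset_Icc_self hs)).le) t ht
  have hi : ∀ i, ‖X i t - Y t (a i)‖ ≤ C * ε := fun i => (norm_le_pi_norm (R t) i).trans hfin
  have hCε : 0 ≤ C * ε := by positivity
  refine ⟨fun i => (hi i).trans ?_, ?_⟩
  · nlinarith [mul_nonneg hLφ.le hCε]
  · have := hfield t ht (C * ε) hCε hε2.le hi
    nlinarith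
  
end IsCharacteristics

end Particles

/-! ### Fundamental solutions of linear differential equations -/

section Fundamental

variable {E : Type*} [NormedAddCommGroup E] [NormedSpace ℝ E]

/-- `P t θ` is the fundamental solution, normalized at time `0`, of the linear equation
`u' = A(t, θ) u` on `[0, T]`, whose coefficient depends continuously on time and on a parameter
`θ` in a compact set. -/
structure IsFundamental (K : Set E) (T : ℝ) (A P : ℝ → E → E →L[ℝ] E) : Prop where
  isCompact : IsCompact K
  nonneg : 0 ≤ T
  continuousOn : ContinuousOn (fun q : ℝ × E => A q.1 q.2) (Icc 0 T ×ˢ K)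
  init : ∀ θ ∈ K, P 0 θ = ContinuousLinearMap.id ℝ E
  ode : ∀ t ∈ Icc 0 T, ∀ θ ∈ K,
    HasDerivWithinAt (fun s => P s θ) ((A t θ).comp (P t θ)) (Icc 0 T) t

namespace IsFundamental

variable {K : Set E} {T : ℝ} {A P : ℝ → E → E →L[ℝ] E}

lemma exists_bound (h : IsFundamental K T A P) :
    ∃ M, 0 ≤ M ∧ ∀ t ∈ Icc 0 T, ∀ θ ∈ K, ‖A t θ‖ ≤ M := by
  obtain ⟨M, hM⟩ := (isCompact_Icc.prod h.isCompact).exists_bound_of_continuousOn h.continuousOn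
  exact ⟨|M|, abs_nonneg M, fun t ht θ hθ => (hM (t, θ) ⟨ht, hθ⟩).trans (le_abs_self M)⟩

lemma continuousOn_time (h : IsFundamental K T A P) {θ : E} (hθ : θ ∈ K) :
    ContinuousOn (fun s => P s θ) (Icc 0 T) := fun t ht => (h.ode t ht θ hθ).continuousWithinAt

/-- The fundamental solution depends continuously on time and on the parameter. -/
lemma continuousOn_fundamental (h : IsFundamental K T A P) :
    ContinuousOn (fun q : ℝ × E => P q.1 q.2) (Icc 0 T ×ˢ K) := by
  obtain ⟨M, hM0, hM⟩ := h.exists_bound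
  have huc := Metric.uniformContinuousOn_iff.1
    ((isCompact_Icc.prod h.isCompact).uniformContinuousOn_of_continuous h.continuousOn)
  rintro ⟨t₀, θ₀⟩ ⟨ht₀, hθ₀⟩
  obtain ⟨M₀, hM₀⟩ := isCompact_Icc.exists_bound_of_continuousOn (h.continuousOn_time hθ₀)
  have hM₀0 : 0 ≤ M₀ := (norm_nonneg _).trans (hM₀ t₀ ht₀)
  set G := gronwallBound 0 M 1 T
  have hG : 0 ≤ G := gronwallBound_zero_one_nonneg hM0 h.nonneg
  refine Metric.continuousWithinAt_iff.2 fun ε hε => ?_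
  obtain ⟨δ₁, hδ₁, h₁⟩ := huc (ε / 2 / (M₀ * G + 1)) (by positivity)
  obtain ⟨δ₂, hδ₂, h₂⟩ := Metric.continuousWithinAt_iff.1 (h.continuousOn_time hθ₀ t₀ ht₀) (ε / 2)
    (by positivity)
  refine ⟨min δ₁ δ₂, by positivity, ?_⟩
  rintro ⟨t, θ⟩ ⟨ht, hθ⟩ hd
  simp only at ht hθ
  rw [Prod.dist_eq, max_lt_iff] at hd
  have hgr := norm_le_mul_gronwallBound (T := T) (u := fun s => P s θ - P s θ₀)
    (u' := fun s => (A s θ).comp (P s θ) - (A s θ₀).comp (P s θ₀)) hM0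
    (ε := ε / 2 / (M₀ * G + 1) * M₀) (by positivity)
    ((h.continuousOn_time hθ).sub (h.continuousOn_time hθ₀))
    (fun s hs => (h.ode s (Ico_subset_Icc_self hs) θ hθ).sub
      (h.ode s (Ico_subset_Icc_self hs) θ₀ hθ₀))
    (by simp [h.init θ hθ, h.init θ₀ hθ₀]) (fun s hs => by
      have hs' := Ico_subset_Icc_self hs
      have e1 : (A s θ).comp (P s θ) - (A s θ₀).comp (P s θ₀) =
          (A s θ).comp (P s θ - P s θ₀) + (A s θ - A s θ₀).comp (P s θ₀) := by
        simp only [ContinuousLinearMap.comp_sub, ContinuousLinearMap.sub_comp]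
        abel
      rw [e1]
      refine norm_add_le_of_le ?_ ?_
      · exact (ContinuousLinearMap.opNorm_comp_le _ _).trans
          (mul_le_mul_of_nonneg_right (hM s hs' θ hθ) (norm_nonneg _))
      · refine (ContinuousLinearMap.opNorm_comp_le _ _).trans
          (mul_le_mul ?_ (hM₀ s hs') (norm_nonneg _) (by positivity))
        have := h₁ (s, θ) ⟨hs', hθ⟩ (s, θ₀) ⟨hs', hθ₀⟩ (by
          rw [Prod.dist_eq, dist_self]
          exact max_lt hδ₁ (hd.2.trans_le (min_le_left _ _)))
        rw [← dist_eq_norm]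
        exact this.le) ht
  have hgr' : dist (P t θ) (P t θ₀) ≤ ε / 2 := by
    rw [dist_eq_norm]
    refine hgr.trans ?_
    rw [mul_assoc, div_mul_eq_mul_div, div_le_iff₀ (by positivity)]
    have : 0 ≤ ε / 2 := by positivity
    nlinarith
  calc dist (P t θ) (P t₀ θ₀) ≤ dist (P t θ) (P t θ₀) + dist (P t θ₀) (P t₀ θ₀) :=
        dist_triangle _ _ _
    _ < ε / 2 + ε / 2 := add_lt_add_of_le_of_lt hgr' (h₂ ht (hd.1.trans_le (min_le_right _ _)))
    _ = ε := add_halves ε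

lemma lipschitz_field {B : E →L[ℝ] E} {M : ℝ} (hM : ‖B‖ ≤ M) : LipschitzWith M.toNNReal B :=
  B.lipschitz.weaken (by
    rw [← NNReal.coe_le_coe, coe_nnnorm]
    exact hM.trans (Real.le_coe_toNNReal M))

/-- The fundamental solution is injective, by backward uniqueness. -/
lemma injective (h : IsFundamental K T A P) {t : ℝ} (ht : t ∈ Icc 0 T) {θ : E} (hθ : θ ∈ K) :
    Function.Injective (P t θ) := by
  refine (injective_iff_map_eq_zero _).2 fun x hx => ?_
  obtain ⟨M, hM0, hM⟩ := h.exists_bound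
  have hsub : Icc 0 t ⊆ Icc 0 T := Icc_subset_Icc_right ht.2
  have key := ODE_solution_unique_of_mem_Icc_left (a := 0) (b := t) (K := M.toNNReal)
    (v := fun s => A s θ) (s := fun _ => univ) (f := fun s => P s θ x) (g := fun _ => 0)
    (fun s hs => (lipschitz_field (hM s (hsub (Ioc_subset_Icc_self hs)) θ hθ)).lipschitzOnWith)
    (((h.continuousOn_time hθ).mono hsub).clm_apply continuousOn_const)
    (fun s hs => by
      have h1 := ((h.ode s (hsub (Ioc_subset_Icc_self hs)) θ hθ).mono hsub).clm_apply
        (hasDerivWithinAt_const s (Icc 0 t) x)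
      simp only [ContinuousLinearMap.comp_apply, map_zero, add_zero] at h1
      exact h1.mono_of_mem_nhdsWithin (Icc_mem_nhdsLE_of_mem hs))
    (fun _ _ => mem_univ _) continuousOn_const
    (fun s _ => by simpa using! hasDerivWithinAt_const s (Iic s) (0 : E)) (fun _ _ => mem_univ _)
    (by simpa using hx)
  have := key ⟨le_rfl, ht.1⟩
  simpa [h.init θ hθ] using this

variable [FiniteDimensional ℝ E]

lemma isUnit (h : IsFundamental K T A P) {t : ℝ} (ht : t ∈ Icc 0 T) {θ : E} (hθ : θ ∈ K) :
    IsUnit (P t θ) := by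
  have : CompleteSpace E := FiniteDimensional.complete ℝ E
  rw [ContinuousLinearMap.isUnit_iff_bijective]
  have hinj := h.injective ht hθ
  exact ⟨hinj, (LinearMap.injective_iff_surjective (f := (P t θ : E →ₗ[ℝ] E))).1 hinj⟩

lemma apply_inverse_apply (h : IsFundamental K T A P) {t : ℝ} (ht : t ∈ Icc 0 T) {θ : E}
    (hθ : θ ∈ K) (x : E) : P t θ (Ring.inverse (P t θ) x) = x := by
  have := congrArg (fun B : E →L[ℝ] E => B x) (Ring.mul_inverse_cancel _ (h.isUnit ht hθ))
  simpa using this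

lemma continuousOn_inverse (h : IsFundamental K T A P) :
    ContinuousOn (fun q : ℝ × E => Ring.inverse (P q.1 q.2)) (Icc 0 T ×ˢ K) := by
  have : CompleteSpace E := FiniteDimensional.complete ℝ E
  intro q hq
  obtain ⟨u, hu⟩ := h.isUnit hq.1 hq.2
  have h1 : ContinuousAt Ring.inverse (P q.1 q.2) := hu ▸ NormedRing.inverse_continuousAt u
  exact ContinuousAt.comp_continuousWithinAt (f := fun q : ℝ × E => P q.1 q.2) h1
    (h.continuousOn_fundamental q hq)

/-- The solution of the equation normalized at time `s` is obtained from the fundamental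
solution. -/
lemma eq_comp_inverse (h : IsFundamental K T A P) {s : ℝ} (hs : s ∈ Icc 0 T) {θ : E} (hθ : θ ∈ K)
    {Q : ℝ → E →L[ℝ] E} (hQs : Q s = ContinuousLinearMap.id ℝ E)
    (hQ : ∀ t ∈ Icc s T, HasDerivWithinAt Q ((A t θ).comp (Q t)) (Icc s T) t) {t : ℝ}
    (ht : t ∈ Icc s T) : Q t = (P t θ).comp (Ring.inverse (P s θ)) := by
  obtain ⟨M, hM0, hM⟩ := h.exists_bound
  have hsub : Icc s T ⊆ Icc 0 T := Icc_subset_Icc_left hs.1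
  have hd : ∀ x ∈ Icc s T, HasDerivWithinAt
      (fun x => Q x - (P x θ).comp (Ring.inverse (P s θ)))
      ((A x θ).comp (Q x - (P x θ).comp (Ring.inverse (P s θ)))) (Icc s T) x := fun x hx => by
    have h1 := ((h.ode x (hsub hx) θ hθ).mono hsub).clm_comp
      (hasDerivWithinAt_const x (Icc s T) (Ring.inverse (P s θ)))
    have h2 := (hQ x hx).fun_sub h1
    simp only [ContinuousLinearMap.comp_zero, add_zero] at h2
    rwa [ContinuousLinearMap.comp_assoc, ← ContinuousLinearMap.comp_sub] at h2
  have key := eq_zero_of_abs_deriv_le_mul_abs_self_of_eq_zero_right (K := M)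
    (fun x hx => (hd x hx).continuousWithinAt)
    (fun x hx => (hd x (Ico_subset_Icc_self hx)).mono_of_mem_nhdsWithin
      (Icc_mem_nhdsGE_of_mem hx)) (by
      have := Ring.mul_inverse_cancel _ (h.isUnit hs hθ)
      rw [hQs, sub_eq_zero]
      exact this.symm)
    (fun x hx => (ContinuousLinearMap.opNorm_comp_le _ _).trans
      (mul_le_mul_of_nonneg_right (hM x (hsub (Ico_subset_Icc_self hx)) θ hθ) (norm_nonneg _)))
  exact sub_eq_zero.1 (key t ht)

/-- **Variation of constants.** -/
lemma hasDerivWithinAt_variation (h : IsFundamental K T A P) {θ : E} (hθ : θ ∈ K) {v : ℝ → E}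
    (hv : ContinuousOn v (Icc 0 T)) {t : ℝ} (ht : t ∈ Icc 0 T) :
    HasDerivWithinAt
      (fun t => P t θ (∫ s in (0 : ℝ)..t, Ring.inverse (P s θ) (v s)))
      (A t θ (P t θ (∫ s in (0 : ℝ)..t, Ring.inverse (P s θ) (v s))) + v t) (Icc 0 T) t := by
  have : CompleteSpace E := FiniteDimensional.complete ℝ E
  have hc : ContinuousOn (fun s => Ring.inverse (P s θ) (v s)) (Icc 0 T) :=
    (h.continuousOn_inverse.comp (continuousOn_id.prodMk continuousOn_const)
      (fun s hs => ⟨hs, hθ⟩)).clm_apply hv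
  have hint : IntervalIntegrable (fun s => Ring.inverse (P s θ) (v s)) volume 0 t :=
    (hc.mono (by rw [uIcc_of_le ht.1]; exact Icc_subset_Icc_right ht.2)).intervalIntegrable
  have : Fact (t ∈ Icc 0 T) := ⟨ht⟩
  have hF : HasDerivWithinAt (fun t => ∫ s in (0 : ℝ)..t, Ring.inverse (P s θ) (v s))
      (Ring.inverse (P t θ) (v t)) (Icc 0 T) t :=
    intervalIntegral.integral_hasDerivWithinAt_right hint
      (hc.stronglyMeasurableAtFilter_nhdsWithin measurableSet_Icc t) (hc t ht)
  have := (h.ode t ht θ hθ).clm_apply hF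
  rwa [h.apply_inverse_apply ht hθ] at this

end IsFundamental

end Fundamental

/-! ### Linear response of a particle system -/

section LinearResponse

variable {E W F : Type*} [NormedAddCommGroup E] [NormedSpace ℝ E]
  [NormedAddCommGroup W] [NormedSpace ℝ W] [NormedAddCommGroup F] [NormedSpace ℝ F]

/-- The derivative of the field `b(y, w)` in `y` along the characteristics. -/
def fieldDeriv (b : E × W → E) (Y : ℝ → E → E) (f : ℝ → W) (t : ℝ) (θ : E) : E →L[ℝ] E :=
  (fderiv ℝ b (Y t θ, f t)).comp (ContinuousLinearMap.inl ℝ E W)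

/-- The derivative of the field `b(y, w)` in `w` along the characteristics. -/
def meanDeriv (b : E × W → E) (Y : ℝ → E → E) (f : ℝ → W) (t : ℝ) (θ : E) : W →L[ℝ] E :=
  (fderiv ℝ b (Y t θ, f t)).comp (ContinuousLinearMap.inr ℝ E W)

/-- The response at time `t` of the observable `ψ`, on the characteristic started from `θ`, to a
perturbation of the mean field at time `s`: the perturbation acts on the velocity at time `s` and is
transported to time `t` by the propagator `P_t P_s⁻¹`. The junk value of `Ring.inverse` does not
occur, since fundamental solutions are invertible. -/
def responseKernel (b : E × W → E) (Y : ℝ → E → E) (f : ℝ → W) (P : ℝ → E → E →L[ℝ] E)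
    (ψ : E → F) (t s : ℝ) (θ : E) : W →L[ℝ] F :=
  (fderiv ℝ ψ (Y t θ)).comp
    ((P t θ).comp ((Ring.inverse (P s θ)).comp (meanDeriv b Y f s θ)))

lemma IsParticleSystem.continuousOn_avg {D : Set E} {T : ℝ} {φ : E → W} {b : E × W → E} {m : ℕ}
    {X : Fin m → ℝ → E} (hX : IsParticleSystem T φ b X) {ψ : E → F} (hψ : ContinuousOn ψ D)
    (hXD : ∀ i, ∀ t ∈ Icc 0 T, X i t ∈ D) :
    ContinuousOn (fun t => avg fun j => ψ (X j t)) (Icc 0 T) := by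
  refine ContinuousOn.const_smul (continuousOn_finsetSum _ fun j _ => ?_) _
  exact hψ.comp (fun t ht => (hX.ode j t ht).continuousWithinAt) (hXD j)

namespace IsCharacteristics

variable {D K : Set E} {T : ℝ} {φ : E → W} {b : E × W → E} {Y : ℝ → E → E} {f : ℝ → W}
  {P : ℝ → E → E →L[ℝ] E}

lemma continuousOn_fderiv_field (h : IsCharacteristics D K T φ b Y f) :
    ContinuousOn (fun q : ℝ × E => fderiv ℝ b (Y q.1 q.2, f q.1)) (Icc 0 T ×ˢ K) :=
  (h.contDiffOn_field.continuousOn_fderiv_of_isOpen (h.isOpen.prod isOpen_univ) le_rfl).comp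
    h.continuousOn_pair fun _ hq => ⟨h.mem _ hq.1 _ hq.2, mem_univ _⟩

lemma continuousOn_meanDeriv (h : IsCharacteristics D K T φ b Y f) :
    ContinuousOn (fun q : ℝ × E => meanDeriv b Y f q.1 q.2) (Icc 0 T ×ˢ K) :=
  h.continuousOn_fderiv_field.clm_comp continuousOn_const

lemma continuousOn_fieldDeriv (h : IsCharacteristics D K T φ b Y f) :
    ContinuousOn (fun q : ℝ × E => fieldDeriv b Y f q.1 q.2) (Icc 0 T ×ˢ K) :=
  h.continuousOn_fderiv_field.clm_comp continuousOn_const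

variable [FiniteDimensional ℝ E]

lemma continuousOn_responseKernel (h : IsCharacteristics D K T φ b Y f)
    (hP : IsFundamental K T (fieldDeriv b Y f) P) {ψ : E → F} (hψ : ContDiffOn ℝ 1 ψ D) :
    ContinuousOn (fun q : E × Icc 0 T × Icc 0 T =>
      responseKernel b Y f P ψ q.2.1 q.2.2 q.1) (K ×ˢ univ) := by
  have h1 : ContinuousOn (fun q : E × Icc (0 : ℝ) T × Icc (0 : ℝ) T => ((q.2.1 : ℝ), q.1))
      (K ×ˢ univ) := by fun_prop
  have h2 : ContinuousOn (fun q : E × Icc (0 : ℝ) T × Icc (0 : ℝ) T => ((q.2.2 : ℝ), q.1))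
      (K ×ˢ univ) := by fun_prop
  have m1 : MapsTo (fun q : E × Icc (0 : ℝ) T × Icc (0 : ℝ) T => ((q.2.1 : ℝ), q.1))
      (K ×ˢ univ) (Icc 0 T ×ˢ K) := fun q hq => ⟨q.2.1.2, hq.1⟩
  have m2 : MapsTo (fun q : E × Icc (0 : ℝ) T × Icc (0 : ℝ) T => ((q.2.2 : ℝ), q.1))
      (K ×ˢ univ) (Icc 0 T ×ˢ K) := fun q hq => ⟨q.2.2.2, hq.1⟩
  have hψ' : ContinuousOn (fun q : ℝ × E => fderiv ℝ ψ (Y q.1 q.2)) (Icc 0 T ×ˢ K) :=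
    (hψ.continuousOn_fderiv_of_isOpen h.isOpen le_rfl).comp h.continuousOn
      fun q hq => h.mem _ hq.1 _ hq.2
  exact (hψ'.comp h1 m1).clm_comp ((hP.continuousOn_fundamental.comp h1 m1).clm_comp
    ((hP.continuousOn_inverse.comp h2 m2).clm_comp (h.continuousOn_meanDeriv.comp h2 m2)))

/-- To first order, the displacement of a particle from its characteristic is the response of the
linearized flow to the deviation of the field. -/
lemma exists_norm_sub_sub_variation_le (h : IsCharacteristics D K T φ b Y f)
    (hP : IsFundamental K T (fieldDeriv b Y f) P) {η : ℝ} (hη : 0 < η) :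
    ∃ ε₁ > 0, ∀ {m : ℕ} (a : Fin m → E) (X : Fin m → ℝ → E),
      (∀ i, a i ∈ K) → (∀ i, ∀ t ∈ Icc 0 T, X i t ∈ D) → IsParticleSystem T φ b X →
      (∀ i, X i 0 = Y 0 (a i)) →
      ∀ ε, 0 ≤ ε → ε ≤ ε₁ → (∀ t ∈ Icc 0 T, ‖(avg fun j => φ (Y t (a j))) - f t‖ ≤ ε) →
      ∀ t ∈ Icc 0 T, ∀ i, ‖X i t - Y t (a i) - P t (a i) (∫ s in (0 : ℝ)..t,
        Ring.inverse (P s (a i)) (meanDeriv b Y f s (a i) ((avg fun j => φ (X j s)) - f s)))‖ ≤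
          η * ε := by
  obtain ⟨C, hC, ε₀, hε₀, hapriori⟩ := h.exists_norm_sub_le
  obtain ⟨M, hM0, hM⟩ := hP.exists_bound
  set G := gronwallBound 0 M 1 T
  have hG : 0 ≤ G := gronwallBound_zero_one_nonneg hM0 h.nonneg
  obtain ⟨δb, hδb, hb⟩ := exists_forall_norm_sub_sub_fderiv_le (h.isOpen.prod isOpen_univ)
    h.contDiffOn_field h.isCompact_image_pair h.image_pair_subset
    (η := η / (C * G + 1)) (by positivity)
  refine ⟨min ε₀ (δb / C), by positivity, fun {m} a X ha hXD hX h0 ε hε hεle hfl t ht i => ?_⟩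
  have hCε : C * ε ≤ δb := by
    have := hεle.trans (min_le_right _ _)
    rwa [le_div_iff₀ hC, mul_comm] at this
  have hap := hapriori a X ha hX h0 ε hε (hεle.trans (min_le_left _ _)) hfl
  set δ : ℝ → W := fun s => (avg fun j => φ (X j s)) - f s with hδ
  have hδc : ContinuousOn δ (Icc 0 T) :=
    (hX.continuousOn_avg h.contDiffOn_obs.continuousOn hXD).sub h.continuousOn_mean
  have hsec : MapsTo (fun s : ℝ => (s, a i)) (Icc 0 T) (Icc 0 T ×ˢ K) := fun s hs => ⟨hs, ha i⟩
  have hvc : ContinuousOn (fun s => meanDeriv b Y f s (a i) (δ s)) (Icc 0 T) :=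
    (h.continuousOn_meanDeriv.comp (continuousOn_id.prodMk continuousOn_const) hsec).clm_apply hδc
  have hL : ∀ s ∈ Icc 0 T, _ := fun s hs => hP.hasDerivWithinAt_variation (ha i) hvc hs
  set L : ℝ → E := fun t => P t (a i) (∫ s in (0 : ℝ)..t,
    Ring.inverse (P s (a i)) (meanDeriv b Y f s (a i) (δ s)))
  have hU : ∀ s ∈ Icc 0 T, HasDerivWithinAt (fun s => X i s - Y s (a i) - L s)
      (b (X i s, avg fun j => φ (X j s)) - b (Y s (a i), f s) -
        (fieldDeriv b Y f s (a i) (L s) + meanDeriv b Y f s (a i) (δ s))) (Icc 0 T) s :=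
    fun s hs => ((hX.ode i s hs).fun_sub (h.ode s hs _ (ha i))).fun_sub (hL s hs)
  have hgr := norm_le_mul_gronwallBound hM0 (ε := η / (C * G + 1) * (C * ε)) (by positivity)
    (fun s hs => (hU s hs).continuousWithinAt) (fun s hs => hU s (Ico_subset_Icc_self hs))
    (by simp [h0 i, L]) (fun s hs => by
      have hs' := Ico_subset_Icc_self hs
      have hdist : ‖(X i s, avg fun j => φ (X j s)) - (Y s (a i), f s)‖ ≤ C * ε :=
        norm_prod_le_iff.2 ⟨(hap s hs').1 i, (hap s hs').2⟩
      have h1 := hb _ ⟨(s, a i), ⟨hs', ha i⟩, rfl⟩ _ (hdist.trans hCε)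
      have h2 : fderiv ℝ b (Y s (a i), f s)
          ((X i s, avg fun j => φ (X j s)) - (Y s (a i), f s)) =
          fieldDeriv b Y f s (a i) (X i s - Y s (a i)) + meanDeriv b Y f s (a i) (δ s) := by
        simp only [fieldDeriv, meanDeriv, ContinuousLinearMap.comp_apply, ← map_add, hδ]
        simp
      simp only at h1
      rw [h2] at h1
      have e1 : b (X i s, avg fun j => φ (X j s)) - b (Y s (a i), f s) -
          (fieldDeriv b Y f s (a i) (L s) + meanDeriv b Y f s (a i) (δ s)) =
          fieldDeriv b Y f s (a i) (X i s - Y s (a i) - L s) +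
          (b (X i s, avg fun j => φ (X j s)) - b (Y s (a i), f s) -
          (fieldDeriv b Y f s (a i) (X i s - Y s (a i)) + meanDeriv b Y f s (a i) (δ s))) := by
        rw [map_sub (fieldDeriv b Y f s (a i)) (X i s - Y s (a i))]
        abel
      rw [e1]
      refine norm_add_le_of_le ?_ (h1.trans (mul_le_mul_of_nonneg_left hdist (by positivity)))
      exact ContinuousLinearMap.le_of_opNorm_le _ (hM s hs' _ (ha i)) _) ht
  refine hgr.trans ?_
  calc η / (C * G + 1) * (C * ε) * G = η * ε * (C * G / (C * G + 1)) := by ring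
    _ ≤ η * ε * 1 := by
      refine mul_le_mul_of_nonneg_left ?_ (by positivity)
      rw [div_le_one (by positivity)]
      linarith
    _ = η * ε := mul_one _

variable [CompleteSpace F]

/-- To first order, the deviation of the average of an observable `ψ` is the response to the
deviation `δ` of the field. -/
lemma exists_norm_avg_sub_avg_sub_volterra_le (h : IsCharacteristics D K T φ b Y f)
    (hP : IsFundamental K T (fieldDeriv b Y f) P) {ψ : E → F} (hψ : ContDiffOn ℝ 1 ψ D)
    {η : ℝ} (hη : 0 < η) :
    ∃ ε₁ > 0, ∀ {m : ℕ} (a : Fin m → E) (X : Fin m → ℝ → E),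
      (∀ i, a i ∈ K) → (∀ i, ∀ t ∈ Icc 0 T, X i t ∈ D) → IsParticleSystem T φ b X →
      (∀ i, X i 0 = Y 0 (a i)) →
      ∀ ε, 0 ≤ ε → ε ≤ ε₁ → (∀ t ∈ Icc 0 T, ‖(avg fun j => φ (Y t (a j))) - f t‖ ≤ ε) →
      ∀ (δ : C(Icc 0 T, W)) (N : Fin m → C(Icc 0 T × Icc 0 T, W →L[ℝ] F)),
      (∀ t : Icc 0 T, δ t = (avg fun j => φ (X j t)) - f t) →
      (∀ i q, N i q = responseKernel b Y f P ψ q.1 q.2 (a i)) →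
      ∀ t : Icc 0 T, ‖(avg fun j => ψ (X j t)) - (avg fun j => ψ (Y t (a j))) -
        volterra h.nonneg (avg N) δ t‖ ≤ η * ε := by
  obtain ⟨C, hC, ε₀, hε₀, hapriori⟩ := h.exists_norm_sub_le
  obtain ⟨M', hM'⟩ := h.isCompact_image.exists_bound_of_continuousOn
    ((hψ.continuousOn_fderiv_of_isOpen h.isOpen le_rfl).mono h.image_subset)
  set M := |M'|
  have hM : ∀ t ∈ Icc 0 T, ∀ θ ∈ K, ‖fderiv ℝ ψ (Y t θ)‖ ≤ M := fun t ht θ hθ =>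
    (hM' _ ⟨(t, θ), ⟨ht, hθ⟩, rfl⟩).trans (le_abs_self _)
  have hM0 : 0 ≤ M := abs_nonneg _
  obtain ⟨δψ, hδψ, hψd⟩ := exists_forall_norm_sub_sub_fderiv_le h.isOpen hψ h.isCompact_image
    h.image_subset (η := η / 2 / C) (by positivity)
  obtain ⟨ε₁, hε₁, hlin⟩ := h.exists_norm_sub_sub_variation_le hP (η := η / 2 / (M + 1))
    (by positivity)
  refine ⟨min ε₁ (min ε₀ (δψ / C)), by positivity,
    fun {m} a X ha hXD hX h0 ε hε hεle hfl δ N hδ hN t => ?_⟩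
  obtain ⟨hεle₁, hεle₂, hεle₃⟩ := le_min_iff.1 hεle |>.imp_right le_min_iff.1
  have hCε : C * ε ≤ δψ := by
    rwa [le_div_iff₀ hC, mul_comm] at hεle₃
  have hap := hapriori a X ha hX h0 ε hε hεle₂ hfl
  have hlin' := hlin a X ha hXD hX h0 ε hε hεle₁ hfl t t.2
  set L : Fin m → E := fun i => P t (a i) (∫ s in (0 : ℝ)..t, Ring.inverse (P s (a i))
    (meanDeriv b Y f s (a i) ((avg fun j => φ (X j s)) - f s))) with hL
  have : CompleteSpace E := FiniteDimensional.complete ℝ E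
  have hvolt : ∀ i, volterra h.nonneg (N i) δ t = fderiv ℝ ψ (Y t (a i)) (L i) := fun i => by
    have hc : ContinuousOn (fun s => Ring.inverse (P s (a i))
        (meanDeriv b Y f s (a i) ((avg fun j => φ (X j s)) - f s))) (Icc 0 T) := by
      have hsec : MapsTo (fun s : ℝ => (s, a i)) (Icc 0 T) (Icc 0 T ×ˢ K) :=
        fun s hs => ⟨hs, ha i⟩
      refine (hP.continuousOn_inverse.comp (continuousOn_id.prodMk continuousOn_const)
        hsec).clm_apply ?_
      exact (h.continuousOn_meanDeriv.comp (continuousOn_id.prodMk continuousOn_const)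
        hsec).clm_apply
        ((hX.continuousOn_avg h.contDiffOn_obs.continuousOn hXD).sub h.continuousOn_mean)
    have hint : IntervalIntegrable (fun s => Ring.inverse (P s (a i))
        (meanDeriv b Y f s (a i) ((avg fun j => φ (X j s)) - f s))) volume 0 t :=
      (hc.mono (by rw [uIcc_of_le t.2.1]; exact Icc_subset_Icc_right t.2.2)).intervalIntegrable
    rw [hL, ← ContinuousLinearMap.comp_apply,
      ← ContinuousLinearMap.intervalIntegral_comp_comm _ hint]
    refine volterra_eq_of_eqOn _ fun s hs _ => ?_
    rw [hN, hδ]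
    rfl
  have hsum : volterra h.nonneg (avg N) δ t = avg fun i => fderiv ℝ ψ (Y t (a i)) (L i) := by
    have h1 : volterra h.nonneg (avg N) δ t = avg fun i => volterra h.nonneg (N i) δ t := by
      simp only [volterra_apply, avg]
      rw [← intervalIntegral.integral_finsetSum, ← intervalIntegral.integral_smul]
      · simp
      · refine fun i _ => Continuous.intervalIntegrable ?_ _ _
        refine Continuous.clm_apply ?_ ?_
        · exact (ContinuousMap.continuous _).comp (continuous_const.prodMk continuous_projIcc)
        · exact (ContinuousMap.continuous _).comp continuous_projIcc
    rw [h1]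
    simp_rw [hvolt]
  rw [hsum, ← avg_sub, ← avg_sub]
  refine norm_avg_le (by positivity) fun i => ?_
  have h1 := hψd _ ⟨(t.1, a i), ⟨t.2, ha i⟩, rfl⟩ (X i t) (((hap t t.2).1 i).trans hCε)
  have h2 := (fderiv ℝ ψ (Y t (a i))).le_of_opNorm_le (hM t t.2 _ (ha i)) _ |>.trans
    (mul_le_mul_of_nonneg_left (hlin' i) hM0)
  have e1 : ψ (X i t) - ψ (Y t (a i)) - fderiv ℝ ψ (Y t (a i)) (L i) =
      (ψ (X i t) - ψ (Y t (a i)) - fderiv ℝ ψ (Y t (a i)) (X i t - Y t (a i))) +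
      fderiv ℝ ψ (Y t (a i)) (X i t - Y t (a i) - L i) := by
    rw [map_sub _ (X i t - Y t (a i)) (L i)]
    abel
  rw [e1]
  refine (norm_add_le_of_le h1 h2).trans ?_
  have h3 : η / 2 / C * ‖X i t - Y t (a i)‖ ≤ η / 2 * ε :=
    (mul_le_mul_of_nonneg_left ((hap t t.2).1 i) (by positivity)).trans (by
      rw [div_mul_eq_mul_div, ← mul_assoc, mul_comm _ C, mul_assoc, mul_div_cancel_left₀ _ hC.ne'])
  have h4 : M * (η / 2 / (M + 1) * ε) ≤ η / 2 * ε := by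
    calc M * (η / 2 / (M + 1) * ε) = M / (M + 1) * (η / 2 * ε) := by ring
      _ ≤ 1 * (η / 2 * ε) := by
        refine mul_le_mul_of_nonneg_right ?_ (by positivity)
        rw [div_le_one (by positivity)]
        linarith
      _ = _ := one_mul _
  linarith

/-- **Linear response.** Let `N i` and `Nψ i` be the response kernels of the observables `φ` and
`ψ` on the characteristics of the particles, let `N₀` and `Nψ₀` be close to their averages, and let
`G` be the small deviation of the average of `φ` along the characteristics. To first order in `G`,
the displacement of the average of `ψ` is `V_ψ (1 - V)⁻¹ G`, for the Volterra operators `V` and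
`V_ψ` with kernels `N₀` and `Nψ₀`. -/
lemma exists_linear_response [CompleteSpace W] (h : IsCharacteristics D K T φ b Y f)
    (hP : IsFundamental K T (fieldDeriv b Y f) P) {ψ : E → F} (hψ : ContDiffOn ℝ 1 ψ D)
    (N₀ : C(Icc 0 T × Icc 0 T, W →L[ℝ] W)) (Nψ₀ : C(Icc 0 T × Icc 0 T, W →L[ℝ] F))
    {η : ℝ} (hη : 0 < η) :
    ∃ ε₁ > 0, ∀ {m : ℕ} (a : Fin m → E) (X : Fin m → ℝ → E),
      (∀ i, a i ∈ K) → (∀ i, ∀ t ∈ Icc 0 T, X i t ∈ D) → IsParticleSystem T φ b X →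
      (∀ i, X i 0 = Y 0 (a i)) →
      ∀ (G : C(Icc 0 T, W)) (N : Fin m → C(Icc 0 T × Icc 0 T, W →L[ℝ] W))
        (Nψ : Fin m → C(Icc 0 T × Icc 0 T, W →L[ℝ] F)),
      (∀ t : Icc 0 T, G t = (avg fun j => φ (Y t (a j))) - f t) →
      (∀ i q, N i q = responseKernel b Y f P φ q.1 q.2 (a i)) →
      (∀ i q, Nψ i q = responseKernel b Y f P ψ q.1 q.2 (a i)) →
      ‖G‖ ≤ ε₁ → ‖avg N - N₀‖ ≤ ε₁ → ‖avg Nψ - Nψ₀‖ ≤ ε₁ →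
      ∀ t : Icc 0 T, ‖(avg fun j => ψ (X j t)) - (avg fun j => ψ (Y t (a j))) -
        volterra h.nonneg Nψ₀ (resolvent h.nonneg N₀ G) t‖ ≤ η * ‖G‖ := by
  obtain ⟨C, hC, ε₀, hε₀, hapriori⟩ := h.exists_norm_sub_le
  set Q := ‖(volterra h.nonneg Nψ₀).comp (resolvent h.nonneg N₀)‖
  have hQ : 0 ≤ Q := ContinuousLinearMap.opNorm_nonneg _
  have hT := h.nonneg
  obtain ⟨ε₂, hε₂, hφe⟩ := h.exists_norm_avg_sub_avg_sub_volterra_le hP h.contDiffOn_obs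
    (η := η / 2 / (1 + Q)) (by positivity)
  obtain ⟨ε₃, hε₃, hψe⟩ := h.exists_norm_avg_sub_avg_sub_volterra_le hP hψ
    (η := η / 2 / (1 + Q)) (by positivity)
  refine ⟨min (min ε₂ ε₃) (min ε₀ (η / 2 / (1 + Q) / (T * C + 1))), by positivity,
    fun {m} a X ha hXD hX h0 G N Nψ hG hN hNψ hle hle' hle'' t => ?_⟩
  have hfl : ∀ t ∈ Icc 0 T, ‖(avg fun j => φ (Y t (a j))) - f t‖ ≤ ‖G‖ := fun t ht => by
    rw [← hG ⟨t, ht⟩]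
    exact G.norm_coe_le_norm _
  obtain ⟨⟨hle₂, hle₃⟩, hle₀, -⟩ := le_min_iff.1 hle |>.imp le_min_iff.1 le_min_iff.1
  have hκ := hle'.trans ((min_le_right _ _).trans (min_le_right _ _))
  have hκψ := hle''.trans ((min_le_right _ _).trans (min_le_right _ _))
  have hap := hapriori a X ha hX h0 ‖G‖ (norm_nonneg _) hle₀ hfl
  let δ : C(Icc 0 T, W) := ⟨fun t => (avg fun j => φ (X j t)) - f t,
    ((hX.continuousOn_avg h.contDiffOn_obs.continuousOn hXD).sub h.continuousOn_mean).domRestrict⟩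
  have hδ : ∀ t : Icc 0 T, δ t = (avg fun j => φ (X j t)) - f t := fun _ => rfl
  have hδn : ‖δ‖ ≤ C * ‖G‖ :=
    (ContinuousMap.norm_le _ (by positivity)).2 fun s => (hap s s.2).2
  -- replacing the averaged kernels by `N₀` and `Nψ₀`
  have hrep : ∀ κ, 0 ≤ κ → κ ≤ η / 2 / (1 + Q) / (T * C + 1) →
      T * κ * ‖δ‖ ≤ η / 2 / (1 + Q) * ‖G‖ := fun κ hκ0 hκ => by
    rw [le_div_iff₀ (by positivity)] at hκ
    calc T * κ * ‖δ‖ ≤ T * κ * (C * ‖G‖) := mul_le_mul_of_nonneg_left hδn (by positivity)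
      _ = κ * (T * C) * ‖G‖ := by ring
      _ ≤ κ * (T * C + 1) * ‖G‖ := by gcongr; linarith
      _ ≤ _ := mul_le_mul_of_nonneg_right hκ (norm_nonneg _)
  set ρ := δ - G - volterra hT N₀ δ with hρ
  have hρn : ‖ρ‖ ≤ η / (1 + Q) * ‖G‖ := by
    have h1 : ‖δ - G - volterra hT (avg N) δ‖ ≤ η / 2 / (1 + Q) * ‖G‖ := by
      refine (ContinuousMap.norm_le _ (by positivity)).2 fun s => ?_
      have := hφe a X ha hXD hX h0 ‖G‖ (norm_nonneg _) hle₂ hfl δ N hδ hN s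
      simpa only [ContinuousMap.sub_apply, hδ, hG, sub_sub_sub_cancel_right] using this
    have h2 : ‖volterra hT (avg N - N₀) δ‖ ≤ η / 2 / (1 + Q) * ‖G‖ :=
      (norm_volterra_apply_le hT _ _).trans (hrep _ (by positivity) hκ)
    have e : ρ = (δ - G - volterra hT (avg N) δ) + volterra hT (avg N - N₀) δ := by
      rw [hρ, volterra_sub_kernel]
      abel
    rw [e]
    refine (norm_add_le_of_le h1 h2).trans (le_of_eq ?_)
    ring
  have hδ' : δ = resolvent hT N₀ (G + ρ) := eq_resolvent hT (by rw [hρ]; abel)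
  have h1 := hψe a X ha hXD hX h0 ‖G‖ (norm_nonneg _) hle₃ hfl δ Nψ hδ hNψ t
  have h2 : ‖volterra hT (avg Nψ - Nψ₀) δ t‖ ≤ η / 2 / (1 + Q) * ‖G‖ :=
    (ContinuousMap.norm_coe_le_norm _ t).trans
      ((norm_volterra_apply_le hT _ _).trans (hrep _ (by positivity) hκψ))
  have h3 : ‖volterra hT Nψ₀ (resolvent hT N₀ ρ) t‖ ≤ Q * (η / (1 + Q) * ‖G‖) :=
    (ContinuousMap.norm_coe_le_norm _ t).trans
      ((((volterra hT Nψ₀).comp (resolvent hT N₀)).le_opNorm ρ).trans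
        (mul_le_mul_of_nonneg_left hρn hQ))
  have e : (avg fun j => ψ (X j t)) - (avg fun j => ψ (Y t (a j))) -
      volterra hT Nψ₀ (resolvent hT N₀ G) t =
      ((avg fun j => ψ (X j t)) - (avg fun j => ψ (Y t (a j))) - volterra hT (avg Nψ) δ t) +
      volterra hT (avg Nψ - Nψ₀) δ t + volterra hT Nψ₀ (resolvent hT N₀ ρ) t := by
    have e1 : volterra hT Nψ₀ δ t = volterra hT Nψ₀ (resolvent hT N₀ G) t +
        volterra hT Nψ₀ (resolvent hT N₀ ρ) t := by
      conv_lhs => rw [hδ', map_add, map_add]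
      rfl
    rw [volterra_sub_kernel, ContinuousMap.sub_apply, e1]
    abel
  rw [e]
  refine (norm_add_le_of_le (norm_add_le_of_le h1 h2) h3).trans (le_of_eq ?_)
  field_simp
  ring

end IsCharacteristics

end LinearResponse

/-! ### Families of continuous functions -/

section ToC

variable {X F E : Type*} [TopologicalSpace X] [NormedAddCommGroup F] [TopologicalSpace E]

open Classical in
/-- The function `g`, bundled as a continuous map; the junk value is `0` if `g` is not
continuous. -/
def toC (g : X → F) : C(X, F) := if h : Continuous g then ⟨g, h⟩ else 0

lemma toC_apply {g : X → F} (h : Continuous g) (x : X) : toC g x = g x := by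
  rw [toC, dif_pos h]
  rfl

lemma toC_apply_of_continuousOn {T : ℝ} {f : ℝ → F} (hf : ContinuousOn f (Icc 0 T))
    (t : Icc 0 T) : toC (fun t : Icc 0 T => f t) t = f t :=
  toC_apply (g := fun t : Icc 0 T => f t) (continuousOn_iff_continuous_domRestrict.1 hf) t

lemma continuous_section {K : Set E} {g : E × X → F} (hg : ContinuousOn g (K ×ˢ univ)) {θ : E}
    (hθ : θ ∈ K) : Continuous fun x => g (θ, x) :=
  continuousOn_univ.1 (hg.comp (f := fun x : X => (θ, x)) (by fun_prop)
    (s := univ) fun x _ => ⟨hθ, mem_univ x⟩)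

/-- A jointly continuous function defines a continuous family of continuous functions. -/
lemma continuousOn_toC {K : Set E} {g : E × X → F} (hg : ContinuousOn g (K ×ˢ univ)) :
    ContinuousOn (fun θ => toC fun x => g (θ, x)) K := by
  rw [continuousOn_iff_continuous_domRestrict]
  have hc : Continuous fun q : K × X => g (q.1, q.2) :=
    continuousOn_univ.1 (hg.comp (f := fun q : K × X => ((q.1 : E), q.2)) (by fun_prop)
      (s := univ) fun q _ => ⟨q.1.2, mem_univ q.2⟩)
  have h1 : K.domRestrict (fun θ => toC fun x => g (θ, x)) =
      (ContinuousMap.curry ⟨_, hc⟩ : C(K, C(X, F))) := by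
    ext θ x
    exact toC_apply (continuous_section hg θ.2) x
  rw [h1]
  exact ContinuousMap.continuous _

end ToC

/-! ### Approximation of continuous curves of functions -/

section Approximation

variable {E : Type*} [TopologicalSpace E]

/-- A curve of functions on a compact set is uniformly approximated by combinations of finitely
many of its points with continuous coefficients, namely by its Bernstein polynomials. -/
lemma exists_bernstein {K : Set E} (hK : IsCompact K) {T : ℝ} (hT : 0 ≤ T) {c : ℝ → E → ℝ}
    (hc : ContinuousOn (fun q : ℝ × E => c q.1 q.2) (Icc 0 T ×ˢ K)) {ε : ℝ} (hε : 0 < ε) :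
    ∃ (n : ℕ) (τ : Fin n → ℝ) (β : Fin n → ℝ → ℝ), (∀ j, τ j ∈ Icc 0 T) ∧
      (∀ j, Continuous (β j)) ∧
      ∀ s ∈ Icc 0 T, ∀ θ ∈ K, |∑ j, β j s * c (τ j) θ - c s θ| ≤ ε := by
  have : CompactSpace K := isCompact_iff_compactSpace.1 hK
  have hmem : ∀ u : unitInterval, T * u ∈ Icc 0 T := fun u =>
    ⟨mul_nonneg hT u.2.1, mul_le_of_le_one_right hT u.2.2⟩
  have hc' : Continuous fun q : unitInterval × K => c (T * q.1) q.2 :=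
    continuousOn_univ.1 (hc.comp (f := fun q : unitInterval × K => (T * (q.1 : ℝ), (q.2 : E)))
      (by fun_prop) (s := univ) fun q _ => ⟨hmem q.1, q.2.2⟩)
  let f : C(unitInterval, C(K, ℝ)) := ContinuousMap.curry ⟨_, hc'⟩
  have hf : ∀ u θ, f u θ = c (T * u) θ := fun _ _ => rfl
  obtain ⟨n, hn⟩ := ((Metric.tendsto_nhds.1 (bernsteinApproximation_uniform f)) ε hε).exists
  refine ⟨n + 1, fun j => T * bernstein.z j, fun j s => bernstein n j (projIcc 0 1 zero_le_one
    (s / T)), fun j => hmem _, fun j => ?_, fun s hs θ hθ => ?_⟩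
  · exact (ContinuousMap.continuous _).comp (continuous_projIcc.comp (by fun_prop))
  · have hmem' : s / T ∈ Icc (0 : ℝ) 1 := ⟨div_nonneg hs.1 hT, div_le_one_of_le₀ hs.2 hT⟩
    have hs' : T * (s / T) = s := by
      rcases hT.eq_or_lt with h | h
      · have : s = 0 := le_antisymm (hs.2.trans h.ge) hs.1
        simp [this]
      · field_simp
    have h1 := (ContinuousMap.dist_apply_le_dist (⟨s / T, hmem'⟩ : unitInterval)).trans hn.le
    have h2 := (ContinuousMap.dist_apply_le_dist (⟨θ, hθ⟩ : K)).trans h1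
    rw [bernsteinApproximation.apply, Real.dist_eq, hf] at h2
    simp only [hs', ContinuousMap.coe_sum, Finset.sum_apply, ContinuousMap.coe_smul,
      Pi.smul_apply, smul_eq_mul, hf] at h2
    simpa only [projIcc_of_mem _ hmem'] using h2

/-- An interval in `[0, ∞)` is exhausted by a sequence of intervals `[0, T_k]`. -/
lemma exists_seq_exhausting {I : Set ℝ} (hI : I.OrdConnected) (h0 : (0 : ℝ) ∈ I) :
    ∃ T : ℕ → ℝ, (∀ k, T k ∈ I) ∧ ∀ t ∈ I, ∀ᶠ k in atTop, t ≤ T k := by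
  have : Nonempty I := ⟨⟨0, h0⟩⟩
  obtain ⟨u, hu⟩ := Filter.exists_seq_tendsto (atTop : Filter I)
  exact ⟨fun k => u k, fun k => (u k).2, fun t ht => hu.eventually (eventually_ge_atTop ⟨t, ht⟩)⟩

/-- Approximations of a curve of functions `c` on an interval `I` by combinations of finitely many
of its points with continuous coefficients, with the error `2⁻ᵏ` for the `k`-th approximation,
locally uniformly in time. -/
structure Approximants (I : Set ℝ) (K : Set E) (c : ℝ → E → ℝ) where
  /-- The number of points of the `k`-th approximation. -/
  n : ℕ → ℕ
  /-- The times at which the curve is evaluated. -/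
  τ : (k : ℕ) → Fin (n k) → ℝ
  /-- The coefficients. -/
  β : (k : ℕ) → Fin (n k) → ℝ → ℝ
  τ_mem : ∀ k j, τ k j ∈ I
  continuous : ∀ k j, Continuous (β k j)
  bound : ∀ T ∈ I, ∀ᶠ k in atTop, ∀ s ∈ Icc 0 T, ∀ θ ∈ K,
    |∑ j, β k j s * c (τ k j) θ - c s θ| ≤ (1 / 2) ^ k

lemma nonempty_approximants {I : Set ℝ} (hI : I.OrdConnected) (h0 : (0 : ℝ) ∈ I)
    (hI0 : I ⊆ Ici 0) {K : Set E} (hK : IsCompact K) {c : ℝ → E → ℝ}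
    (hc : ContinuousOn (fun q : ℝ × E => c q.1 q.2) (I ×ˢ K)) :
    Nonempty (Approximants I K c) := by
  obtain ⟨T, hT, hT'⟩ := exists_seq_exhausting hI h0
  have hsub : ∀ k, Icc 0 (T k) ⊆ I := fun k => hI.out h0 (hT k)
  choose n τ β hτ hβ hb using fun k => exists_bernstein hK (hI0 (hT k))
    (hc.mono (prod_mono_left (hsub k))) (ε := (1 / 2) ^ k) (by positivity)
  exact ⟨⟨n, τ, β, fun k j => hsub k (hτ k j), hβ, fun t ht => (hT' t ht).mono
    fun k hk s hs θ hθ => hb k s ⟨hs.1, hs.2.trans hk⟩ θ hθ⟩⟩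

end Approximation

/-! ### Fluctuation fields -/

section Field

variable {E : Type*} [TopologicalSpace E] {S : Type*} [MeasurableSpace S]

/-- A random linear functional `χ ↦ ω(χ)` of the continuous functions on `K`, linear up to null
sets, with `E|ω(χ)| ≤ sup_K |χ|`. The Gaussian fluctuation measure and the normalized empirical
fluctuations of independent variables with values in `K` are of this kind. -/
structure IsFluctuationField (K : Set E) (Q : Measure S) (ω : (E → ℝ) → S → ℝ) : Prop where
  aemeasurable : ∀ χ, ContinuousOn χ K → AEMeasurable (ω χ) Q
  add_smul : ∀ (χ χ' : E → ℝ) (a : ℝ), ContinuousOn χ K → ContinuousOn χ' K →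
    ω (fun θ => χ θ + a * χ' θ) =ᵐ[Q] fun σ => ω χ σ + a * ω χ' σ
  lintegral_le : ∀ (χ : E → ℝ) (M : ℝ), ContinuousOn χ K → (∀ θ ∈ K, |χ θ| ≤ M) →
    ∫⁻ σ, ‖ω χ σ‖ₑ ∂Q ≤ ENNReal.ofReal M

/-- A curve `χ` of functions on `K`, indexed by the times in `I`, with the derivative `c` in
time. -/
structure IsC1Curve (I : Set ℝ) (K : Set E) (χ c : ℝ → E → ℝ) : Prop where
  isCompact : IsCompact K
  ordConnected : I.OrdConnected
  zero_mem : (0 : ℝ) ∈ I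
  subset : I ⊆ Ici 0
  continuousOn_zero : ContinuousOn (χ 0) K
  continuousOn : ContinuousOn (fun q : ℝ × E => c q.1 q.2) (I ×ˢ K)
  eq_integral : ∀ t ∈ I, ∀ θ ∈ K, χ t θ = χ 0 θ + ∫ s in (0 : ℝ)..t, c s θ

namespace IsFluctuationField

variable {K : Set E} {Q : Measure S} {ω : (E → ℝ) → S → ℝ}

lemma add_sum (h : IsFluctuationField K Q ω) {ι : Type*} (J : Finset ι) {χ₀ : E → ℝ}
    (h₀ : ContinuousOn χ₀ K) {χ : ι → E → ℝ} (hχ : ∀ j, ContinuousOn (χ j) K) (a : ι → ℝ) :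
    ω (fun θ => χ₀ θ + ∑ j ∈ J, a j * χ j θ) =ᵐ[Q]
      fun σ => ω χ₀ σ + ∑ j ∈ J, a j * ω (χ j) σ := by
  classical
  induction J using Finset.induction_on with
  | empty => simp
  | insert i J hi ih =>
    have h1 := h.add_smul (fun θ => χ₀ θ + ∑ j ∈ J, a j * χ j θ) (χ i) (a i)
      (by fun_prop) (hχ i)
    have e : (fun θ => χ₀ θ + ∑ j ∈ insert i J, a j * χ j θ) =
        fun θ => χ₀ θ + ∑ j ∈ J, a j * χ j θ + a i * χ i θ := by
      funext θ
      rw [Finset.sum_insert hi]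
      ring
    rw [e]
    filter_upwards [h1, ih] with σ h2 h3
    rw [h2, h3, Finset.sum_insert hi]
    ring

lemma ae_eq_zero (h : IsFluctuationField K Q ω) {χ : E → ℝ} (hχ : ∀ θ ∈ K, χ θ = 0) :
    ω χ =ᵐ[Q] 0 := by
  have hc : ContinuousOn χ K := continuousOn_const.congr hχ
  have h1 := h.lintegral_le χ 0 hc fun θ hθ => by simp [hχ θ hθ]
  rw [ENNReal.ofReal_zero, nonpos_iff_eq_zero, lintegral_eq_zero_iff' (h.aemeasurable χ hc).enorm]
    at h1
  filter_upwards [h1] with σ hσ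
  simpa using hσ

lemma sum (h : IsFluctuationField K Q ω) {ι : Type*} (J : Finset ι)
    {χ : ι → E → ℝ} (hχ : ∀ j, ContinuousOn (χ j) K) (a : ι → ℝ) :
    ω (fun θ => ∑ j ∈ J, a j * χ j θ) =ᵐ[Q] fun σ => ∑ j ∈ J, a j * ω (χ j) σ := by
  have h1 := h.add_sum J (χ₀ := fun _ => 0) continuousOn_const hχ a
  have h2 := h.ae_eq_zero (χ := fun _ => 0) fun _ _ => rfl
  simp only [zero_add] at h1
  filter_upwards [h1, h2] with σ h3 h4
  rw [h3, h4]
  simp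

lemma sub (h : IsFluctuationField K Q ω) {χ χ' : E → ℝ} (hχ : ContinuousOn χ K)
    (hχ' : ContinuousOn χ' K) : ω (fun θ => χ θ - χ' θ) =ᵐ[Q] fun σ => ω χ σ - ω χ' σ := by
  have h1 := h.add_smul χ χ' (-1) hχ hχ'
  simpa only [neg_one_mul, ← sub_eq_add_neg] using h1

lemma congr (h : IsFluctuationField K Q ω) {χ χ' : E → ℝ} (hχ : ContinuousOn χ K)
    (he : EqOn χ χ' K) : ω χ =ᵐ[Q] ω χ' := by
  have h1 := h.sub hχ (hχ.congr he.symm)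
  have h2 := h.ae_eq_zero (χ := fun θ => χ θ - χ' θ) fun θ hθ => sub_eq_zero.2 (he hθ)
  filter_upwards [h1, h2] with σ h3 h4
  rw [h3] at h4
  exact sub_eq_zero.1 h4

/-- Almost sure limits along uniformly convergent sequences of functions. -/
lemma ae_eq_of_tendsto (h : IsFluctuationField K Q ω) {χ : ℕ → E → ℝ} {χ' : E → ℝ}
    (hχ : ∀ k, ContinuousOn (χ k) K) (hχ' : ContinuousOn χ' K) {M : ℕ → ℝ}
    (hM : Tendsto M atTop (𝓝 0)) (hle : ∀ᶠ k in atTop, ∀ θ ∈ K, |χ k θ - χ' θ| ≤ M k)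
    {Z : S → ℝ} (hZ : ∀ᵐ σ ∂Q, Tendsto (fun k => ω (χ k) σ) atTop (𝓝 (Z σ))) :
    Z =ᵐ[Q] ω χ' := by
  have hm : ∀ k, AEMeasurable (fun σ => ‖ω (χ k) σ - ω χ' σ‖ₑ) Q := fun k =>
    ((h.aemeasurable _ (hχ k)).sub (h.aemeasurable _ hχ')).enorm
  have h0 : Tendsto (fun k => ∫⁻ σ, ‖ω (χ k) σ - ω χ' σ‖ₑ ∂Q) atTop (𝓝 0) := by
    have hM' : Tendsto (fun k => ENNReal.ofReal (M k)) atTop (𝓝 0) := by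
      simpa using ENNReal.tendsto_ofReal hM
    refine tendsto_of_tendsto_of_tendsto_of_le_of_le' tendsto_const_nhds hM'
      (Eventually.of_forall fun _ => zero_le) (hle.mono fun k hk => ?_)
    rw [← lintegral_congr_ae ((h.sub (hχ k) hχ').mono fun σ hσ => congrArg enorm hσ)]
    exact h.lintegral_le _ _ ((hχ k).sub hχ') hk
  have h1 : ∫⁻ σ, ‖Z σ - ω χ' σ‖ₑ ∂Q = 0 := by
    refine nonpos_iff_eq_zero.1 ?_
    calc ∫⁻ σ, ‖Z σ - ω χ' σ‖ₑ ∂Q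
        = ∫⁻ σ, liminf (fun k => ‖ω (χ k) σ - ω χ' σ‖ₑ) atTop ∂Q := by
          refine lintegral_congr_ae (hZ.mono fun σ hσ => ?_)
          exact ((hσ.sub_const _).enorm.liminf_eq).symm
      _ ≤ liminf (fun k => ∫⁻ σ, ‖ω (χ k) σ - ω χ' σ‖ₑ ∂Q) atTop := lintegral_liminf_le' hm
      _ = 0 := h0.liminf_eq
  have hZm : AEMeasurable Z Q := aemeasurable_of_tendsto_metrizable_ae atTop
    (fun k => h.aemeasurable _ (hχ k)) hZ
  rw [lintegral_eq_zero_iff' (f := fun σ => ‖Z σ - ω χ' σ‖ₑ)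
    (hZm.sub (h.aemeasurable _ hχ')).enorm] at h1
  filter_upwards [h1] with σ hσ
  simpa [sub_eq_zero] using hσ

/-- Integrated over time, a combination of finitely many values of the field with continuous
coefficients is controlled by the corresponding combination of functions. -/
lemma lintegral_lintegral_le [SFinite Q] (h : IsFluctuationField K Q ω) {ι : Type*} [Fintype ι]
    {χ : ι → E → ℝ} (hχ : ∀ j, ContinuousOn (χ j) K) {β : ι → ℝ → ℝ} (hβ : ∀ j, Continuous (β j))
    {T M : ℝ} (hM : ∀ s ∈ Icc 0 T, ∀ θ ∈ K, |∑ j, β j s * χ j θ| ≤ M) :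
    ∫⁻ σ, (∫⁻ s in Icc 0 T, ‖∑ j, β j s * ω (χ j) σ‖ₑ) ∂Q ≤
      ENNReal.ofReal M * ENNReal.ofReal T := by
  have hm : AEMeasurable (Function.uncurry fun (σ : S) (s : ℝ) => ‖∑ j, β j s * ω (χ j) σ‖ₑ)
      (Q.prod (volume.restrict (Icc 0 T))) := by
    refine AEMeasurable.enorm (Finset.aemeasurable_fun_sum _ fun j _ => ?_)
    exact ((hβ j).measurable.comp measurable_snd).aemeasurable.mul
      (h.aemeasurable _ (hχ j)).comp_fst
  rw [lintegral_lintegral_swap hm]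
  calc ∫⁻ s in Icc 0 T, (∫⁻ σ, ‖∑ j, β j s * ω (χ j) σ‖ₑ ∂Q)
      ≤ ∫⁻ _ in Icc 0 T, ENNReal.ofReal M := by
        refine setLIntegral_mono' measurableSet_Icc fun s hs => ?_
        rw [← lintegral_congr_ae ((h.sum Finset.univ hχ fun j => β j s).mono
          fun σ hσ => congrArg enorm hσ)]
        exact h.lintegral_le _ _ (continuousOn_finsetSum _ fun j _ => (hχ j).const_mul _) (hM s hs)
    _ = ENNReal.ofReal M * ENNReal.ofReal T := by
        rw [setLIntegral_const, Real.volume_Icc, sub_zero]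

end IsFluctuationField

end Field

/-! ### Continuous versions of fluctuation fields along curves -/

section Version

variable {E : Type*} [TopologicalSpace E] {S : Type*} {I : Set ℝ}
  {K : Set E} {χ c : ℝ → E → ℝ} {ω : (E → ℝ) → S → ℝ}

namespace IsC1Curve

lemma Icc_subset (h : IsC1Curve I K χ c) {T : ℝ} (hT : T ∈ I) : Icc 0 T ⊆ I :=
  h.ordConnected.out h.zero_mem hT

/-- A choice of approximations of the derivative of the curve. -/
def approximants (h : IsC1Curve I K χ c) : Approximants I K c :=
  (nonempty_approximants h.ordConnected h.zero_mem h.subset h.isCompact h.continuousOn).some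

/-- The approximations of the curve obtained by integrating those of its derivative. -/
def approxCurve (h : IsC1Curve I K χ c) (k : ℕ) (t : ℝ) (θ : E) : ℝ :=
  χ 0 θ + ∑ j, (∫ s in (0 : ℝ)..t, h.approximants.β k j s) * c (h.approximants.τ k j) θ

/-- The field evaluated at the approximations of the curve. -/
def approxField (h : IsC1Curve I K χ c) (ω : (E → ℝ) → S → ℝ) (k : ℕ) (t : ℝ) (σ : S) : ℝ :=
  ω (χ 0) σ + ∑ j, (∫ s in (0 : ℝ)..t, h.approximants.β k j s) * ω (c (h.approximants.τ k j)) σ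

/-- The continuous version of the process `t ↦ ω(χ_t)`: the limit of the field along the
approximations of the curve, with an arbitrary value on the null set where the limit does not
exist. -/
def version (h : IsC1Curve I K χ c) (ω : (E → ℝ) → S → ℝ) (t : ℝ) (σ : S) : ℝ :=
  limUnder atTop fun k => h.approxField ω k t σ

lemma continuousOn_deriv (h : IsC1Curve I K χ c) {s : ℝ} (hs : s ∈ I) : ContinuousOn (c s) K :=
  h.continuousOn.comp (f := fun θ => (s, θ)) (by fun_prop) fun _ hθ => ⟨hs, hθ⟩

lemma continuousOn_time (h : IsC1Curve I K χ c) {θ : E} (hθ : θ ∈ K) :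
    ContinuousOn (fun s => c s θ) I :=
  h.continuousOn.comp (f := fun s => (s, θ)) (by fun_prop) fun _ hs => ⟨hs, hθ⟩

lemma intervalIntegrable (h : IsC1Curve I K χ c) {θ : E} (hθ : θ ∈ K) {t : ℝ} (ht : t ∈ I) :
    IntervalIntegrable (fun s => c s θ) volume 0 t := by
  refine ((h.continuousOn_time hθ).mono ?_).intervalIntegrable
  rw [uIcc_of_le (h.subset ht)]
  exact h.Icc_subset ht

lemma continuousOn_approxCurve (h : IsC1Curve I K χ c) (k : ℕ) (t : ℝ) :
    ContinuousOn (h.approxCurve k t) K :=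
  h.continuousOn_zero.add (continuousOn_finsetSum _ fun j _ =>
    (h.continuousOn_deriv (h.approximants.τ_mem k j)).const_mul _)

lemma continuous_primitive (h : IsC1Curve I K χ c) (k : ℕ) (j : Fin (h.approximants.n k)) :
    Continuous fun t => ∫ s in (0 : ℝ)..t, h.approximants.β k j s :=
  intervalIntegral.continuous_primitive
    (fun _ _ => (h.approximants.continuous k j).intervalIntegrable _ _) 0

lemma continuous_approxField (h : IsC1Curve I K χ c) (k : ℕ) (σ : S) :
    Continuous fun t => h.approxField ω k t σ :=
  continuous_const.add (continuous_finsetSum _ fun j _ =>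
    (h.continuous_primitive k j).mul continuous_const)

lemma continuous_approxCurve (h : IsC1Curve I K χ c) (k : ℕ) (θ : E) :
    Continuous fun t => h.approxCurve k t θ :=
  continuous_const.add (continuous_finsetSum _ fun j _ =>
    (h.continuous_primitive k j).mul continuous_const)

lemma approxCurve_sub (h : IsC1Curve I K χ c) {T : ℝ} (hT : T ∈ I) :
    ∀ᶠ k in atTop, ∀ t ∈ Icc 0 T, ∀ θ ∈ K,
      |h.approxCurve k t θ - χ t θ| ≤ T * (1 / 2) ^ k := by
  filter_upwards [h.approximants.bound T hT] with k hk t ht θ hθ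
  have htI := h.Icc_subset hT ht
  have e : h.approxCurve k t θ - χ t θ = ∫ s in (0 : ℝ)..t,
      (∑ j, h.approximants.β k j s * c (h.approximants.τ k j) θ - c s θ) := by
    rw [approxCurve, h.eq_integral t htI θ hθ, add_sub_add_left_eq_sub,
      intervalIntegral.integral_sub _ (h.intervalIntegrable hθ htI),
      intervalIntegral.integral_finsetSum]
    · simp_rw [intervalIntegral.integral_mul_const]
    · exact fun j _ => ((h.approximants.continuous k j).mul continuous_const).intervalIntegrable _ _
    · exact (continuous_finsetSum _ fun j _ =>
        (h.approximants.continuous k j).mul continuous_const).intervalIntegrable _ _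
  rw [e, ← Real.norm_eq_abs]
  refine (intervalIntegral.norm_integral_le_of_norm_le_const (C := (1 / 2) ^ k)
    fun s hs => ?_).trans ?_
  · rw [uIoc_of_le ht.1] at hs
    exact hk s ⟨hs.1.le, hs.2.trans ht.2⟩ θ hθ
  · rw [sub_zero, abs_of_nonneg ht.1, mul_comm]
    exact mul_le_mul_of_nonneg_right ht.2 (by positivity)

/-- The curve is jointly continuous, as a uniform limit of its approximations. -/
lemma continuousOn_curve (h : IsC1Curve I K χ c) {T : ℝ} (hT : T ∈ I) :
    ContinuousOn (fun q : E × Icc 0 T => χ q.2 q.1) (K ×ˢ univ) := by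
  have hlim : TendstoUniformlyOn (fun k (q : E × Icc 0 T) => h.approxCurve k q.2 q.1)
      (fun q => χ q.2 q.1) atTop (K ×ˢ univ) := by
    have hpow : Tendsto (fun k : ℕ => T * (1 / 2 : ℝ) ^ k) atTop (𝓝 0) := by
      simpa using (tendsto_pow_atTop_nhds_zero_of_lt_one (r := (1 / 2 : ℝ)) (by norm_num)
        (by norm_num)).const_mul T
    refine Metric.tendstoUniformlyOn_iff.2 fun ε hε => ?_
    filter_upwards [h.approxCurve_sub hT, hpow.eventually_lt_const hε] with k hk hkε q hq
    rw [dist_comm, Real.dist_eq]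
    exact (hk q.2 q.2.2 q.1 hq.1).trans_lt hkε
  refine hlim.continuousOn (Eventually.frequently (Eventually.of_forall fun k => ?_))
  refine ContinuousOn.add (h.continuousOn_zero.comp continuousOn_fst fun q hq => hq.1)
    (continuousOn_finsetSum _ fun j _ => ContinuousOn.mul ?_ ?_)
  · exact ((h.continuous_primitive k j).comp
      (continuous_subtype_val.comp continuous_snd)).continuousOn
  · exact (h.continuousOn_deriv (h.approximants.τ_mem k j)).comp continuousOn_fst
      fun q hq => hq.1

/-- The increments of the approximating processes, uniformly on `[0, T]`, are controlled by this
random variable. -/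
def increment (h : IsC1Curve I K χ c) (ω : (E → ℝ) → S → ℝ) (T : ℝ) (k : ℕ) (σ : S) : ℝ≥0∞ :=
  ∫⁻ s in Icc 0 T,
    ‖∑ j, Sum.elim (h.approximants.β (k + 1)) (fun i s => -h.approximants.β k i s) j s *
      ω (c (Sum.elim (h.approximants.τ (k + 1)) (h.approximants.τ k) j)) σ‖ₑ

lemma enorm_intervalIntegral_le {f : ℝ → ℝ} {t T : ℝ} (ht : t ∈ Icc 0 T) :
    ‖∫ s in (0 : ℝ)..t, f s‖ₑ ≤ ∫⁻ s in Icc 0 T, ‖f s‖ₑ := by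
  rw [intervalIntegral.integral_of_le ht.1]
  exact (enorm_integral_le_lintegral_enorm _).trans
    (lintegral_mono_set (Ioc_subset_Icc_self.trans (Icc_subset_Icc_right ht.2)))

lemma edist_approxField_le (h : IsC1Curve I K χ c) {T t : ℝ} (ht : t ∈ Icc 0 T) (k : ℕ)
    (σ : S) : edist (h.approxField ω k t σ) (h.approxField ω (k + 1) t σ) ≤
      h.increment ω T k σ := by
  rw [edist_comm, edist_eq_enorm_sub]
  refine le_trans (le_of_eq ?_) (enorm_intervalIntegral_le ht)
  rw [intervalIntegral.integral_finsetSum]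
  · simp_rw [intervalIntegral.integral_mul_const]
    rw [Fintype.sum_sum_type]
    simp only [Sum.elim_inl, Sum.elim_inr, intervalIntegral.integral_neg, neg_mul,
      Finset.sum_neg_distrib, approxField, add_sub_add_left_eq_sub, ← sub_eq_add_neg]
  · refine fun j _ => Continuous.intervalIntegrable (Continuous.mul ?_ continuous_const) _ _
    rcases j with j | j
    · exact h.approximants.continuous _ j
    · exact (h.approximants.continuous _ j).neg

variable [MeasurableSpace S] {Q : Measure S}

lemma lintegral_increment_le [SFinite Q] (h : IsC1Curve I K χ c) (hω : IsFluctuationField K Q ω)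
    {T : ℝ} (hT : T ∈ I) : ∀ᶠ k in atTop,
      ∫⁻ σ, h.increment ω T k σ ∂Q ≤ ENNReal.ofReal (2 * T) * ENNReal.ofReal (1 / 2) ^ k := by
  filter_upwards [h.approximants.bound T hT,
    (tendsto_add_atTop_nat 1).eventually (h.approximants.bound T hT)] with k hk hk'
  have hT0 : 0 ≤ T := h.subset hT
  refine (hω.lintegral_lintegral_le (M := 2 * (1 / 2) ^ k) (fun j => ?_) (fun j => ?_)
    fun s hs θ hθ => ?_).trans (le_of_eq ?_)
  · rcases j with j | j
    · exact h.continuousOn_deriv (h.approximants.τ_mem _ j)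
    · exact h.continuousOn_deriv (h.approximants.τ_mem _ j)
  · rcases j with j | j
    · exact h.approximants.continuous _ j
    · exact (h.approximants.continuous _ j).neg
  · rw [Fintype.sum_sum_type]
    simp only [Sum.elim_inl, Sum.elim_inr, neg_mul, Finset.sum_neg_distrib, ← sub_eq_add_neg]
    have h1 := abs_sub_le (∑ j, h.approximants.β (k + 1) j s * c (h.approximants.τ (k + 1) j) θ)
      (c s θ) (∑ j, h.approximants.β k j s * c (h.approximants.τ k j) θ)
    have h2 := hk s hs θ hθ
    have h3 := hk' s hs θ hθ
    rw [abs_sub_comm] at h2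
    have h4 : (1 / 2 : ℝ) ^ (k + 1) ≤ (1 / 2) ^ k :=
      pow_le_pow_of_le_one (by norm_num) (by norm_num) (Nat.le_succ k)
    linarith
  · rw [← ENNReal.ofReal_pow (by norm_num), ← ENNReal.ofReal_mul (by positivity),
      ← ENNReal.ofReal_mul (by positivity)]
    ring_nf

lemma aemeasurable_increment [SFinite Q] (h : IsC1Curve I K χ c)
    (hω : IsFluctuationField K Q ω) (T : ℝ) (k : ℕ) : AEMeasurable (h.increment ω T k) Q := by
  refine AEMeasurable.lintegral_prod_right'
    (f := fun q : S × ℝ => ‖∑ j, Sum.elim (h.approximants.β (k + 1))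
      (fun i s => -h.approximants.β k i s) j q.2 *
      ω (c (Sum.elim (h.approximants.τ (k + 1)) (h.approximants.τ k) j)) q.1‖ₑ) ?_
  refine AEMeasurable.enorm (Finset.aemeasurable_fun_sum _ fun j _ => AEMeasurable.mul ?_ ?_)
  · rcases j with j | j
    · exact ((h.approximants.continuous _ j).measurable.comp measurable_snd).aemeasurable
    · exact ((h.approximants.continuous _ j).measurable.comp measurable_snd).neg.aemeasurable
  · rcases j with j | j
    · exact (hω.aemeasurable _ (h.continuousOn_deriv (h.approximants.τ_mem _ j))).comp_fst
    · exact (hω.aemeasurable _ (h.continuousOn_deriv (h.approximants.τ_mem _ j))).comp_fst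

/-- Almost surely, the approximating processes converge uniformly on `[0, T]`: their increments
have summable expectations. -/
lemma ae_tendstoUniformlyOn [SFinite Q] (h : IsC1Curve I K χ c) (hω : IsFluctuationField K Q ω)
    {T : ℝ} (hT : T ∈ I) : ∀ᵐ σ ∂Q, TendstoUniformlyOn (fun k t => h.approxField ω k t σ)
      (fun t => h.version ω t σ) atTop (Icc 0 T) := by
  obtain ⟨k₀, hk₀⟩ := eventually_atTop.1 (h.lintegral_increment_le hω hT)
  have hsum : ∫⁻ σ, ∑' k, h.increment ω T (k + k₀) σ ∂Q ≠ ∞ := by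
    rw [lintegral_tsum fun k => h.aemeasurable_increment hω T _]
    refine ne_top_of_le_ne_top ?_ (ENNReal.tsum_le_tsum fun k => hk₀ (k + k₀) (Nat.le_add_left _ _))
    rw [ENNReal.tsum_mul_left]
    refine ENNReal.mul_ne_top ENNReal.ofReal_ne_top ?_
    simp_rw [pow_add]
    rw [ENNReal.tsum_mul_right]
    refine ENNReal.mul_ne_top ?_ (ENNReal.pow_ne_top ENNReal.ofReal_ne_top)
    rw [ENNReal.tsum_geometric]
    refine ENNReal.inv_ne_top.2 (tsub_pos_of_lt ?_).ne'
    rw [ENNReal.ofReal_lt_one]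
    norm_num
  have hae := ae_lt_top' (AEMeasurable.tsum
    fun k => h.aemeasurable_increment hω T (k + k₀)) hsum
  filter_upwards [hae] with σ hσ
  have hstep : ∀ t ∈ Icc 0 T, ∀ k, edist (h.approxField ω (k + k₀) t σ)
      (h.approxField ω (k.succ + k₀) t σ) ≤ h.increment ω T (k + k₀) σ := fun t ht k => by
    rw [Nat.succ_add]
    exact h.edist_approxField_le ht _ σ
  have hlim : ∀ t ∈ Icc 0 T, Tendsto (fun k => h.approxField ω (k + k₀) t σ) atTop
      (𝓝 (h.version ω t σ)) := fun t ht => by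
    have hcs := cauchySeq_of_edist_le_of_tsum_ne_top _ (hstep t ht) hσ.ne
    obtain ⟨z, hz⟩ := cauchySeq_tendsto_of_complete hcs
    have hz' : Tendsto (fun k => h.approxField ω k t σ) atTop (𝓝 z) :=
      (tendsto_add_atTop_iff_nat k₀).1 hz
    rwa [version, hz'.limUnder_eq]
  have hunif : TendstoUniformlyOn (fun k t => h.approxField ω (k + k₀) t σ)
      (fun t => h.version ω t σ) atTop (Icc 0 T) := by
    refine EMetric.tendstoUniformlyOn_iff.2 fun ε hε => ?_
    filter_upwards [(ENNReal.tendsto_sum_nat_add _ hσ.ne).eventually_lt_const hε] with k hk t ht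
    rw [edist_comm]
    refine (edist_le_tsum_of_edist_le_of_tendsto _ (hstep t ht) (hlim t ht) k).trans_lt ?_
    simpa only [add_comm k] using hk
  refine EMetric.tendstoUniformlyOn_iff.2 fun ε hε => ?_
  obtain ⟨k₁, hk₁⟩ := eventually_atTop.1 (EMetric.tendstoUniformlyOn_iff.1 hunif ε hε)
  filter_upwards [eventually_ge_atTop (k₁ + k₀)] with k hk
  have := hk₁ (k - k₀) (by omega)
  rwa [Nat.sub_add_cancel (by omega)] at this

/-- A function on an interval `I ⊆ [0, ∞)` is continuous if it is so on the intervals `[0, T]`,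
`T ∈ I`. -/
lemma _root_.MeanFieldCLT.continuousOn_of_forall_Icc {F : Type*} [TopologicalSpace F] {I : Set ℝ}
    (hI0 : I ⊆ Ici 0) {f : ℝ → F} (hf : ∀ T ∈ I, ContinuousOn f (Icc 0 T)) : ContinuousOn f I := by
  intro t ht
  by_cases hex : ∃ T ∈ I, t < T
  · obtain ⟨T, hT, htT⟩ := hex
    refine (hf T hT t ⟨hI0 ht, htT.le⟩).mono_of_mem_nhdsWithin ?_
    filter_upwards [self_mem_nhdsWithin, mem_nhdsWithin_of_mem_nhds (Iio_mem_nhds htT)]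
      with s hs hs'
    exact ⟨hI0 hs, le_of_lt hs'⟩
  · push Not at hex
    exact (hf t ht t ⟨hI0 ht, le_rfl⟩).mono fun s hs => ⟨hI0 hs, hex s hs⟩

lemma ae_continuousOn_version [SFinite Q] (h : IsC1Curve I K χ c)
    (hω : IsFluctuationField K Q ω) :
    ∀ᵐ σ ∂Q, ContinuousOn (fun t => h.version ω t σ) I := by
  obtain ⟨T, hT, hT'⟩ := exists_seq_exhausting h.ordConnected h.zero_mem
  filter_upwards [ae_all_iff.2 fun k => h.ae_tendstoUniformlyOn hω (hT k)] with σ hσ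
  refine continuousOn_of_forall_Icc h.subset fun t ht => ?_
  obtain ⟨k, hk⟩ := (hT' t ht).exists
  exact ((hσ k).continuousOn (Eventually.frequently (Eventually.of_forall fun k =>
    (h.continuous_approxField k σ).continuousOn))).mono (Icc_subset_Icc_right hk)

/-- Continuous linear functionals of the continuous version are values of the field. -/
lemma ae_apply_version [SFinite Q] (h : IsC1Curve I K χ c) (hω : IsFluctuationField K Q ω)
    {T : ℝ} (hT : T ∈ I) (l : C(Icc 0 T, ℝ) →L[ℝ] ℝ) :
    (fun σ => l (toC fun t : Icc 0 T => h.version ω t σ)) =ᵐ[Q]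
      ω fun θ => l (toC fun t : Icc 0 T => χ t θ) := by
  have hT0 : 0 ≤ T := h.subset hT
  let β (k : ℕ) (j : Fin (h.approximants.n k)) : C(Icc 0 T, ℝ) :=
    ⟨fun t => ∫ s in (0 : ℝ)..t, h.approximants.β k j s,
      (h.continuous_primitive k j).comp continuous_subtype_val⟩
  let χ' (k : ℕ) (θ : E) : ℝ := l 1 * χ 0 θ + ∑ j, l (β k j) * c (h.approximants.τ k j) θ
  have hcurve : ∀ k θ, χ' k θ = l (toC fun t : Icc 0 T => h.approxCurve k t θ) := fun k θ => by
    have e : (toC fun t : Icc 0 T => h.approxCurve k t θ) =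
        χ 0 θ • (1 : C(Icc 0 T, ℝ)) + ∑ j, c (h.approximants.τ k j) θ • β k j := by
      ext t
      rw [toC_apply_of_continuousOn (h.continuous_approxCurve k θ).continuousOn]
      simp [approxCurve, β, mul_comm]
    rw [e, map_add, map_smul, map_sum]
    simp [χ', mul_comm]
  have hproc : ∀ k, ω (χ' k) =ᵐ[Q]
      fun σ => l (toC fun t : Icc 0 T => h.approxField ω k t σ) := fun k => by
    have h1 := hω.add_sum Finset.univ (χ₀ := fun θ => l 1 * χ 0 θ)
      (h.continuousOn_zero.const_mul _)
      (fun j => h.continuousOn_deriv (h.approximants.τ_mem k j)) fun j => l (β k j)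
    have h2 := hω.sum (Finset.univ : Finset Unit) (χ := fun _ => χ 0)
      (fun _ => h.continuousOn_zero) fun _ => l 1
    simp only [Finset.univ_unique, Finset.sum_singleton] at h2
    filter_upwards [h1, h2] with σ h3 h4
    have e : (toC fun t : Icc 0 T => h.approxField ω k t σ) =
        ω (χ 0) σ • (1 : C(Icc 0 T, ℝ)) + ∑ j, ω (c (h.approximants.τ k j)) σ • β k j := by
      ext t
      rw [toC_apply_of_continuousOn (h.continuous_approxField k σ).continuousOn]
      simp [approxField, β, mul_comm]
    change ω (fun θ => l 1 * χ 0 θ + ∑ j, l (β k j) * c (h.approximants.τ k j) θ) σ = _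
    rw [h3, h4, e, map_add, map_smul, map_sum]
    simp [mul_comm]
  have hχc : ∀ θ ∈ K, Continuous fun t : Icc 0 T => χ t θ := fun θ hθ =>
    continuous_section (h.continuousOn_curve hT) hθ
  refine hω.ae_eq_of_tendsto (χ := χ') (M := fun k => ‖l‖ * (T * (1 / 2) ^ k)) (fun k => ?_)
    (l.continuous.comp_continuousOn (continuousOn_toC (h.continuousOn_curve hT))) ?_ ?_ ?_
  · exact (h.continuousOn_zero.const_mul _).add (continuousOn_finsetSum _ fun j _ =>
      (h.continuousOn_deriv (h.approximants.τ_mem k j)).const_mul _)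
  · have := ((tendsto_pow_atTop_nhds_zero_of_lt_one (r := (1 / 2 : ℝ)) (by norm_num)
      (by norm_num)).const_mul T).const_mul ‖l‖
    simpa using this
  · filter_upwards [h.approxCurve_sub hT] with k hk θ hθ
    rw [hcurve, Function.comp_apply, ← map_sub, ← Real.norm_eq_abs]
    refine l.le_of_opNorm_le_of_le le_rfl ((ContinuousMap.norm_le _ (by positivity)).2 fun t => ?_)
    rw [ContinuousMap.sub_apply, toC_apply (hχc θ hθ),
      toC_apply_of_continuousOn (h.continuous_approxCurve k θ).continuousOn]
    exact hk t t.2 θ hθ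
  · filter_upwards [ae_all_iff.2 hproc, h.ae_tendstoUniformlyOn hω hT] with σ h1 h2
    simp_rw [h1]
    refine (l.continuous.tendsto _).comp ?_
    have hvc : ContinuousOn (fun t => h.version ω t σ) (Icc 0 T) :=
      h2.continuousOn (Eventually.frequently (Eventually.of_forall fun k =>
        (h.continuous_approxField k σ).continuousOn))
    rw [ContinuousMap.tendsto_iff_tendstoUniformly]
    intro u hu
    filter_upwards [h2 u hu] with k hk t
    rw [toC_apply_of_continuousOn hvc,
      toC_apply_of_continuousOn (h.continuous_approxField k σ).continuousOn]
    exact hk t t.2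

lemma ae_version_eq [SFinite Q] (h : IsC1Curve I K χ c) (hω : IsFluctuationField K Q ω)
    {t : ℝ} (ht : t ∈ I) : h.version ω t =ᵐ[Q] ω (χ t) := by
  have ht' : t ∈ Icc 0 t := ⟨h.subset ht, le_rfl⟩
  have h1 := h.ae_apply_version hω ht (ContinuousMap.evalCLM ℝ (⟨t, ht'⟩ : Icc 0 t))
  have hc : ∀ θ ∈ K, toC (fun s : Icc 0 t => χ s θ) ⟨t, ht'⟩ = χ t θ := fun θ hθ =>
    toC_apply (continuous_section (h.continuousOn_curve ht) hθ) _
  have hcont : ContinuousOn (χ t) K :=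
    (h.continuousOn_curve ht).comp (f := fun θ => (θ, (⟨t, ht'⟩ : Icc 0 t))) (by fun_prop)
      fun θ hθ => ⟨hθ, mem_univ _⟩
  have h2 := hω.congr (χ := χ t)
    (χ' := fun θ => ContinuousMap.evalCLM ℝ (⟨t, ht'⟩ : Icc 0 t) (toC fun s : Icc 0 t => χ s θ))
    hcont fun θ hθ => (hc θ hθ).symm
  filter_upwards [h1, h2, h.ae_continuousOn_version hω] with σ h3 h4 h5
  rw [h4, ← h3]
  exact (toC_apply (continuousOn_iff_continuous_domRestrict.1 (h5.mono (h.Icc_subset ht)))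
    (⟨t, ht'⟩ : Icc 0 t)).symm

end IsC1Curve

end Version

/-! ### The two fluctuation fields -/

section Moments

variable {E F : Type*} [MeasurableSpace E] [NormedAddCommGroup F] {K : Set E} {μ₀ : Measure E}

lemma norm_integral_le_of_forall_mem [NormedSpace ℝ F] [IsProbabilityMeasure μ₀]
    (hmem : ∀ᵐ θ ∂μ₀, θ ∈ K) {h : E → F} {M : ℝ} (hM : ∀ θ ∈ K, ‖h θ‖ ≤ M) :
    ‖∫ θ, h θ ∂μ₀‖ ≤ M := by
  simpa using norm_integral_le_of_norm_le_const (hmem.mono hM)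

/-- The first absolute moment is at most the square root of the second moment. -/
lemma lintegral_enorm_le_of_integral_sq_le {S : Type*} [MeasurableSpace S] {Q : Measure S}
    [IsProbabilityMeasure Q] {Z : S → ℝ} (hZ : MemLp Z 2 Q) {M : ℝ} (hM : 0 ≤ M)
    (h : ∫ σ, Z σ ^ 2 ∂Q ≤ M ^ 2) : ∫⁻ σ, ‖Z σ‖ₑ ∂Q ≤ ENNReal.ofReal M := by
  have hi : Integrable Z Q := hZ.integrable (by norm_num)
  have h1 := variance_nonneg (fun σ => |Z σ|) Q
  rw [variance_eq_sub (X := fun σ => |Z σ|) hZ.abs] at h1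
  simp only [Pi.pow_apply, sq_abs] at h1
  have h2 : ∫ σ, |Z σ| ∂Q ≤ M := abs_le_of_sq_le_sq' (by linarith) hM |>.2
  rw [← ofReal_integral_norm_eq_lintegral_enorm hi]
  exact ENNReal.ofReal_le_ofReal h2

lemma integral_sq_le_of_forall_mem [IsProbabilityMeasure μ₀] (hmem : ∀ᵐ θ ∂μ₀, θ ∈ K)
    {h : E → ℝ} {M : ℝ} (hM : ∀ θ ∈ K, |h θ| ≤ M) : ∫ θ, h θ ^ 2 ∂μ₀ ≤ M ^ 2 := by
  have h1 : ‖∫ θ, h θ ^ 2 ∂μ₀‖ ≤ M ^ 2 := norm_integral_le_of_forall_mem hmem fun θ hθ => by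
    rw [Real.norm_eq_abs, abs_pow]
    exact pow_le_pow_left₀ (abs_nonneg _) (hM θ hθ) 2
  exact (le_abs_self _).trans h1

end Moments

section Integrability

variable {E F : Type*} [TopologicalSpace E] [SecondCountableTopology E] [T2Space E]
  [MeasurableSpace E] [BorelSpace E] [NormedAddCommGroup F]
  {K : Set E} {μ₀ : Measure E}

lemma aestronglyMeasurable_of_continuousOn (hK : IsCompact K) (hmem : ∀ᵐ θ ∂μ₀, θ ∈ K)
    {h : E → F} (hh : ContinuousOn h K) : AEStronglyMeasurable h μ₀ := by
  have := hh.aestronglyMeasurable (μ := μ₀) hK.measurableSet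
  rwa [Measure.restrict_eq_self_of_ae_mem hmem] at this

lemma memLp_of_continuousOn [IsFiniteMeasure μ₀] (hK : IsCompact K) (hmem : ∀ᵐ θ ∂μ₀, θ ∈ K)
    {h : E → F} (hh : ContinuousOn h K) (q : ℝ≥0∞) : MemLp h q μ₀ := by
  obtain ⟨M, hM⟩ := hK.exists_bound_of_continuousOn hh
  exact MemLp.of_bound (aestronglyMeasurable_of_continuousOn hK hmem hh) M (hmem.mono hM)

lemma integrable_of_continuousOn [IsFiniteMeasure μ₀] (hK : IsCompact K)
    (hmem : ∀ᵐ θ ∂μ₀, θ ∈ K) {h : E → F} (hh : ContinuousOn h K) : Integrable h μ₀ :=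
  memLp_one_iff_integrable.1 (memLp_of_continuousOn hK hmem hh 1)

end Integrability

section Gaussian

variable {k : ℕ} {S : Type*} [MeasurableSpace S] {μ₀ : Measure (Euc k)} {Q : Measure S}
  {ω : (Euc k → ℝ) → S → ℝ}

namespace IsGaussianFluctuation

lemma hasGaussianLaw (h : IsGaussianFluctuation μ₀ Q ω) {χ : Euc k → ℝ}
    (hχ : ContinuousOn χ μ₀.support) : HasGaussianLaw (ω χ) Q :=
  h.gaussian.hasGaussianLaw_eval ⟨χ, hχ⟩

variable [IsProbabilityMeasure μ₀]

/-- The Gaussian fluctuation measure is linear up to null sets, since the covariance of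
`ω(χ + a χ') - ω(χ) - a ω(χ')` with the values of `ω` vanishes. -/
lemma add_smul (h : IsGaussianFluctuation μ₀ Q ω) (hK : IsCompact μ₀.support)
    {χ χ' : Euc k → ℝ} (a : ℝ) (hχ : ContinuousOn χ μ₀.support)
    (hχ' : ContinuousOn χ' μ₀.support) :
    ω (fun θ => χ θ + a * χ' θ) =ᵐ[Q] fun σ => ω χ σ + a * ω χ' σ := by
  have hmem : ∀ᵐ θ ∂μ₀, θ ∈ μ₀.support := Measure.support_mem_ae
  have hL : ∀ {ξ : Euc k → ℝ}, ContinuousOn ξ μ₀.support → MemLp (ω ξ) 2 Q :=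
    fun hξ => (h.hasGaussianLaw hξ).memLp_two
  have hi : ∀ {ξ : Euc k → ℝ}, ContinuousOn ξ μ₀.support → Integrable ξ μ₀ :=
    fun hξ => integrable_of_continuousOn hK hmem hξ
  have hs : ContinuousOn (fun θ => χ θ + a * χ' θ) μ₀.support := by fun_prop
  have hmul : ∀ {ξ ξ' : Euc k → ℝ}, ContinuousOn ξ μ₀.support → ContinuousOn ξ' μ₀.support →
      Integrable (fun σ => ω ξ σ * ω ξ' σ) Q := fun hξ hξ' => (hL hξ).integrable_mul (hL hξ')
  set d : S → ℝ := fun σ => ω (fun θ => χ θ + a * χ' θ) σ - (ω χ σ + a * ω χ' σ)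
  have horth : ∀ {ξ : Euc k → ℝ}, ContinuousOn ξ μ₀.support → ∫ σ, d σ * ω ξ σ ∂Q = 0 := by
    intro ξ hξ
    have e : ∀ σ, d σ * ω ξ σ = ω (fun θ => χ θ + a * χ' θ) σ * ω ξ σ -
        (ω χ σ * ω ξ σ + a * (ω χ' σ * ω ξ σ)) := fun σ => by simp only [d]; ring
    simp_rw [e]
    have hadd : Integrable (fun σ => ω χ σ * ω ξ σ + a * (ω χ' σ * ω ξ σ)) Q :=
      (hmul hχ hξ).add ((hmul hχ' hξ).const_mul a)
    rw [integral_sub (hmul hs hξ) hadd,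
      integral_add (hmul hχ hξ) ((hmul hχ' hξ).const_mul a), integral_const_mul, h.cov _ _ hs hξ,
      h.cov _ _ hχ hξ, h.cov _ _ hχ' hξ, integral_add (hi hχ) ((hi hχ').const_mul a),
      integral_const_mul]
    have e2 : ∀ θ, (χ θ + a * χ' θ) * ξ θ = χ θ * ξ θ + a * (χ' θ * ξ θ) := fun θ => by ring
    simp_rw [e2]
    have h1 : Integrable (fun θ => χ θ * ξ θ) μ₀ := hi (hχ.mul hξ)
    have h2 : Integrable (fun θ => χ' θ * ξ θ) μ₀ := hi (hχ'.mul hξ)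
    rw [integral_add h1 (h2.const_mul a), integral_const_mul]
    ring
  have hdL : MemLp d 2 Q := (hL hs).sub ((hL hχ).add ((hL hχ').const_mul a))
  have hdm : ∀ {ξ : Euc k → ℝ}, ContinuousOn ξ μ₀.support → Integrable (fun σ => d σ * ω ξ σ) Q :=
    fun hξ => hdL.integrable_mul (hL hξ)
  have hzero : ∫ σ, d σ ^ 2 ∂Q = 0 := by
    have e : ∀ σ, d σ ^ 2 = d σ * ω (fun θ => χ θ + a * χ' θ) σ -
        (d σ * ω χ σ + a * (d σ * ω χ' σ)) := fun σ => by simp only [d]; ring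
    simp_rw [e]
    have hadd : Integrable (fun σ => d σ * ω χ σ + a * (d σ * ω χ' σ)) Q :=
      (hdm hχ).add ((hdm hχ').const_mul a)
    rw [integral_sub (hdm hs) hadd,
      integral_add (hdm hχ) ((hdm hχ').const_mul a), integral_const_mul, horth hs, horth hχ,
      horth hχ']
    simp
  rw [integral_eq_zero_iff_of_nonneg (fun σ => sq_nonneg _) hdL.integrable_sq] at hzero
  filter_upwards [hzero] with σ hσ
  exact sub_eq_zero.1 (pow_eq_zero_iff two_ne_zero |>.1 hσ)

lemma isFluctuationField [IsProbabilityMeasure Q] (h : IsGaussianFluctuation μ₀ Q ω)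
    (hK : IsCompact μ₀.support) : IsFluctuationField μ₀.support Q ω where
  aemeasurable χ hχ := (h.hasGaussianLaw hχ).aemeasurable
  add_smul χ χ' a hχ hχ' := h.add_smul hK a hχ hχ'
  lintegral_le χ M hχ hM := by
    have hmem : ∀ᵐ θ ∂μ₀, θ ∈ μ₀.support := Measure.support_mem_ae
    obtain ⟨θ, hθ⟩ := Measure.nonempty_support (IsProbabilityMeasure.ne_zero μ₀)
    refine lintegral_enorm_le_of_integral_sq_le (h.hasGaussianLaw hχ).memLp_two
      ((abs_nonneg _).trans (hM θ hθ)) ?_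
    have hc := h.cov χ χ hχ hχ
    simp_rw [← pow_two] at hc
    rw [hc]
    linarith [integral_sq_le_of_forall_mem hmem hM, sq_nonneg (∫ θ, χ θ ∂μ₀)]

end IsGaussianFluctuation

end Gaussian

section Empirical

variable {E F : Type*} [MeasurableSpace E] [NormedAddCommGroup F] [NormedSpace ℝ F]

/-- The deviation of the empirical average of `h` at the points `a i` from its mean. -/
def empDev (μ₀ : Measure E) {m : ℕ} (a : Fin m → E) (h : E → F) : F :=
  (avg fun i => h (a i)) - ∫ θ, h θ ∂μ₀

variable {K : Set E} {μ₀ : Measure E}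

lemma empDev_const_mul {m : ℕ} (a : Fin m → E) (r : ℝ) (h : E → ℝ) :
    empDev μ₀ a (fun θ => r * h θ) = r * empDev μ₀ a h := by
  rw [empDev, integral_const_mul, empDev]
  simp only [avg, ← Finset.mul_sum, smul_eq_mul]
  ring

lemma empDev_congr (hmem : ∀ᵐ θ ∂μ₀, θ ∈ K) {m : ℕ} {a : Fin m → E} (ha : ∀ i, a i ∈ K)
    {h h' : E → F} (he : EqOn h h' K) : empDev μ₀ a h = empDev μ₀ a h' := by
  rw [empDev, empDev, integral_congr_ae (hmem.mono fun θ hθ => he hθ)]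
  simp only [he (ha _)]

lemma sqrt_mul_empDev_eq {S : Type*} {ξ : ℕ → S → E} {m : ℕ} (g : E → ℝ) (σ : S) :
    √(m : ℝ) * empDev μ₀ (fun i : Fin m => ξ i σ) g =
      (√(m : ℝ))⁻¹ * (∑ k ∈ Finset.range m, (g ∘ ξ k) σ - m * ∫ θ, g θ ∂μ₀) := by
  rcases Nat.eq_zero_or_pos m with rfl | hm
  · simp
  have hm' : (0 : ℝ) < m := by exact_mod_cast hm
  rw [empDev, avg, Finset.sum_range, smul_eq_mul]
  have hs : √(m : ℝ) * √m = m := Real.mul_self_sqrt hm'.le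
  have hs0 : √(m : ℝ) ≠ 0 := (Real.sqrt_pos.2 hm').ne'
  rw [eq_inv_mul_iff_mul_eq₀ hs0, ← mul_assoc, hs, mul_sub, ← mul_assoc, mul_inv_cancel₀ hm'.ne',
    one_mul]
  rfl

lemma norm_empDev_le [IsProbabilityMeasure μ₀] (hmem : ∀ᵐ θ ∂μ₀, θ ∈ K) {m : ℕ} {a : Fin m → E}
    (ha : ∀ i, a i ∈ K)
    {h : E → F} {M : ℝ} (hM0 : 0 ≤ M) (hM : ∀ θ ∈ K, ‖h θ‖ ≤ M) : ‖empDev μ₀ a h‖ ≤ 2 * M := by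
  rw [two_mul]
  exact norm_sub_le_of_le (norm_avg_le hM0 fun i => hM _ (ha i))
    (norm_integral_le_of_forall_mem hmem hM)

variable [TopologicalSpace E] [SecondCountableTopology E] [T2Space E] [BorelSpace E]
  [IsProbabilityMeasure μ₀]

lemma empDev_add (hK : IsCompact K) (hmem : ∀ᵐ θ ∂μ₀, θ ∈ K) {m : ℕ} (a : Fin m → E)
    {h h' : E → F} (hh : ContinuousOn h K) (hh' : ContinuousOn h' K) :
    empDev μ₀ a (fun θ => h θ + h' θ) = empDev μ₀ a h + empDev μ₀ a h' := by
  rw [empDev, integral_add (integrable_of_continuousOn hK hmem hh)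
    (integrable_of_continuousOn hK hmem hh'), empDev, empDev]
  simp only [avg, Finset.sum_add_distrib, smul_add]
  abel

lemma map_empDev {G : Type*} [NormedAddCommGroup G] [NormedSpace ℝ G] [CompleteSpace F]
    [CompleteSpace G] (hK : IsCompact K)
    (hmem : ∀ᵐ θ ∂μ₀, θ ∈ K) {m : ℕ} (a : Fin m → E) {h : E → F} (hh : ContinuousOn h K)
    (A : F →L[ℝ] G) : A (empDev μ₀ a h) = empDev μ₀ a fun θ => A (h θ) := by
  rw [empDev, map_sub, map_avg, empDev,
    ← A.integral_comp_comm (integrable_of_continuousOn hK hmem hh)]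

lemma empDev_sum (hK : IsCompact K) (hmem : ∀ᵐ θ ∂μ₀, θ ∈ K) {m : ℕ} (a : Fin m → E)
    {ι : Type*} (J : Finset ι) {h : ι → E → ℝ} (hh : ∀ j, ContinuousOn (h j) K) (r : ι → ℝ) :
    empDev μ₀ a (fun θ => ∑ j ∈ J, r j * h j θ) = ∑ j ∈ J, r j * empDev μ₀ a (h j) := by
  classical
  induction J using Finset.induction_on with
  | empty => simp [empDev, avg]
  | insert i J hi ih =>
    simp only [Finset.sum_insert hi]
    rw [empDev_add hK hmem a ((hh i).const_mul _)
      (continuousOn_finsetSum _ fun j _ => (hh j).const_mul _), empDev_const_mul, ih]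

end Empirical

section Sample

variable {E : Type*} [TopologicalSpace E] [MeasurableSpace E] {S : Type*} [MeasurableSpace S]

/-- A sequence of independent random variables with the law `μ₀`, which is carried by the compact
set `K`. -/
structure IsSample (K : Set E) (μ₀ : Measure E) (P : Measure S) (ξ : ℕ → S → E) : Prop where
  isCompact : IsCompact K
  mem : ∀ᵐ θ ∂μ₀, θ ∈ K
  hasLaw : ∀ i, HasLaw (ξ i) μ₀ P
  iIndepFun : iIndepFun ξ P

namespace IsSample

variable {K : Set E} {μ₀ : Measure E} {P : Measure S} {ξ : ℕ → S → E}

lemma ae_mem (h : IsSample K μ₀ P ξ) : ∀ᵐ σ ∂P, ∀ i, ξ i σ ∈ K := by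
  rw [ae_all_iff]
  intro i
  have h1 := h.mem
  rw [← (h.hasLaw i).map_eq] at h1
  exact ae_of_ae_map (h.hasLaw i).aemeasurable h1

variable [SecondCountableTopology E] [T2Space E] [BorelSpace E]

section Banach

variable {F : Type*} [NormedAddCommGroup F] [MeasurableSpace F] [BorelSpace F]

lemma aemeasurable_comp (h : IsSample K μ₀ P ξ) {g : E → F} (hg : ContinuousOn g K) (i : ℕ) :
    AEMeasurable g (P.map (ξ i)) := by
  rw [(h.hasLaw i).map_eq]
  exact (aestronglyMeasurable_of_continuousOn h.isCompact h.mem hg).aemeasurable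

lemma iIndepFun_comp (h : IsSample K μ₀ P ξ) {g : E → F} (hg : ContinuousOn g K) :
    ProbabilityTheory.iIndepFun (fun i => g ∘ ξ i) P :=
  h.iIndepFun.comp₀ (fun _ => g) (fun i => (h.hasLaw i).aemeasurable) (h.aemeasurable_comp hg)

lemma identDistrib_comp (h : IsSample K μ₀ P ξ) {g : E → F} (hg : ContinuousOn g K) (i j : ℕ) :
    IdentDistrib (g ∘ ξ i) (g ∘ ξ j) P P :=
  IdentDistrib.comp_of_aemeasurable ⟨(h.hasLaw i).aemeasurable, (h.hasLaw j).aemeasurable, by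
    rw [(h.hasLaw i).map_eq, (h.hasLaw j).map_eq]⟩ (h.aemeasurable_comp hg i)

end Banach

lemma memLp_comp {F : Type*} [NormedAddCommGroup F] [IsProbabilityMeasure μ₀]
    (h : IsSample K μ₀ P ξ) {g : E → F} (hg : ContinuousOn g K) (i : ℕ)
    (q : ℝ≥0∞) : MemLp (g ∘ ξ i) q P := by
  refine MemLp.comp_of_map ?_ (h.hasLaw i).aemeasurable
  rw [(h.hasLaw i).map_eq]
  exact memLp_of_continuousOn h.isCompact h.mem hg q

lemma integral_comp {F : Type*} [NormedAddCommGroup F] [NormedSpace ℝ F]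
    (h : IsSample K μ₀ P ξ) {g : E → F} (hg : ContinuousOn g K) (i : ℕ) :
    ∫ σ, (g ∘ ξ i) σ ∂P = ∫ θ, g θ ∂μ₀ :=
  (h.hasLaw i).integral_comp (aestronglyMeasurable_of_continuousOn h.isCompact h.mem hg)

variable [IsProbabilityMeasure μ₀]

/-- The law of large numbers for continuous functions of the sample with values in a Banach
space. -/
lemma ae_tendsto_empDev {F : Type*} [NormedAddCommGroup F] [NormedSpace ℝ F] [CompleteSpace F]
    (h : IsSample K μ₀ P ξ) {g : E → F} (hg : ContinuousOn g K) :
    ∀ᵐ σ ∂P, Tendsto (fun m : ℕ => empDev μ₀ (fun i : Fin m => ξ i σ) g) atTop (𝓝 0) := by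
  borelize F
  have h1 := strong_law_ae (fun i => g ∘ ξ i)
    (memLp_one_iff_integrable.1 (h.memLp_comp hg 0 1))
    (fun i j hij => (h.iIndepFun_comp hg).indepFun hij) fun i => h.identDistrib_comp hg i 0
  filter_upwards [h1] with σ hσ
  rw [h.integral_comp hg 0] at hσ
  have h2 := hσ.sub_const (∫ θ, g θ ∂μ₀)
  rw [sub_self] at h2
  refine h2.congr fun m => ?_
  rw [empDev, avg, Finset.sum_range]
  rfl

variable [IsProbabilityMeasure P]

/-- The normalized fluctuations of a sample have the second moment `Var χ`. -/
lemma integral_sq_sqrt_mul_empDev (h : IsSample K μ₀ P ξ) {g : E → ℝ} (hg : ContinuousOn g K)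
    {m : ℕ} (hm : 0 < m) :
    ∫ σ, (√(m : ℝ) * empDev μ₀ (fun i : Fin m => ξ i σ) g) ^ 2 ∂P =
      ∫ θ, g θ ^ 2 ∂μ₀ - (∫ θ, g θ ∂μ₀) ^ 2 := by
  have hm' : (0 : ℝ) < m := by exact_mod_cast hm
  have hL : ∀ i, MemLp (g ∘ ξ i) 2 P := fun i => h.memLp_comp hg i 2
  have hI : ∀ i, Integrable (g ∘ ξ i) P := fun i => (hL i).integrable (by norm_num)
  simp_rw [sqrt_mul_empDev_eq]
  have hZL : MemLp (fun σ => (∑ k ∈ Finset.range m, (g ∘ ξ k) σ)) 2 P :=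
    memLp_finsetSum _ fun i _ => hL i
  have hAE : AEMeasurable (fun σ => (√(m : ℝ))⁻¹ *
      (∑ k ∈ Finset.range m, (g ∘ ξ k) σ - m * ∫ θ, g θ ∂μ₀)) P :=
    ((hZL.sub (memLp_const (m * ∫ θ, g θ ∂μ₀))).const_mul _).aemeasurable
  rw [← variance_of_integral_eq_zero hAE]
  · rw [variance_const_mul, variance_sub_const hZL.aestronglyMeasurable]
    have hv := IndepFun.variance_sum (X := fun i => g ∘ ξ i) (s := Finset.range m)
      (fun i _ => hL i) (fun i _ j _ hij => (h.iIndepFun_comp hg).indepFun hij)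
    have e : (fun σ => ∑ k ∈ Finset.range m, (g ∘ ξ k) σ) = ∑ k ∈ Finset.range m, g ∘ ξ k := by
      ext σ
      simp
    rw [e, hv, Finset.sum_congr rfl fun i _ => (h.identDistrib_comp hg i 0).variance_eq,
      Finset.sum_const, Finset.card_range, nsmul_eq_mul, variance_eq_sub (hL 0),
      h.integral_comp hg 0, inv_pow, Real.sq_sqrt hm'.le, inv_mul_cancel_left₀ hm'.ne']
    congr 1
    exact h.integral_comp (g := fun θ => g θ ^ 2) (hg.pow 2) 0
  · rw [integral_const_mul, integral_sub (hZL.integrable (by norm_num)) (integrable_const _),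
      integral_finsetSum _ fun i _ => hI i, Finset.sum_congr rfl fun i _ => h.integral_comp hg i]
    simp

lemma memLp_sqrt_mul_empDev (h : IsSample K μ₀ P ξ) {g : E → ℝ} (hg : ContinuousOn g K)
    (m : ℕ) : MemLp (fun σ => √(m : ℝ) * empDev μ₀ (fun i : Fin m => ξ i σ) g) 2 P := by
  simp_rw [sqrt_mul_empDev_eq]
  exact ((memLp_finsetSum _ fun i _ => h.memLp_comp hg i 2).sub (memLp_const _)).const_mul _

/-- The normalized empirical fluctuations of a sample are a fluctuation field. -/
lemma isFluctuationField (h : IsSample K μ₀ P ξ) (m : ℕ) :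
    IsFluctuationField K P fun χ σ => √(m : ℝ) * empDev μ₀ (fun i : Fin m => ξ i σ) χ where
  aemeasurable χ hχ := (h.memLp_sqrt_mul_empDev hχ m).aemeasurable
  add_smul χ χ' a hχ hχ' := by
    refine Eventually.of_forall fun σ => ?_
    simp only
    rw [empDev_add h.isCompact h.mem _ hχ (hχ'.const_mul a), empDev_const_mul]
    ring
  lintegral_le χ M hχ hM := by
    rcases Nat.eq_zero_or_pos m with rfl | hm
    · simp
    obtain ⟨θ, hθ⟩ := h.mem.exists
    refine lintegral_enorm_le_of_integral_sq_le (h.memLp_sqrt_mul_empDev hχ m)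
      ((abs_nonneg _).trans (hM θ hθ)) ?_
    rw [h.integral_sq_sqrt_mul_empDev hχ hm]
    linarith [integral_sq_le_of_forall_mem h.mem hM, sq_nonneg (∫ θ, χ θ ∂μ₀)]

/-- The central limit theorem for continuous functions of the sample. -/
lemma tendstoInDistribution (h : IsSample K μ₀ P ξ) {g : E → ℝ} (hg : ContinuousOn g K)
    {S' : Type*} [MeasurableSpace S'] {Q : Measure S'} [IsProbabilityMeasure Q] {Z : S' → ℝ}
    (hZ : HasGaussianLaw Z Q) (hmean : ∫ σ, Z σ ∂Q = 0)
    (hvar : ∫ σ, Z σ * Z σ ∂Q = ∫ θ, g θ * g θ ∂μ₀ - (∫ θ, g θ ∂μ₀) * ∫ θ, g θ ∂μ₀) :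
    TendstoInDistribution
      (fun (m : ℕ) σ => √(m : ℝ) * empDev μ₀ (fun i : Fin m => ξ i σ) g) atTop Z
      (fun _ => P) Q := by
  have hv : Var[Z; Q] = Var[g ∘ ξ 0; P] := by
    rw [variance_of_integral_eq_zero hZ.aemeasurable hmean, variance_eq_sub (h.memLp_comp hg 0 2),
      h.integral_comp hg 0]
    simp_rw [pow_two]
    rw [hvar]
    congr 1
    exact (h.integral_comp (g := fun θ => g θ * g θ) (hg.mul hg) 0).symm
  have hlaw : HasLaw Z (gaussianReal 0 Var[g ∘ ξ 0; P].toNNReal) Q :=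
    ⟨hZ.aemeasurable, by rw [hZ.map_eq_gaussianReal, hmean, hv]⟩
  have key := tendstoInDistribution_inv_sqrt_mul_sum_sub (X := fun i => g ∘ ξ i) hlaw
    (h.memLp_comp hg 0 2) (h.iIndepFun_comp hg) fun i => h.identDistrib_comp hg i 0
  rw [h.integral_comp hg 0] at key
  simpa only [sqrt_mul_empDev_eq] using key

/-- Along a continuously differentiable curve, the normalized fluctuations of a sample are bounded
in mean, uniformly in time and in the size of the sample. -/
lemma exists_lintegral_le (h : IsSample K μ₀ P ξ) {I : Set ℝ} {χ c : ℝ → E → ℝ}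
    (hχ : IsC1Curve I K χ c) {T : ℝ} (hT : T ∈ I) :
    ∃ B : ℝ, ∀ m : ℕ, ∀ G : S → C(Icc 0 T, ℝ),
      (∀ᵐ σ ∂P, ∀ t, G σ t = empDev μ₀ (fun i : Fin m => ξ i σ) (χ t)) →
      ∫⁻ σ, ‖√(m : ℝ) • G σ‖ₑ ∂P ≤ ENNReal.ofReal B := by
  have hT0 : 0 ≤ T := hχ.subset hT
  obtain ⟨M₀, hM₀⟩ := h.isCompact.exists_bound_of_continuousOn hχ.continuousOn_zero
  obtain ⟨M, hM⟩ := (isCompact_Icc.prod h.isCompact).exists_bound_of_continuousOn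
    (hχ.continuousOn.mono (prod_mono_left (hχ.Icc_subset hT)))
  have hM' : ∀ s ∈ Icc 0 T, ∀ θ ∈ K, |c s θ| ≤ M := fun s hs θ hθ => hM (s, θ) ⟨hs, hθ⟩
  obtain ⟨θ₁, hθ₁⟩ := h.mem.exists
  have hM0 : 0 ≤ M := (abs_nonneg _).trans (hM' 0 ⟨le_rfl, hT0⟩ θ₁ hθ₁)
  have hM₀0 : 0 ≤ M₀ := (norm_nonneg _).trans (hM₀ θ₁ hθ₁)
  refine ⟨M₀ + (M + 1) * T + 1, fun m G hG => ?_⟩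
  set ω : (E → ℝ) → S → ℝ := fun χ σ => √(m : ℝ) * empDev μ₀ (fun i : Fin m => ξ i σ) χ
  have hω := h.isFluctuationField m
  have hpow : Tendsto (fun k : ℕ => √(m : ℝ) * (2 * (T * (1 / 2 : ℝ) ^ k))) atTop (𝓝 0) := by
    simpa using ((((tendsto_pow_atTop_nhds_zero_of_lt_one (r := (1 / 2 : ℝ)) (by norm_num)
      (by norm_num)).const_mul T).const_mul 2).const_mul √(m : ℝ))
  obtain ⟨k, hk1, hk2, hk3⟩ := ((hχ.approxCurve_sub hT).and ((hχ.approximants.bound T hT).and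
    (hpow.eventually_le_const one_pos))).exists
  have hpath : ∀ᵐ σ ∂P, ‖√(m : ℝ) • G σ‖ₑ ≤ ‖ω (χ 0) σ‖ₑ +
      (∫⁻ s in Icc 0 T, ‖∑ j, hχ.approximants.β k j s * ω (c (hχ.approximants.τ k j)) σ‖ₑ) +
      1 := by
    filter_upwards [h.ae_mem, hG] with σ hσ hGσ
    have hb : ∀ t : Icc 0 T, ‖(√(m : ℝ) • G σ) t‖ₑ ≤ ‖ω (χ 0) σ‖ₑ +
        (∫⁻ s in Icc 0 T, ‖∑ j, hχ.approximants.β k j s * ω (c (hχ.approximants.τ k j)) σ‖ₑ) +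
        1 := by
      intro t
      have hcont : ContinuousOn (χ t) K :=
        (hχ.continuousOn_curve hT).comp (f := fun θ => (θ, t)) (by fun_prop)
          fun θ hθ => ⟨hθ, mem_univ _⟩
      have hd : ContinuousOn (fun θ => χ t θ - hχ.approxCurve k t θ) K :=
        hcont.sub (hχ.continuousOn_approxCurve k t)
      have hc : ∀ j, ContinuousOn (c (hχ.approximants.τ k j)) K := fun j =>
        hχ.continuousOn_deriv (hχ.approximants.τ_mem k j)
      have e1 : (√(m : ℝ) • G σ) t = ω (χ 0) σ +
          (∑ j, (∫ s in (0 : ℝ)..t, hχ.approximants.β k j s) *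
            ω (c (hχ.approximants.τ k j)) σ) + ω (fun θ => χ t θ - hχ.approxCurve k t θ) σ := by
        have e2 : χ t = fun θ => (χ 0 θ + ∑ j, (∫ s in (0 : ℝ)..t, hχ.approximants.β k j s) *
            c (hχ.approximants.τ k j) θ) + (χ t θ - hχ.approxCurve k t θ) := by
          funext θ
          simp only [IsC1Curve.approxCurve]
          ring
        change √(m : ℝ) * G σ t = _
        rw [hGσ t]
        conv_lhs => rw [e2]
        have hap : ContinuousOn (fun θ => χ 0 θ +
            ∑ j, (∫ s in (0 : ℝ)..t, hχ.approximants.β k j s) *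
              c (hχ.approximants.τ k j) θ) K := hχ.continuousOn_approxCurve k t
        rw [empDev_add h.isCompact h.mem _ hap hd,
          empDev_add h.isCompact h.mem _ hχ.continuousOn_zero
            (continuousOn_finsetSum _ fun j _ => (hc j).const_mul _),
          empDev_sum h.isCompact h.mem _ _ hc]
        simp only [ω, mul_add, Finset.mul_sum, mul_left_comm]
      have e3 : (∑ j, (∫ s in (0 : ℝ)..t, hχ.approximants.β k j s) *
          ω (c (hχ.approximants.τ k j)) σ) = ∫ s in (0 : ℝ)..t,
            ∑ j, hχ.approximants.β k j s * ω (c (hχ.approximants.τ k j)) σ := by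
        rw [intervalIntegral.integral_finsetSum]
        · simp_rw [intervalIntegral.integral_mul_const]
        · exact fun j _ =>
            ((hχ.approximants.continuous k j).mul continuous_const).intervalIntegrable _ _
      have e4 : ‖ω (fun θ => χ t θ - hχ.approxCurve k t θ) σ‖ₑ ≤ 1 := by
        rw [← ofReal_norm, ← ENNReal.ofReal_one]
        refine ENNReal.ofReal_le_ofReal (le_trans ?_ hk3)
        rw [norm_mul, Real.norm_of_nonneg (Real.sqrt_nonneg _)]
        refine mul_le_mul_of_nonneg_left ?_ (Real.sqrt_nonneg _)
        refine norm_empDev_le h.mem (fun i => hσ i) (by positivity) fun θ hθ => ?_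
        rw [norm_sub_rev]
        exact hk1 t t.2 θ hθ
      rw [e1, e3]
      exact (enorm_add_le _ _).trans (add_le_add ((enorm_add_le _ _).trans
        (add_le_add_right (IsC1Curve.enorm_intervalIntegral_le t.2) _)) e4)
    by_cases htop : ‖ω (χ 0) σ‖ₑ +
        (∫⁻ s in Icc 0 T, ‖∑ j, hχ.approximants.β k j s * ω (c (hχ.approximants.τ k j)) σ‖ₑ) +
        1 = ∞
    · rw [htop]
      exact le_top
    · rw [← ofReal_norm, ENNReal.ofReal_le_iff_le_toReal htop]
      refine (ContinuousMap.norm_le _ ENNReal.toReal_nonneg).2 fun t => ?_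
      rw [← ENNReal.ofReal_le_iff_le_toReal htop, ofReal_norm]
      exact hb t
  refine (lintegral_mono_ae hpath).trans ?_
  rw [lintegral_add_right _ measurable_const, lintegral_add_left' (hω.aemeasurable _
    hχ.continuousOn_zero).enorm, lintegral_const, measure_univ, mul_one,
    ENNReal.ofReal_add (by positivity) zero_le_one, ENNReal.ofReal_add hM₀0 (by positivity),
    ENNReal.ofReal_one, ENNReal.ofReal_mul (by positivity)]
  refine add_le_add_left (add_le_add (hω.lintegral_le _ _ hχ.continuousOn_zero hM₀)
    (hω.lintegral_lintegral_le (fun j => hχ.continuousOn_deriv (hχ.approximants.τ_mem k j))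
      (hχ.approximants.continuous k) fun s hs θ hθ => ?_)) _
  have h1 := hk2 s hs θ hθ
  have h2 := hM' s hs θ hθ
  have h3 : (1 / 2 : ℝ) ^ k ≤ 1 := pow_le_one₀ (by norm_num) (by norm_num)
  rw [abs_le] at *
  constructor <;> linarith

end IsSample

end Sample

section Convergence

variable {S : Type*} [MeasurableSpace S] {P : Measure S} [IsProbabilityMeasure P]

/-- If almost surely `|R_m| ≤ η τ_m` for large `m`, for every `η > 0`, and `τ_m` is bounded in
mean, then `R_m` tends to zero in probability. -/
lemma tendstoInMeasure_zero_of_le {R τ : ℕ → S → ℝ} (hR : ∀ m, AEMeasurable (R m) P)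
    (hτ : ∀ m, AEMeasurable (τ m) P) (hτ0 : ∀ m σ, 0 ≤ τ m σ) {B : ℝ}
    (hB : ∀ m, ∫⁻ σ, ‖τ m σ‖ₑ ∂P ≤ ENNReal.ofReal B)
    (hle : ∀ η > 0, ∀ᵐ σ ∂P, ∀ᶠ m in atTop, |R m σ| ≤ η * τ m σ) :
    TendstoInMeasure P R atTop 0 := by
  rw [tendstoInMeasure_iff_norm]
  intro a ha
  refine ENNReal.tendsto_nhds_zero.2 fun δ hδ => ?_
  obtain ⟨ρ, hρ0, hρδ⟩ := ENNReal.lt_iff_exists_real_btwn.1 (ENNReal.half_pos hδ.ne')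
  have hρ : 0 < ρ := ENNReal.ofReal_pos.1 hρδ.1
  set η : ℝ := ρ * (a / 2) / (|B| + 1)
  have hη : 0 < η := by positivity
  -- the excess of `|R_m|` over `η τ_m` vanishes for large `m`
  have hexc : TendstoInMeasure P (fun m σ => max (|R m σ| - η * τ m σ) 0) atTop 0 := by
    refine tendstoInMeasure_of_tendsto_ae (fun m => ?_) ?_
    · exact ((((hR m).abs).sub ((hτ m).const_mul η)).max
        aemeasurable_const).aestronglyMeasurable
    · filter_upwards [hle η hη] with σ hσ
      refine tendsto_const_nhds.congr' (hσ.mono fun m hm => ?_)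
      simp [hm]
  have h1 := (tendstoInMeasure_iff_norm.1 hexc (a / 2) (by positivity)).eventually_le_const
    (ENNReal.half_pos hδ.ne')
  filter_upwards [h1] with m hm
  have hsub : {σ | a ≤ ‖R m σ - (0 : S → ℝ) σ‖} ⊆
      {σ | a / 2 ≤ ‖max (|R m σ| - η * τ m σ) 0 - (0 : S → ℝ) σ‖} ∪
        {σ | ENNReal.ofReal (a / 2 / η) ≤ ‖τ m σ‖ₑ} := by
    intro σ hσ
    simp only [Pi.zero_apply, sub_zero, mem_ofPred_eq, Real.norm_eq_abs, mem_union] at hσ ⊢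
    by_cases hc : a / 2 ≤ η * τ m σ
    · right
      rw [Real.enorm_of_nonneg (hτ0 m σ)]
      refine ENNReal.ofReal_le_ofReal ?_
      rw [div_le_iff₀ hη, mul_comm]
      exact hc
    · left
      refine le_trans ?_ (le_abs_self _)
      refine le_trans ?_ (le_max_left _ _)
      linarith
  have h2 : P {σ | ENNReal.ofReal (a / 2 / η) ≤ ‖τ m σ‖ₑ} ≤ ENNReal.ofReal ρ := by
    refine (meas_ge_le_lintegral_div (hτ m).enorm ?_ ENNReal.ofReal_ne_top).trans ?_
    · exact (ENNReal.ofReal_pos.2 (by positivity)).ne'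
    · refine (ENNReal.div_le_div_right (hB m) _).trans ?_
      rw [← ENNReal.ofReal_div_of_pos (by positivity)]
      refine ENNReal.ofReal_le_ofReal ?_
      have e : a / 2 / η = (|B| + 1) / ρ := by
        simp only [η]
        field_simp
      rw [e, div_le_iff₀ (by positivity), mul_div_cancel₀ _ hρ.ne']
      linarith [le_abs_self B]
  calc _ ≤ _ := measure_mono hsub
    _ ≤ δ / 2 + δ / 2 := (measure_union_le _ _).trans (add_le_add hm (h2.trans hρδ.2.le))
    _ = δ := ENNReal.add_halves δ

end Convergence

/-! ### Volterra equations on an interval -/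

section Glue

variable {W F : Type*} [NormedAddCommGroup F] {T : ℝ}

/-- The restriction of a kernel to `[0, T]`, as a continuous map; the junk value is `0`. -/
def kernelC (T : ℝ) (κ : ℝ → ℝ → F) : C(Icc 0 T × Icc 0 T, F) := toC fun q => κ q.1 q.2

/-- The restriction of a path to `[0, T]`, as a continuous map; the junk value is `0`. -/
def pathC (T : ℝ) (v : ℝ → F) : C(Icc 0 T, F) := toC fun t => v t

lemma pathC_apply {v : ℝ → F} (hv : ContinuousOn v (Icc 0 T)) (t : Icc 0 T) :
    pathC T v t = v t := toC_apply_of_continuousOn hv t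

lemma kernelC_apply {κ : ℝ → ℝ → F}
    (hκ : ContinuousOn (fun q : ℝ × ℝ => κ q.1 q.2) (Icc 0 T ×ˢ Icc 0 T))
    (q : Icc 0 T × Icc 0 T) : kernelC T κ q = κ q.1 q.2 := by
  refine toC_apply (g := fun q : Icc 0 T × Icc 0 T => κ q.1 q.2) ?_ q
  exact continuousOn_univ.1 (hκ.comp (f := fun q : Icc 0 T × Icc 0 T => ((q.1 : ℝ), (q.2 : ℝ)))
    (by fun_prop) (s := univ) fun q _ => ⟨q.1.2, q.2.2⟩)

variable [NormedAddCommGroup W] [NormedSpace ℝ W] [CompleteSpace W] [NormedSpace ℝ F]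

/-- The solution `u` of the Volterra equation `u_t = v_t + ∫₀ᵗ κ(t, s) u_s ds`. Its value at time
`t` is obtained from the equation on the interval `[0, t]`. -/
def solution (κ : ℝ → ℝ → W →L[ℝ] W) (v : ℝ → W) (t : ℝ) : W :=
  if h : 0 ≤ t then resolvent h (kernelC t κ) (pathC t v) ⟨t, h, le_rfl⟩ else 0

variable {κ : ℝ → ℝ → W →L[ℝ] W} {v : ℝ → W}

/-- By uniqueness, the equations on the intervals `[0, t]`, `t ≤ T`, have the same solution as the
equation on `[0, T]`. -/
lemma solution_eq (hT : 0 ≤ T)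
    (hκ : ContinuousOn (fun q : ℝ × ℝ => κ q.1 q.2) (Icc 0 T ×ˢ Icc 0 T))
    (hv : ContinuousOn v (Icc 0 T)) (t : Icc 0 T) :
    solution κ v t = resolvent hT (kernelC T κ) (pathC T v) t := by
  obtain ⟨t, ht0, htT⟩ := t
  set U := resolvent hT (kernelC T κ) (pathC T v)
  have hsub : Icc 0 t ⊆ Icc 0 T := Icc_subset_Icc_right htT
  let U' : C(Icc 0 t, W) := U.comp ⟨fun r => ⟨r, hsub r.2⟩, by fun_prop⟩
  have hU' : U' = pathC t v + volterra ht0 (kernelC t κ) U' := by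
    ext r
    have hr : U ⟨r, hsub r.2⟩ = _ := congrArg (fun f : C(Icc 0 T, W) => f ⟨r, hsub r.2⟩)
      (resolvent_eq hT (kernelC T κ) (pathC T v))
    change U ⟨r, hsub r.2⟩ = _
    rw [hr, ContinuousMap.add_apply, ContinuousMap.add_apply, pathC_apply hv,
      pathC_apply (hv.mono hsub)]
    congr 1
    rw [volterra_eq_of_eqOn hT (h := fun s => κ r s (U (projIcc 0 T hT s))),
      volterra_eq_of_eqOn ht0 (h := fun s => κ r s (U (projIcc 0 T hT s)))]
    · intro s hs _
      rw [kernelC_apply (hκ.mono (prod_mono hsub hsub)), projIcc_of_mem hT (hsub hs)]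
      rfl
    · intro s hs _
      rw [kernelC_apply hκ, projIcc_of_mem hT hs]
  rw [solution, dif_pos ht0, ← eq_resolvent ht0 hU']
  rfl

lemma volterra_solution_eq (hT : 0 ≤ T)
    (hκ : ContinuousOn (fun q : ℝ × ℝ => κ q.1 q.2) (Icc 0 T ×ˢ Icc 0 T))
    (hv : ContinuousOn v (Icc 0 T)) {κ' : ℝ → ℝ → W →L[ℝ] F}
    (hκ' : ContinuousOn (fun q : ℝ × ℝ => κ' q.1 q.2) (Icc 0 T ×ˢ Icc 0 T)) (t : Icc 0 T) :
    volterra hT (kernelC T κ') (resolvent hT (kernelC T κ) (pathC T v)) t =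
      ∫ s in (0 : ℝ)..t, κ' t s (solution κ v s) :=
  volterra_eq_of_eqOn hT fun s hs _ => by
    rw [kernelC_apply hκ', ← solution_eq hT hκ hv]

lemma continuousOn_solution (hT : 0 ≤ T)
    (hκ : ContinuousOn (fun q : ℝ × ℝ => κ q.1 q.2) (Icc 0 T ×ˢ Icc 0 T))
    (hv : ContinuousOn v (Icc 0 T)) : ContinuousOn (solution κ v) (Icc 0 T) := by
  rw [continuousOn_iff_continuous_domRestrict]
  exact (resolvent hT (kernelC T κ) (pathC T v)).continuous.congr fun t =>
    (solution_eq hT hκ hv t).symm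

lemma solution_eq_add_integral (hT : 0 ≤ T)
    (hκ : ContinuousOn (fun q : ℝ × ℝ => κ q.1 q.2) (Icc 0 T ×ˢ Icc 0 T))
    (hv : ContinuousOn v (Icc 0 T)) {t : ℝ} (ht : t ∈ Icc 0 T) :
    solution κ v t = v t + ∫ s in (0 : ℝ)..t, κ t s (solution κ v s) := by
  rw [solution_eq hT hκ hv ⟨t, ht⟩, resolvent_eq, ContinuousMap.add_apply, pathC_apply hv,
    volterra_solution_eq hT hκ hv hκ]

lemma continuousOn_integral_solution (hT : 0 ≤ T)
    (hκ : ContinuousOn (fun q : ℝ × ℝ => κ q.1 q.2) (Icc 0 T ×ˢ Icc 0 T))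
    (hv : ContinuousOn v (Icc 0 T)) {κ' : ℝ → ℝ → W →L[ℝ] F}
    (hκ' : ContinuousOn (fun q : ℝ × ℝ => κ' q.1 q.2) (Icc 0 T ×ˢ Icc 0 T)) :
    ContinuousOn (fun t => ∫ s in (0 : ℝ)..t, κ' t s (solution κ v s)) (Icc 0 T) := by
  rw [continuousOn_iff_continuous_domRestrict]
  exact (volterra hT (kernelC T κ') (resolvent hT (kernelC T κ) (pathC T v))).continuous.congr
    fun t => volterra_solution_eq hT hκ hv hκ' t

lemma intervalIntegrable_kernel_solution (hT : 0 ≤ T)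
    (hκ : ContinuousOn (fun q : ℝ × ℝ => κ q.1 q.2) (Icc 0 T ×ˢ Icc 0 T))
    (hv : ContinuousOn v (Icc 0 T)) {κ' : ℝ → ℝ → W →L[ℝ] F}
    (hκ' : ContinuousOn (fun q : ℝ × ℝ => κ' q.1 q.2) (Icc 0 T ×ˢ Icc 0 T)) :
    IntervalIntegrable (fun s => κ' T s (solution κ v s)) volume 0 T := by
  refine ContinuousOn.intervalIntegrable ?_
  rw [uIcc_of_le hT]
  refine ContinuousOn.clm_apply ?_ (continuousOn_solution hT hκ hv)
  exact hκ'.comp (f := fun s => (T, s)) (by fun_prop) fun s hs => ⟨⟨hT, le_rfl⟩, hs⟩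

end Glue

/-! ### Fluctuations of a mean-field system -/

section MeanField

variable {k n : ℕ} {F : Type*} [NormedAddCommGroup F] [NormedSpace ℝ F]

/-- A mean-field system on the time interval `I`: the characteristics `Y` of the field
`b(y, f_t)`, where `f_t` is the mean of `φ(Y_t)` under the initial law `μ₀`, which is carried by
the compact set `K`; `P` is the fundamental solution of the linearized equation. -/
structure IsMeanField (D K : Set (Euc k)) (I : Set ℝ) (μ₀ : Measure (Euc k))
    (φ : Euc k → Fin n → ℝ) (b : Euc k × (Fin n → ℝ) → Euc k) (Y : ℝ → Euc k → Euc k)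
    (f : ℝ → Fin n → ℝ) (P : ℝ → Euc k → Euc k →L[ℝ] Euc k) : Prop where
  ordConnected : I.OrdConnected
  zero_mem : (0 : ℝ) ∈ I
  subset : I ⊆ Ici 0
  continuousOn : ContinuousOn (fun q : ℝ × Euc k => Y q.1 q.2) (I ×ˢ K)
  ae_mem : ∀ᵐ θ ∂μ₀, θ ∈ K
  characteristics : ∀ T ∈ I, IsCharacteristics D K T φ b Y f
  fundamental : ∀ T ∈ I, IsFundamental K T (fieldDeriv b Y f) P
  mean : ∀ t ∈ I, f t = ∫ θ, φ (Y t θ) ∂μ₀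

/-- The mean over the characteristics of the response of the observable `ψ` at time `t` to a
perturbation of the field at time `s`. -/
def meanResponse (b : Euc k × (Fin n → ℝ) → Euc k) (Y : ℝ → Euc k → Euc k) (f : ℝ → Fin n → ℝ)
    (P : ℝ → Euc k → Euc k →L[ℝ] Euc k) (μ₀ : Measure (Euc k)) (ψ : Euc k → F) (t s : ℝ) :
    (Fin n → ℝ) →L[ℝ] F :=
  ∫ θ, responseKernel b Y f P ψ t s θ ∂μ₀

/-- The influence at time `t` of a particle started at `θ` on the mean of the observable `ψ`: the
value of `ψ` on its characteristic, and the effect of the particle on the field. -/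
def influence (φ : Euc k → Fin n → ℝ) (b : Euc k × (Fin n → ℝ) → Euc k) (Y : ℝ → Euc k → Euc k)
    (f : ℝ → Fin n → ℝ) (P : ℝ → Euc k → Euc k →L[ℝ] Euc k) (μ₀ : Measure (Euc k))
    (ψ : Euc k → ℝ) (t : ℝ) (θ : Euc k) : ℝ :=
  ψ (Y t θ) + ∫ s in (0 : ℝ)..t, meanResponse b Y f P μ₀ ψ t s
    (solution (meanResponse b Y f P μ₀ φ) (fun s => φ (Y s θ)) s)

namespace IsMeanField

variable {D K : Set (Euc k)} {I : Set ℝ} {μ₀ : Measure (Euc k)} {φ : Euc k → Fin n → ℝ}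
  {b : Euc k × (Fin n → ℝ) → Euc k} {Y : ℝ → Euc k → Euc k} {f : ℝ → Fin n → ℝ}
  {P : ℝ → Euc k → Euc k →L[ℝ] Euc k}

lemma isCompact (h : IsMeanField D K I μ₀ φ b Y f P) : IsCompact K :=
  (h.characteristics 0 h.zero_mem).isCompact

lemma isOpen (h : IsMeanField D K I μ₀ φ b Y f P) : IsOpen D :=
  (h.characteristics 0 h.zero_mem).isOpen

lemma Icc_subset (h : IsMeanField D K I μ₀ φ b Y f P) {T : ℝ} (hT : T ∈ I) : Icc 0 T ⊆ I :=
  h.ordConnected.out h.zero_mem hT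

lemma mem (h : IsMeanField D K I μ₀ φ b Y f P) {t : ℝ} (ht : t ∈ I) {θ : Euc k} (hθ : θ ∈ K) :
    Y t θ ∈ D :=
  (h.characteristics t ht).mem t ⟨h.subset ht, le_rfl⟩ θ hθ

lemma contDiffOn_obs (h : IsMeanField D K I μ₀ φ b Y f P) : ContDiffOn ℝ 1 φ D :=
  (h.characteristics 0 h.zero_mem).contDiffOn_obs

lemma contDiffOn_obs_apply (h : IsMeanField D K I μ₀ φ b Y f P) (l : Fin n) :
    ContDiffOn ℝ 1 (fun z => φ z l) D :=
  contDiffOn_pi.1 h.contDiffOn_obs l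

lemma continuousOn_mean (h : IsMeanField D K I μ₀ φ b Y f P) : ContinuousOn f I :=
  continuousOn_of_forall_Icc h.subset fun T hT => (h.characteristics T hT).continuousOn_mean

lemma continuousOn_comp (h : IsMeanField D K I μ₀ φ b Y f P) {G : Type*}
    [TopologicalSpace G] {ψ : Euc k → G}
    (hψ : ContinuousOn ψ D) : ContinuousOn (fun q : ℝ × Euc k => ψ (Y q.1 q.2)) (I ×ˢ K) :=
  hψ.comp h.continuousOn fun _ hq => h.mem hq.1 hq.2

lemma continuousOn_comp_Icc (h : IsMeanField D K I μ₀ φ b Y f P) {G : Type*}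
    [TopologicalSpace G] {ψ : Euc k → G}
    (hψ : ContinuousOn ψ D) {T : ℝ} (hT : T ∈ I) :
    ContinuousOn (fun q : Euc k × Icc 0 T => ψ (Y q.2 q.1)) (K ×ˢ univ) :=
  (h.continuousOn_comp hψ).comp (f := fun q : Euc k × Icc 0 T => ((q.2 : ℝ), q.1)) (by fun_prop)
    fun q hq => ⟨h.Icc_subset hT q.2.2, hq.1⟩

lemma continuousOn_path (h : IsMeanField D K I μ₀ φ b Y f P) {G : Type*}
    [TopologicalSpace G] {ψ : Euc k → G}
    (hψ : ContinuousOn ψ D) {θ : Euc k} (hθ : θ ∈ K) : ContinuousOn (fun s => ψ (Y s θ)) I :=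
  (h.continuousOn_comp hψ).comp (f := fun s => (s, θ)) (by fun_prop) fun _ hs => ⟨hs, hθ⟩

lemma continuousOn_pathC (h : IsMeanField D K I μ₀ φ b Y f P) {G : Type*}
    [NormedAddCommGroup G] {ψ : Euc k → G}
    (hψ : ContinuousOn ψ D) {T : ℝ} (hT : T ∈ I) :
    ContinuousOn (fun θ => pathC T fun s => ψ (Y s θ)) K :=
  continuousOn_toC (h.continuousOn_comp_Icc hψ hT)

lemma continuousOn_initial (h : IsMeanField D K I μ₀ φ b Y f P) {G : Type*}
    [TopologicalSpace G] {ψ : Euc k → G}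
    (hψ : ContinuousOn ψ D) {t : ℝ} (ht : t ∈ I) : ContinuousOn (fun θ => ψ (Y t θ)) K :=
  (h.continuousOn_comp hψ).comp (f := fun θ => (t, θ)) (by fun_prop) fun _ hθ => ⟨ht, hθ⟩

/-- An observable along the characteristics is a continuously differentiable curve of functions of
the initial position. -/
lemma isC1Curve (h : IsMeanField D K I μ₀ φ b Y f P) {ψ : Euc k → ℝ} (hψ : ContDiffOn ℝ 1 ψ D) :
    IsC1Curve I K (fun t θ => ψ (Y t θ)) fun t θ => fderiv ℝ ψ (Y t θ) (b (Y t θ, f t)) where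
  isCompact := h.isCompact
  ordConnected := h.ordConnected
  zero_mem := h.zero_mem
  subset := h.subset
  continuousOn_zero := h.continuousOn_initial hψ.continuousOn h.zero_mem
  continuousOn := by
    refine ContinuousOn.clm_apply (h.continuousOn_comp
      (hψ.continuousOn_fderiv_of_isOpen h.isOpen le_rfl)) ?_
    refine (h.characteristics 0 h.zero_mem).contDiffOn_field.continuousOn.comp
      (h.continuousOn.prodMk (h.continuousOn_mean.comp continuousOn_fst fun _ hq => hq.1)) ?_
    exact fun q hq => ⟨h.mem hq.1 hq.2, mem_univ _⟩
  eq_integral t ht θ hθ := by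
    have ht0 : 0 ≤ t := h.subset ht
    have hc := h.characteristics t ht
    have hd : ∀ s ∈ Icc 0 t, HasDerivWithinAt (fun s => ψ (Y s θ))
        (fderiv ℝ ψ (Y s θ) (b (Y s θ, f s))) (Icc 0 t) s := fun s hs => by
      have h1 := (hψ.differentiableOn one_ne_zero).differentiableAt
        (h.isOpen.mem_nhds (hc.mem s hs θ hθ))
      exact h1.hasFDerivAt.comp_hasDerivWithinAt s (hc.ode s hs θ hθ)
    have hcont : ContinuousOn (fun s => fderiv ℝ ψ (Y s θ) (b (Y s θ, f s))) (Icc 0 t) := by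
      refine ContinuousOn.clm_apply ((h.continuousOn_path
        (hψ.continuousOn_fderiv_of_isOpen h.isOpen le_rfl) hθ).mono (h.Icc_subset ht)) ?_
      exact hc.contDiffOn_field.continuousOn.comp
        (((h.continuousOn_path continuousOn_id hθ).mono (h.Icc_subset ht)).prodMk
          hc.continuousOn_mean) fun s hs => ⟨hc.mem s hs θ hθ, mem_univ _⟩
    rw [intervalIntegral.integral_eq_sub_of_hasDerivAt_of_le ht0
      (fun s hs => (hd s hs).continuousWithinAt)
      (fun s hs => (hd s (Ioo_subset_Icc_self hs)).hasDerivAt (Icc_mem_nhds hs.1 hs.2))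
      (hcont.intervalIntegrable_of_Icc ht0)]
    ring

lemma continuousOn_toC_responseKernel (h : IsMeanField D K I μ₀ φ b Y f P) {ψ : Euc k → F}
    (hψ : ContDiffOn ℝ 1 ψ D) {T : ℝ} (hT : T ∈ I) :
    ContinuousOn (fun θ => toC fun q : Icc 0 T × Icc 0 T =>
      responseKernel b Y f P ψ q.1 q.2 θ) K :=
  continuousOn_toC (g := fun q : Euc k × Icc 0 T × Icc 0 T =>
    responseKernel b Y f P ψ q.2.1 q.2.2 q.1)
    ((h.characteristics T hT).continuousOn_responseKernel (h.fundamental T hT) hψ)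

variable [IsProbabilityMeasure μ₀]

section Kernel

variable [CompleteSpace F]

lemma integral_responseKernel_apply (h : IsMeanField D K I μ₀ φ b Y f P) {ψ : Euc k → F}
    (hψ : ContDiffOn ℝ 1 ψ D) {T : ℝ} (hT : T ∈ I) (q : Icc 0 T × Icc 0 T) :
    (∫ θ, toC (fun q : Icc 0 T × Icc 0 T => responseKernel b Y f P ψ q.1 q.2 θ) ∂μ₀) q =
      meanResponse b Y f P μ₀ ψ q.1 q.2 := by
  have hi := integrable_of_continuousOn h.isCompact h.ae_mem
    (h.continuousOn_toC_responseKernel hψ hT)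
  have h1 := (ContinuousMap.evalCLM ℝ q).integral_comp_comm hi
  simp only [ContinuousMap.evalCLM_apply] at h1
  rw [← h1, meanResponse]
  refine integral_congr_ae (h.ae_mem.mono fun θ hθ => ?_)
  exact toC_apply (continuous_section
    ((h.characteristics T hT).continuousOn_responseKernel (h.fundamental T hT) hψ) hθ) q

lemma continuousOn_meanResponse (h : IsMeanField D K I μ₀ φ b Y f P) {ψ : Euc k → F}
    (hψ : ContDiffOn ℝ 1 ψ D) {T : ℝ} (hT : T ∈ I) :
    ContinuousOn (fun q : ℝ × ℝ => meanResponse b Y f P μ₀ ψ q.1 q.2) (Icc 0 T ×ˢ Icc 0 T) := by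
  set N := ∫ θ, toC (fun q : Icc 0 T × Icc 0 T => responseKernel b Y f P ψ q.1 q.2 θ) ∂μ₀
  have hT0 : 0 ≤ T := h.subset hT
  have h1 : Continuous fun q : ℝ × ℝ => N (projIcc 0 T hT0 q.1, projIcc 0 T hT0 q.2) :=
    N.continuous.comp (by fun_prop)
  refine h1.continuousOn.congr fun q hq => ?_
  simp only
  rw [h.integral_responseKernel_apply hψ hT, projIcc_of_mem hT0 hq.1, projIcc_of_mem hT0 hq.2]

lemma kernelC_meanResponse (h : IsMeanField D K I μ₀ φ b Y f P) {ψ : Euc k → F}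
    (hψ : ContDiffOn ℝ 1 ψ D) {T : ℝ} (hT : T ∈ I) :
    kernelC T (meanResponse b Y f P μ₀ ψ) =
      ∫ θ, toC (fun q : Icc 0 T × Icc 0 T => responseKernel b Y f P ψ q.1 q.2 θ) ∂μ₀ := by
  ext1 q
  rw [kernelC_apply (h.continuousOn_meanResponse hψ hT), h.integral_responseKernel_apply hψ hT]

end Kernel

/-- The effect of a path of the field on the mean of the observable `ψ` at time `T`. -/
def effect (h : IsMeanField D K I μ₀ φ b Y f P) (ψ : Euc k → ℝ) {T : ℝ} (hT : T ∈ I) :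
    C(Icc 0 T, Fin n → ℝ) →L[ℝ] ℝ :=
  (ContinuousMap.evalCLM ℝ (⟨T, h.subset hT, le_rfl⟩ : Icc 0 T)).comp
    ((volterra (h.subset hT) (kernelC T (meanResponse b Y f P μ₀ ψ))).comp
      (resolvent (h.subset hT) (kernelC T (meanResponse b Y f P μ₀ φ))))

lemma effect_apply (h : IsMeanField D K I μ₀ φ b Y f P) {ψ : Euc k → ℝ}
    (hψ : ContDiffOn ℝ 1 ψ D) {T : ℝ} (hT : T ∈ I) {v : ℝ → Fin n → ℝ}
    (hv : ContinuousOn v (Icc 0 T)) :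
    h.effect ψ hT (pathC T v) = ∫ s in (0 : ℝ)..T, meanResponse b Y f P μ₀ ψ T s
      (solution (meanResponse b Y f P μ₀ φ) v s) :=
  volterra_solution_eq (h.subset hT) (h.continuousOn_meanResponse h.contDiffOn_obs hT) hv
    (h.continuousOn_meanResponse hψ hT) ⟨T, h.subset hT, le_rfl⟩

lemma influence_eq (h : IsMeanField D K I μ₀ φ b Y f P) {ψ : Euc k → ℝ}
    (hψ : ContDiffOn ℝ 1 ψ D) {T : ℝ} (hT : T ∈ I) {θ : Euc k} (hθ : θ ∈ K) :
    influence φ b Y f P μ₀ ψ T θ = ψ (Y T θ) + h.effect ψ hT (pathC T fun s => φ (Y s θ)) := by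
  rw [influence, h.effect_apply hψ hT ((h.continuousOn_path h.contDiffOn_obs.continuousOn hθ).mono
    (h.Icc_subset hT))]

lemma continuousOn_influence (h : IsMeanField D K I μ₀ φ b Y f P) {ψ : Euc k → ℝ}
    (hψ : ContDiffOn ℝ 1 ψ D) {T : ℝ} (hT : T ∈ I) :
    ContinuousOn (influence φ b Y f P μ₀ ψ T) K := by
  refine ContinuousOn.congr ?_ fun θ hθ => h.influence_eq hψ hT hθ
  exact (h.continuousOn_initial hψ.continuousOn hT).add
    ((h.effect ψ hT).continuous.comp_continuousOn
      (h.continuousOn_pathC h.contDiffOn_obs.continuousOn hT))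

/-- The fluctuation field at the influence function is the solution of the Volterra equation driven
by the continuous versions of the fluctuations along the characteristics. -/
lemma ae_influence_eq (h : IsMeanField D K I μ₀ φ b Y f P) {S : Type*} [MeasurableSpace S]
    {Q : Measure S} [SFinite Q] {ω : (Euc k → ℝ) → S → ℝ} (hω : IsFluctuationField K Q ω)
    {ψ : Euc k → ℝ} (hψ : ContDiffOn ℝ 1 ψ D) {T : ℝ} (hT : T ∈ I) :
    ω (influence φ b Y f P μ₀ ψ T) =ᵐ[Q] fun σ => (h.isC1Curve hψ).version ω T σ +
      ∫ s in (0 : ℝ)..T, meanResponse b Y f P μ₀ ψ T s (solution (meanResponse b Y f P μ₀ φ)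
        (fun s l => (h.isC1Curve (h.contDiffOn_obs_apply l)).version ω s σ) s) := by
  let ι (l : Fin n) : C(Icc 0 T, ℝ) →L[ℝ] C(Icc 0 T, Fin n → ℝ) :=
    ContinuousLinearMap.compLeftContinuous ℝ (Icc 0 T)
      (ContinuousLinearMap.single ℝ (fun _ : Fin n => ℝ) l)
  have hι : ∀ l g s, ι l g s = Pi.single l (g s) := fun _ _ _ => rfl
  -- the effect of a path is the sum of the effects of its coordinates
  have hdec : ∀ {v : ℝ → Fin n → ℝ}, ContinuousOn v (Icc 0 T) →
      h.effect ψ hT (pathC T v) = ∑ l, h.effect ψ hT (ι l (pathC T fun s => v s l)) := by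
    intro v hv
    rw [← map_sum]
    congr 1
    ext s l
    rw [pathC_apply hv, ContinuousMap.sum_apply, Finset.sum_apply, Finset.sum_eq_single l]
    · rw [hι, Pi.single_eq_same,
        pathC_apply (v := fun s => v s l) ((continuous_apply l).comp_continuousOn hv)]
    · intro j _ hj
      rw [hι, Pi.single_eq_of_ne hj.symm]
    · simp
  have hl : ∀ l, ContinuousOn (fun θ => h.effect ψ hT (ι l (pathC T fun s => φ (Y s θ) l))) K :=
    fun l => ((h.effect ψ hT).comp (ι l)).continuous.comp_continuousOn
      (h.continuousOn_pathC (h.contDiffOn_obs_apply l).continuousOn hT)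
  have e1 : EqOn (influence φ b Y f P μ₀ ψ T) (fun θ => ψ (Y T θ) +
      ∑ l, 1 * h.effect ψ hT (ι l (pathC T fun s => φ (Y s θ) l))) K := fun θ hθ => by
    simp only [one_mul]
    rw [h.influence_eq hψ hT hθ, hdec ((h.continuousOn_path h.contDiffOn_obs.continuousOn hθ).mono
      (h.Icc_subset hT))]
  have h1 := hω.congr (h.continuousOn_influence hψ hT) e1
  have h2 := hω.add_sum Finset.univ (h.continuousOn_initial hψ.continuousOn hT) hl fun _ => 1
  have h3 := (h.isC1Curve hψ).ae_version_eq hω hT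
  have h4 := ae_all_iff.2 fun l => (h.isC1Curve (h.contDiffOn_obs_apply l)).ae_apply_version hω hT
    ((h.effect ψ hT).comp (ι l))
  have h5 := ae_all_iff.2 fun l =>
    (h.isC1Curve (h.contDiffOn_obs_apply l)).ae_continuousOn_version hω
  filter_upwards [h1, h2, h3, h4, h5] with σ h1 h2 h3 h4 h5
  have hv : ContinuousOn (fun s l => (h.isC1Curve (h.contDiffOn_obs_apply l)).version ω s σ)
      (Icc 0 T) := (continuousOn_pi.2 h5).mono (h.Icc_subset hT)
  rw [h1, h2, h3, ← h.effect_apply hψ hT hv, hdec hv]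
  simp only [one_mul]
  congr 1
  exact Finset.sum_congr rfl fun l _ => (h4 l).symm

lemma meanResponse_obs_apply (h : IsMeanField D K I μ₀ φ b Y f P) {T t s : ℝ} (hT : T ∈ I)
    (ht : t ∈ Icc 0 T) (hs : s ∈ Icc 0 T) (w : Fin n → ℝ) (l : Fin n) :
    meanResponse b Y f P μ₀ φ t s w l = meanResponse b Y f P μ₀ (fun z => φ z l) t s w := by
  have hi : ∀ {F : Type} [NormedAddCommGroup F] [NormedSpace ℝ F] {ψ : Euc k → F},
      ContDiffOn ℝ 1 ψ D → Integrable (responseKernel b Y f P ψ t s) μ₀ := fun hψ =>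
    integrable_of_continuousOn h.isCompact h.ae_mem
      (((h.characteristics T hT).continuousOn_responseKernel (h.fundamental T hT) hψ).comp
        (f := fun θ => (θ, (⟨t, ht⟩ : Icc 0 T), (⟨s, hs⟩ : Icc 0 T))) (by fun_prop)
        fun θ hθ => ⟨hθ, mem_univ _⟩)
  have h1 := hi h.contDiffOn_obs
  rw [meanResponse, meanResponse, ContinuousLinearMap.integral_apply h1,
    ContinuousLinearMap.integral_apply (hi (h.contDiffOn_obs_apply l))]
  have h2 := (ContinuousLinearMap.proj (R := ℝ) (φ := fun _ : Fin n => ℝ) l).integral_comp_comm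
    (h1.apply_continuousLinearMap w)
  refine h2.symm.trans (integral_congr_ae (h.ae_mem.mono fun θ hθ => ?_))
  have hd := (h.contDiffOn_obs.differentiableOn one_ne_zero).differentiableAt
    (h.isOpen.mem_nhds (h.mem (h.Icc_subset hT ht) hθ))
  have h3 := ((ContinuousLinearMap.proj (R := ℝ) (φ := fun _ : Fin n => ℝ) l).hasFDerivAt.comp _
    hd.hasFDerivAt).fderiv
  simp only [responseKernel, ContinuousLinearMap.comp_apply]
  exact (DFunLike.congr_fun h3 _).symm

lemma solution_apply_eq (h : IsMeanField D K I μ₀ φ b Y f P) {v : ℝ → Fin n → ℝ}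
    (hv : ContinuousOn v I) {t : ℝ} (ht : t ∈ I) (l : Fin n) :
    solution (meanResponse b Y f P μ₀ φ) v t l = v t l + ∫ s in (0 : ℝ)..t,
      meanResponse b Y f P μ₀ (fun z => φ z l) t s (solution (meanResponse b Y f P μ₀ φ) v s) := by
  have ht0 : 0 ≤ t := h.subset ht
  have hκ := h.continuousOn_meanResponse h.contDiffOn_obs ht
  have hv' := hv.mono (h.Icc_subset ht)
  rw [solution_eq_add_integral ht0 hκ hv' ⟨ht0, le_rfl⟩, Pi.add_apply]
  congr 1
  have h1 := (ContinuousLinearMap.proj (R := ℝ) (φ := fun _ : Fin n => ℝ)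
    l).intervalIntegral_comp_comm (intervalIntegrable_kernel_solution ht0 hκ hv' hκ)
  refine h1.symm.trans (intervalIntegral.integral_congr fun s hs => ?_)
  rw [uIcc_of_le ht0] at hs
  exact h.meanResponse_obs_apply ht ⟨ht0, le_rfl⟩ hs _ l

end IsMeanField

end MeanField

/-! ### The central limit theorem for the particles -/

section Empirical

variable {E F : Type*} [TopologicalSpace E] [SecondCountableTopology E] [T2Space E]
  [MeasurableSpace E] [BorelSpace E] [NormedAddCommGroup F] [NormedSpace ℝ F] {K : Set E}
  {μ₀ : Measure E} {S₀ : Type*} [MeasurableSpace S₀] {P₀ : Measure S₀} {ξ : ℕ → S₀ → E}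

lemma IsSample.aestronglyMeasurable_empDev [IsProbabilityMeasure μ₀] [IsProbabilityMeasure P₀]
    (h : IsSample K μ₀ P₀ ξ) {g : E → F} (hg : ContinuousOn g K) (m : ℕ) :
    AEStronglyMeasurable (fun σ => empDev μ₀ (fun i : Fin m => ξ i σ) g) P₀ := by
  borelize F
  have h1 : ∀ i, AEStronglyMeasurable (fun σ => g (ξ i σ)) P₀ :=
    fun i => (h.memLp_comp hg i 1).aestronglyMeasurable
  simp only [empDev, avg]
  exact ((Finset.univ.aestronglyMeasurable_fun_sum fun i _ => h1 (i : Fin m)).const_smul _).sub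
    aestronglyMeasurable_const

end Empirical

namespace IsMeanField

variable {k n : ℕ} {D K : Set (Euc k)} {I : Set ℝ} {μ₀ : Measure (Euc k)}
  [IsProbabilityMeasure μ₀] {φ : Euc k → Fin n → ℝ}
  {b : Euc k × (Fin n → ℝ) → Euc k} {Y : ℝ → Euc k → Euc k} {f : ℝ → Fin n → ℝ}
  {P : ℝ → Euc k → Euc k →L[ℝ] Euc k} {S₀ : Type*} [MeasurableSpace S₀] {P₀ : Measure S₀}
  {ξ : ℕ → S₀ → Euc k}

/-- The deviation of the field along the characteristics of the sample from its mean. -/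
lemma empDev_path_apply (h : IsMeanField D K I μ₀ φ b Y f P) {F : Type*} [NormedAddCommGroup F]
    [NormedSpace ℝ F] [CompleteSpace F] {ψ : Euc k → F} (hψ : ContinuousOn ψ D) {T : ℝ}
    (hT : T ∈ I) {m : ℕ} {a : Fin m → Euc k} (ha : ∀ i, a i ∈ K) (t : Icc 0 T) :
    empDev μ₀ a (fun θ => pathC T fun s => ψ (Y s θ)) t = empDev μ₀ a fun θ => ψ (Y t θ) := by
  have h1 := map_empDev h.isCompact h.ae_mem a (h.continuousOn_pathC hψ hT)
    (ContinuousMap.evalCLM ℝ t)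
  rw [ContinuousMap.evalCLM_apply] at h1
  rw [h1]
  refine empDev_congr h.ae_mem ha fun θ hθ => ?_
  exact pathC_apply ((h.continuousOn_path hψ hθ).mono (h.Icc_subset hT)) t

/-- The fluctuations of the mean of `ψ` over the particles differ from the fluctuations of the
influence function over the sample by a term of smaller order. -/
lemma ae_eventually_abs_sub_le (h : IsMeanField D K I μ₀ φ b Y f P) (hξ : IsSample K μ₀ P₀ ξ)
    {ψ : Euc k → ℝ} (hψ : ContDiffOn ℝ 1 ψ D) {T : ℝ} (hT : T ∈ I)
    {X : (m : ℕ) → Fin m → ℝ → S₀ → Euc k}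
    (hX : ∀ m, ∀ᵐ σ ∂P₀, IsParticleSystem T φ b (fun i t => X m i t σ) ∧
      (∀ i, ∀ t ∈ Icc 0 T, X m i t σ ∈ D) ∧ ∀ i : Fin m, X m i 0 σ = Y 0 (ξ i σ))
    {η : ℝ} (hη : 0 < η) :
    ∀ᵐ σ ∂P₀, ∀ᶠ m : ℕ in atTop,
      |√(m : ℝ) * ((avg fun i => ψ (X m i T σ)) - ∫ θ, ψ (Y T θ) ∂μ₀) -
        √(m : ℝ) * empDev μ₀ (fun i : Fin m => ξ i σ) (influence φ b Y f P μ₀ ψ T)| ≤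
      η * (√(m : ℝ) * ‖empDev μ₀ (fun i : Fin m => ξ i σ) (fun θ =>
        pathC T fun s => φ (Y s θ))‖) := by
  have hT0 := h.subset hT
  have hφ := h.contDiffOn_obs
  obtain ⟨ε, hε, hlin⟩ := (h.characteristics T hT).exists_linear_response (h.fundamental T hT) hψ
    (kernelC T (meanResponse b Y f P μ₀ φ)) (kernelC T (meanResponse b Y f P μ₀ ψ)) hη
  have hΦ := h.continuousOn_pathC hφ.continuousOn hT
  have hN := h.continuousOn_toC_responseKernel hφ hT
  have hNψ := h.continuousOn_toC_responseKernel hψ hT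
  filter_upwards [hξ.ae_mem, ae_all_iff.2 hX, hξ.ae_tendsto_empDev hΦ, hξ.ae_tendsto_empDev hN,
    hξ.ae_tendsto_empDev hNψ] with σ hσ hXσ h1 h2 h3
  filter_upwards [(tendsto_zero_iff_norm_tendsto_zero.1 h1).eventually_le_const hε,
    (tendsto_zero_iff_norm_tendsto_zero.1 h2).eventually_le_const hε,
    (tendsto_zero_iff_norm_tendsto_zero.1 h3).eventually_le_const hε] with m h1 h2 h3
  set a : Fin m → Euc k := fun i => ξ i σ
  have ha : ∀ i, a i ∈ K := fun i => hσ i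
  set G := empDev μ₀ a fun θ => pathC T fun s => φ (Y s θ)
  rw [empDev, ← h.kernelC_meanResponse hφ hT] at h2
  rw [empDev, ← h.kernelC_meanResponse hψ hT] at h3
  have key := hlin a (fun i t => X m i t σ) ha (hXσ m).2.1 (hXσ m).1 (hXσ m).2.2 G _ _
    (fun t => by
      rw [h.empDev_path_apply hφ.continuousOn hT ha, empDev, h.mean t (h.Icc_subset hT t.2)])
    (fun i q => toC_apply (continuous_section ((h.characteristics T hT).continuousOn_responseKernel
      (h.fundamental T hT) hφ) (ha i)) q)
    (fun i q => toC_apply (continuous_section ((h.characteristics T hT).continuousOn_responseKernel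
      (h.fundamental T hT) hψ) (ha i)) q) h1 h2 h3 ⟨T, hT0, le_rfl⟩
  have hinf : empDev μ₀ a (influence φ b Y f P μ₀ ψ T) =
      (avg fun i => ψ (Y T (a i))) - ∫ θ, ψ (Y T θ) ∂μ₀ + h.effect ψ hT G := by
    have hc : ContinuousOn (fun θ => h.effect ψ hT (pathC T fun s => φ (Y s θ))) K :=
      (h.effect ψ hT).continuous.comp_continuousOn hΦ
    rw [empDev_congr h.ae_mem ha fun θ hθ => h.influence_eq hψ hT hθ,
      empDev_add h.isCompact h.ae_mem a (h.continuousOn_initial hψ.continuousOn hT) hc,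
      map_empDev h.isCompact h.ae_mem a hΦ]
    rfl
  rw [hinf, ← mul_sub, abs_mul, abs_of_nonneg (Real.sqrt_nonneg _), mul_left_comm]
  refine mul_le_mul_of_nonneg_left ?_ (Real.sqrt_nonneg _)
  convert! key using 1
  rw [Real.norm_eq_abs]
  congr 1
  change _ = _ - _ - h.effect ψ hT G
  ring

variable [IsProbabilityMeasure P₀]

/-- The deviation of the field along the characteristics is of order `m^(-1/2)` in mean, uniformly
in time. -/
lemma exists_lintegral_norm_empDev_le (h : IsMeanField D K I μ₀ φ b Y f P)
    (hξ : IsSample K μ₀ P₀ ξ) {T : ℝ} (hT : T ∈ I) :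
    ∃ B : ℝ, ∀ m : ℕ, ∫⁻ σ, ‖√(m : ℝ) * ‖empDev μ₀ (fun i : Fin m => ξ i σ) (fun θ =>
      pathC T fun s => φ (Y s θ))‖‖ₑ ∂P₀ ≤ ENNReal.ofReal B := by
  have hl := h.contDiffOn_obs_apply
  choose B hB using fun l => hξ.exists_lintegral_le (h.isC1Curve (hl l)) hT
  refine ⟨∑ l, max (B l) 0, fun m => ?_⟩
  set G : Fin n → S₀ → C(Icc 0 T, ℝ) := fun l σ =>
    empDev μ₀ (fun i : Fin m => ξ i σ) fun θ => pathC T fun s => φ (Y s θ) l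
  have hG : ∀ l, AEStronglyMeasurable (fun σ => √(m : ℝ) • G l σ) P₀ := fun l =>
    (hξ.aestronglyMeasurable_empDev (h.continuousOn_pathC (hl l).continuousOn hT) m).const_smul
      √(m : ℝ)
  have hle : ∀ᵐ σ ∂P₀, ‖√(m : ℝ) * ‖empDev μ₀ (fun i : Fin m => ξ i σ) (fun θ =>
      pathC T fun s => φ (Y s θ))‖‖ₑ ≤ ∑ l, ‖√(m : ℝ) • G l σ‖ₑ := by
    filter_upwards [hξ.ae_mem] with σ hσ
    have h1 : ‖empDev μ₀ (fun i : Fin m => ξ i σ) (fun θ => pathC T fun s => φ (Y s θ))‖ ≤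
        ∑ l, ‖G l σ‖ := by
      have h0 : 0 ≤ ∑ l, ‖G l σ‖ := Finset.sum_nonneg fun l _ => norm_nonneg _
      refine (ContinuousMap.norm_le _ h0).2 fun t => (pi_norm_le_iff_of_nonneg h0).2 fun l => ?_
      rw [h.empDev_path_apply h.contDiffOn_obs.continuousOn hT fun i => hσ i]
      have h2 : (empDev μ₀ (fun i : Fin m => ξ i σ) fun θ => φ (Y t θ)) l = G l σ t := by
        rw [h.empDev_path_apply (hl l).continuousOn hT fun i => hσ i]
        exact map_empDev h.isCompact h.ae_mem (fun i : Fin m => ξ i σ)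
          (h.continuousOn_initial h.contDiffOn_obs.continuousOn (h.Icc_subset hT t.2))
          (ContinuousLinearMap.proj (R := ℝ) (φ := fun _ : Fin n => ℝ) l)
      rw [h2]
      exact ((G l σ).norm_coe_le_norm t).trans
        (Finset.single_le_sum (f := fun l => ‖G l σ‖) (fun l _ => norm_nonneg _)
          (Finset.mem_univ l))
    simp only [← ofReal_norm]
    rw [← ENNReal.ofReal_sum_of_nonneg fun l _ => norm_nonneg _]
    refine ENNReal.ofReal_le_ofReal ?_
    simp only [norm_smul, norm_mul, norm_norm, ← Finset.mul_sum]
    exact mul_le_mul_of_nonneg_left h1 (norm_nonneg _)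
  refine (lintegral_mono_ae hle).trans ?_
  rw [lintegral_finsetSum' _ fun l _ => (hG l).enorm,
    ENNReal.ofReal_sum_of_nonneg fun l _ => le_max_right _ _]
  refine Finset.sum_le_sum fun l _ => (hB l m (G l) ?_).trans
    (ENNReal.ofReal_le_ofReal (le_max_left _ _))
  filter_upwards [hξ.ae_mem] with σ hσ t
  exact h.empDev_path_apply (hl l).continuousOn hT (fun i => hσ i) t

/-- **Central limit theorem** for the mean of an observable over the particles. -/
lemma tendstoInDistribution (h : IsMeanField D K I μ₀ φ b Y f P) (hξ : IsSample K μ₀ P₀ ξ)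
    {ψ : Euc k → ℝ} (hψ : ContDiffOn ℝ 1 ψ D) {T : ℝ} (hT : T ∈ I)
    {X : (m : ℕ) → Fin m → ℝ → S₀ → Euc k} (hXm : ∀ m i, AEMeasurable (X m i T) P₀)
    (hX : ∀ m, ∀ᵐ σ ∂P₀, IsParticleSystem T φ b (fun i t => X m i t σ) ∧
      (∀ i, ∀ t ∈ Icc 0 T, X m i t σ ∈ D) ∧ ∀ i : Fin m, X m i 0 σ = Y 0 (ξ i σ))
    {S : Type*} [MeasurableSpace S] {Q : Measure S} [IsProbabilityMeasure Q] {Z : S → ℝ}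
    (hZ : HasGaussianLaw Z Q) (hmean : ∫ σ, Z σ ∂Q = 0)
    (hvar : ∫ σ, Z σ * Z σ ∂Q =
      ∫ θ, influence φ b Y f P μ₀ ψ T θ * influence φ b Y f P μ₀ ψ T θ ∂μ₀ -
        (∫ θ, influence φ b Y f P μ₀ ψ T θ ∂μ₀) * ∫ θ, influence φ b Y f P μ₀ ψ T θ ∂μ₀) :
    TendstoInDistribution (fun (m : ℕ) σ =>
      √(m : ℝ) * ((avg fun i => ψ (X m i T σ)) - ∫ θ, ψ (Y T θ) ∂μ₀)) atTop Z
      (fun _ => P₀) Q := by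
  have hT0 : T ∈ Icc 0 T := ⟨h.subset hT, le_rfl⟩
  have hinf := h.continuousOn_influence hψ hT
  have hΦ := h.continuousOn_pathC h.contDiffOn_obs.continuousOn hT
  have hψX : ∀ m i, AEMeasurable (fun σ => ψ (X m i T σ)) P₀ := fun m i => by
    have h1 : ∀ᵐ z ∂P₀.map (X m i T), z ∈ D :=
      (ae_map_iff (hXm m i) h.isOpen.measurableSet).2 ((hX m).mono fun σ hσ => hσ.2.1 i T hT0)
    have h2 := hψ.continuousOn.aemeasurable (μ := P₀.map (X m i T)) h.isOpen.measurableSet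
    rw [Measure.restrict_eq_self_of_ae_mem h1] at h2
    exact h2.comp_aemeasurable (hXm m i)
  have hdev : ∀ m : ℕ, AEMeasurable (fun σ =>
      √(m : ℝ) * ((avg fun i => ψ (X m i T σ)) - ∫ θ, ψ (Y T θ) ∂μ₀)) P₀ := fun m => by
    refine AEMeasurable.const_mul (AEMeasurable.sub_const ?_ _) _
    simp only [avg, smul_eq_mul]
    exact (Finset.univ.aemeasurable_fun_sum fun i _ => hψX m i).const_mul _
  refine tendstoInDistribution_of_tendstoInMeasure_sub _ Z
    (hξ.tendstoInDistribution hinf hZ hmean hvar) ?_ hdev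
  obtain ⟨B, hB⟩ := h.exists_lintegral_norm_empDev_le hξ hT
  refine tendstoInMeasure_zero_of_le (τ := fun (m : ℕ) σ => √(m : ℝ) *
    ‖empDev μ₀ (fun i : Fin m => ξ i σ) (fun θ => pathC T fun s => φ (Y s θ))‖)
    (fun m => (hdev m).sub (hξ.memLp_sqrt_mul_empDev hinf m).aemeasurable)
    (fun m => (hξ.aestronglyMeasurable_empDev hΦ m).norm.aemeasurable.const_mul _)
    (fun m σ => by positivity) hB fun η hη => h.ae_eventually_abs_sub_le hξ hψ hT hX hη

end IsMeanField

/-! ### The least-squares problem as a mean-field system -/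

lemma integrable_empiricalMeasure {k m : ℕ} {F : Type*} [NormedAddCommGroup F] (hm : m ≠ 0)
    (a : Fin m → Euc k) (g : Euc k → F) : Integrable g (empiricalMeasure a) :=
  (integrable_finsetSum_measure.2 fun i _ => integrable_dirac enorm_lt_top).smul_measure
    (by simpa using hm)

/-- For `m = 0` both sides vanish: the empirical measure is `∞ • 0`. -/
lemma integral_empiricalMeasure {k m : ℕ} {F : Type*} [NormedAddCommGroup F] [NormedSpace ℝ F]
    [CompleteSpace F] (a : Fin m → Euc k) (g : Euc k → F) :
    ∫ x, g x ∂empiricalMeasure a = avg fun i => g (a i) := by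
  rw [empiricalMeasure, integral_smul_measure,
    integral_finsetSum_measure fun i _ => integrable_dirac enorm_lt_top, avg]
  simp

lemma continuous_integral_of_continuousOn {k : ℕ} {X F : Type*} [TopologicalSpace X]
    [CompactSpace X] [NormedAddCommGroup F] [NormedSpace ℝ F] [CompleteSpace F] {K : Set (Euc k)}
    {μ₀ : Measure (Euc k)} [IsFiniteMeasure μ₀] (hK : IsCompact K) (hmem : ∀ᵐ θ ∂μ₀, θ ∈ K)
    {g : Euc k × X → F} (hg : ContinuousOn g (K ×ˢ univ)) :
    Continuous fun x => ∫ θ, g (θ, x) ∂μ₀ := by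
  refine (∫ θ, toC (fun x => g (θ, x)) ∂μ₀).continuous.congr fun x => ?_
  rw [← ContinuousMap.evalCLM_apply ℝ, ← ContinuousLinearMap.integral_comp_comm _
    (integrable_of_continuousOn hK hmem (continuousOn_toC hg))]
  exact integral_congr_ae (hmem.mono fun θ hθ => toC_apply (continuous_section hg hθ) x)

namespace Problem

variable {k d n : ℕ} (p : Problem k d n)

/-- The values of the unit at the data points. -/
def obs (z : Euc k) (l : Fin n) : ℝ := p.φ z (p.data l)

/-- The field `-∇V`, as a function of the position of the particle and of the values `w` of the
network at the data points. -/
def field (q : Euc k × (Fin n → ℝ)) : Euc k :=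
  -(p.lam • gradient p.reg q.1 + (n : ℝ)⁻¹ • ∑ l, (q.2 l - p.target (p.data l)) •
    gradient (fun z => p.φ z (p.data l)) q.1)

/-- The potential `V`, as a function of the values `w` of the network at the data points. -/
def potential (w : Fin n → ℝ) (z : Euc k) : ℝ :=
  p.lam * p.reg z + (n : ℝ)⁻¹ * ∑ l, (w l - p.target (p.data l)) * p.φ z (p.data l)

/-- The values of the mean-field network at the data points. -/
def meanNet (μ₀ : Measure (Euc k)) (Θ : ℝ → Euc k → Euc k) (t : ℝ) (l : Fin n) : ℝ :=
  p.net (mfMeasure μ₀ Θ t) (p.data l)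

lemma integral_ν (g : Euc d → ℝ) : ∫ x, g x ∂p.ν = (n : ℝ)⁻¹ * ∑ l, g (p.data l) := by
  rw [ν, integral_empiricalMeasure]
  rfl

lemma V_eq_potential {μ : Measure (Euc k)}
    (hμ : ∀ l, Integrable (fun z => p.φ z (p.data l)) μ) (z : Euc k) :
    p.V z μ = p.potential (fun l => p.net μ (p.data l)) z := by
  simp only [V, F, K, potential, integral_ν, net]
  rw [integral_const_mul, integral_finsetSum _ fun l _ => (hμ l).const_mul _]
  simp only [integral_const_mul, sub_mul, Finset.sum_sub_distrib, mul_sub]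
  rw [Finset.sum_congr rfl fun l _ => mul_comm (p.φ z (p.data l)) _]
  ring

section Regular

variable {p} {D : Set (Euc k)} {Ω : Set (Euc d)}

namespace Regular

lemma contDiffOn_unit (h : p.Regular D Ω) (hD : IsOpen D) {x : Euc d} (hx : x ∈ Ω) :
    ContDiffOn ℝ 1 (fun z => p.φ z x) D := by
  rw [show (1 : WithTop ℕ∞) = 0 + 1 from rfl, contDiffOn_succ_iff_fderiv_of_isOpen hD]
  refine ⟨fun θ hθ => (h.differentiable x hx θ hθ).differentiableWithinAt, by simp, ?_⟩
  rw [contDiffOn_zero]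
  intro θ hθ
  have h1 := (InnerProductSpace.toDual ℝ (Euc k)).continuous.continuousAt.comp
    (h.twice_differentiable x hx θ hθ).continuousAt
  refine ContinuousAt.continuousWithinAt (h1.congr (Eventually.of_forall fun z => ?_))
  simp [gradient]

lemma contDiffOn_gradient (h : p.Regular D Ω) (hD : IsOpen D) {x : Euc d} (hx : x ∈ Ω) :
    ContDiffOn ℝ 1 (gradient fun z => p.φ z x) D := by
  obtain ⟨L, hL⟩ := h.lipschitz
  rw [show (1 : WithTop ℕ∞) = 0 + 1 from rfl, contDiffOn_succ_iff_fderiv_of_isOpen hD]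
  exact ⟨fun θ hθ => (h.twice_differentiable x hx θ hθ).differentiableWithinAt, by simp,
    contDiffOn_zero.2 (hL x hx).continuousOn⟩

lemma contDiffOn_gradient_reg (h : p.Regular D Ω) (hD : IsOpen D) :
    ContDiffOn ℝ 1 (gradient p.reg) D :=
  (InnerProductSpace.toDual ℝ (Euc k)).symm.contDiff.comp_contDiffOn
    (h.reg.fderiv_of_isOpen hD (m := 1) (by norm_num [one_add_one_eq_two]))

lemma contDiffOn_obs (h : p.Regular D Ω) (hD : IsOpen D) (hdata : ∀ l, p.data l ∈ Ω) :
    ContDiffOn ℝ 1 p.obs D :=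
  contDiffOn_pi.2 fun l => h.contDiffOn_unit hD (hdata l)

lemma contDiffOn_field (h : p.Regular D Ω) (hD : IsOpen D) (hdata : ∀ l, p.data l ∈ Ω) :
    ContDiffOn ℝ 1 p.field (D ×ˢ univ) := by
  have h1 : MapsTo (Prod.fst : Euc k × (Fin n → ℝ) → Euc k) (D ×ˢ univ) D := fun q hq => hq.1
  have h2 : ContDiffOn ℝ 1 (fun q : Euc k × (Fin n → ℝ) => p.lam • gradient p.reg q.1)
      (D ×ˢ univ) := ContDiffOn.const_smul p.lam
    ((h.contDiffOn_gradient_reg hD).comp contDiff_fst.contDiffOn h1)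
  have h3 : ∀ l, ContDiffOn ℝ 1 (fun q : Euc k × (Fin n → ℝ) => (q.2 l - p.target (p.data l)) •
      gradient (fun z => p.φ z (p.data l)) q.1) (D ×ˢ univ) := fun l =>
    (((contDiff_apply ℝ ℝ l).comp contDiff_snd).contDiffOn.sub contDiffOn_const).smul
      ((h.contDiffOn_gradient hD (hdata l)).comp contDiff_fst.contDiffOn h1)
  have h4 : ContDiffOn ℝ 1 (fun q : Euc k × (Fin n → ℝ) => (n : ℝ)⁻¹ •
      ∑ l, (q.2 l - p.target (p.data l)) • gradient (fun z => p.φ z (p.data l)) q.1)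
      (D ×ˢ univ) := ContDiffOn.const_smul (n : ℝ)⁻¹ (ContDiffOn.sum fun l _ => h3 l)
  exact (h2.add h4).neg

lemma gradient_potential (h : p.Regular D Ω) (hD : IsOpen D) (hdata : ∀ l, p.data l ∈ Ω)
    (w : Fin n → ℝ) {z : Euc k} (hz : z ∈ D) :
    gradient (p.potential w) z = -p.field (z, w) := by
  have hr : HasFDerivAt p.reg (fderiv ℝ p.reg z) z :=
    ((h.reg.differentiableOn two_ne_zero).differentiableAt (hD.mem_nhds hz)).hasFDerivAt
  have hl : ∀ l, HasFDerivAt (fun z => p.φ z (p.data l))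
      (fderiv ℝ (fun z => p.φ z (p.data l)) z) z := fun l =>
    (h.differentiable _ (hdata l) z hz).hasFDerivAt
  have h1 := (hr.const_mul p.lam).fun_add ((HasFDerivAt.fun_sum fun l (_ : l ∈ Finset.univ) =>
    (hl l).const_mul (w l - p.target (p.data l))).const_mul (n : ℝ)⁻¹)
  have h2 : HasFDerivAt (p.potential w) _ z := h1
  rw [gradient, h2.fderiv, field, neg_neg]
  simp only [map_add, map_smul, map_sum, gradient]

lemma gradV_eq (h : p.Regular D Ω) (hD : IsOpen D) (hdata : ∀ l, p.data l ∈ Ω)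
    {μ : Measure (Euc k)} (hμ : ∀ l, Integrable (fun z => p.φ z (p.data l)) μ) {z : Euc k}
    (hz : z ∈ D) : p.gradV z μ = -p.field (z, fun l => p.net μ (p.data l)) := by
  rw [gradV, funext fun z => p.V_eq_potential hμ z, h.gradient_potential hD hdata _ hz]

lemma hasFDerivAt_field (h : p.Regular D Ω) (hD : IsOpen D) (hdata : ∀ l, p.data l ∈ Ω)
    (w : Fin n → ℝ) {z : Euc k} (hz : z ∈ D) :
    HasFDerivAt p.field (fderiv ℝ p.field (z, w)) (z, w) :=
  (((h.contDiffOn_field hD hdata).differentiableOn one_ne_zero).differentiableAt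
    ((hD.prod isOpen_univ).mem_nhds ⟨hz, mem_univ w⟩)).hasFDerivAt

lemma hessV_eq (h : p.Regular D Ω) (hD : IsOpen D) (hdata : ∀ l, p.data l ∈ Ω)
    {μ : Measure (Euc k)} (hμ : ∀ l, Integrable (fun z => p.φ z (p.data l)) μ) {z : Euc k}
    (hz : z ∈ D) : p.hessV z μ = -(fderiv ℝ p.field (z, fun l => p.net μ (p.data l))).comp
      (ContinuousLinearMap.inl ℝ (Euc k) (Fin n → ℝ)) := by
  have h1 := ((h.hasFDerivAt_field hD hdata (fun l => p.net μ (p.data l)) hz).comp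
    (f := fun e => (e, fun l => p.net μ (p.data l))) z
    (hasFDerivAt_prodMk_left z (fun l => p.net μ (p.data l)))).neg
  rw [hessV, hessian, ← h1.fderiv]
  refine Filter.EventuallyEq.fderiv_eq ?_
  filter_upwards [hD.mem_nhds hz] with y hy
  exact h.gradV_eq hD hdata hμ hy

/-- The field depends on the values of the network through an affine map. -/
lemma fderiv_field_inr (h : p.Regular D Ω) (hD : IsOpen D) (hdata : ∀ l, p.data l ∈ Ω)
    (w : Fin n → ℝ) {z : Euc k} (hz : z ∈ D) (l : Fin n) :
    fderiv ℝ p.field (z, w) (0, Pi.single l 1) =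
      -((n : ℝ)⁻¹ • gradient (fun z => p.φ z (p.data l)) z) := by
  have h1 := (h.hasFDerivAt_field hD hdata w hz).comp w (hasFDerivAt_prodMk_right z w)
  have h2 := h1.hasLineDerivAt (Pi.single l 1)
  have h3 : HasDerivAt (fun t : ℝ => p.field (z, w) +
      t • -((n : ℝ)⁻¹ • gradient (fun z => p.φ z (p.data l)) z))
      ((1 : ℝ) • -((n : ℝ)⁻¹ • gradient (fun z => p.φ z (p.data l)) z)) 0 :=
    ((hasDerivAt_id (0 : ℝ)).smul_const _).const_add _
  rw [one_smul] at h3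
  refine HasDerivAt.unique h2 (h3.congr_of_eventuallyEq (Eventually.of_forall fun t => ?_))
  have e : ∀ j, (w + t • (Pi.single l 1 : Fin n → ℝ)) j - p.target (p.data j) =
      (w j - p.target (p.data j)) + t * (Pi.single l 1 : Fin n → ℝ) j := fun j => by
    simp only [Pi.add_apply, Pi.smul_apply, smul_eq_mul]
    ring
  simp only [Function.comp_apply, field, e, add_smul, Finset.sum_add_distrib, mul_smul]
  rw [← Finset.smul_sum (r := t), Finset.sum_eq_single (a := l) (f := fun j =>
    (Pi.single l 1 : Fin n → ℝ) j • gradient (fun z => p.φ z (p.data j)) z)]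
  · rw [Pi.single_eq_same, one_smul]
    module
  · intro j _ hj
    rw [Pi.single_eq_of_ne hj, zero_smul]
  · simp

end Regular

end Regular

end Problem

namespace Problem

variable {k d n : ℕ} {p : Problem k d n} {D : Set (Euc k)} {Ω : Set (Euc d)} {I : Set ℝ}
  {μ₀ : Measure (Euc k)} {Θ : ℝ → Euc k → Euc k} {J : ℝ → ℝ → Euc k → Euc k →L[ℝ] Euc k}

namespace IsMeanFieldFlow

lemma continuousOn_initial (hΘ : p.IsMeanFieldFlow D I μ₀ Θ) {t : ℝ} (ht : t ∈ I) :
    ContinuousOn (Θ t) μ₀.support :=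
  hΘ.continuous.comp (f := fun θ => (t, θ)) (by fun_prop) fun _ hθ => ⟨ht, hθ⟩



lemma continuousOn_unit (hΘ : p.IsMeanFieldFlow D I μ₀ Θ) (hp : p.Regular D Ω) (hD : IsOpen D)
    {t : ℝ} (ht : t ∈ I) {x : Euc d} (hx : x ∈ Ω) :
    ContinuousOn (fun θ => p.φ (Θ t θ) x) μ₀.support :=
  (hp.contDiffOn_unit hD hx).continuousOn.comp (hΘ.continuousOn_initial ht) (hΘ.mem t ht)

lemma aemeasurable (hΘ : p.IsMeanFieldFlow D I μ₀ Θ) (hK : IsCompact μ₀.support) {t : ℝ}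
    (ht : t ∈ I) : AEMeasurable (Θ t) μ₀ :=
  (aestronglyMeasurable_of_continuousOn hK Measure.support_mem_ae
    (hΘ.continuousOn_initial ht)).aemeasurable

lemma aestronglyMeasurable_unit (hΘ : p.IsMeanFieldFlow D I μ₀ Θ) (hp : p.Regular D Ω)
    (hD : IsOpen D) (hK : IsCompact μ₀.support) {t : ℝ} (ht : t ∈ I) {x : Euc d} (hx : x ∈ Ω) :
    AEStronglyMeasurable (fun z => p.φ z x) (mfMeasure μ₀ Θ t) := by
  have h0 : ∀ᵐ θ ∂μ₀, θ ∈ μ₀.support := Measure.support_mem_ae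
  have h1 : ∀ᵐ z ∂mfMeasure μ₀ Θ t, z ∈ D :=
    (ae_map_iff (hΘ.aemeasurable hK ht) hD.measurableSet).2 (h0.mono (hΘ.mem t ht))
  have h2 := (hp.contDiffOn_unit hD hx).continuousOn.aestronglyMeasurable
    (μ := mfMeasure μ₀ Θ t) hD.measurableSet
  rwa [Measure.restrict_eq_self_of_ae_mem h1] at h2

lemma integrable_unit [IsFiniteMeasure μ₀] (hΘ : p.IsMeanFieldFlow D I μ₀ Θ) (hp : p.Regular D Ω)
    (hD : IsOpen D) (hK : IsCompact μ₀.support) {t : ℝ} (ht : t ∈ I) {x : Euc d} (hx : x ∈ Ω) :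
    Integrable (fun z => p.φ z x) (mfMeasure μ₀ Θ t) :=
  (integrable_map_measure (hΘ.aestronglyMeasurable_unit hp hD hK ht hx)
    (hΘ.aemeasurable hK ht)).2
    (integrable_of_continuousOn hK Measure.support_mem_ae (hΘ.continuousOn_unit hp hD ht hx))

lemma net_eq (hΘ : p.IsMeanFieldFlow D I μ₀ Θ) (hp : p.Regular D Ω)
    (hD : IsOpen D) (hK : IsCompact μ₀.support) {t : ℝ} (ht : t ∈ I) {x : Euc d} (hx : x ∈ Ω) :
    p.net (mfMeasure μ₀ Θ t) x = ∫ θ, p.φ (Θ t θ) x ∂μ₀ :=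
  integral_map (hΘ.aemeasurable hK ht) (hΘ.aestronglyMeasurable_unit hp hD hK ht hx)

variable [IsProbabilityMeasure μ₀]

lemma meanNet_eq (hΘ : p.IsMeanFieldFlow D I μ₀ Θ) (hp : p.Regular D Ω)
    (hD : IsOpen D) (hdata : ∀ l, p.data l ∈ Ω) (hK : IsCompact μ₀.support) {t : ℝ} (ht : t ∈ I) :
    p.meanNet μ₀ Θ t = ∫ θ, p.obs (Θ t θ) ∂μ₀ := by
  funext l
  have hc : ContinuousOn (fun θ => p.obs (Θ t θ)) μ₀.support :=
    continuousOn_pi.2 fun l => hΘ.continuousOn_unit hp hD ht (hdata l)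
  have h1 := (ContinuousLinearMap.proj (R := ℝ) (φ := fun _ : Fin n => ℝ) l).integral_comp_comm
    (integrable_of_continuousOn hK Measure.support_mem_ae hc)
  rw [meanNet, hΘ.net_eq hp hD hK ht (hdata l)]
  exact h1

lemma isCharacteristics (hΘ : p.IsMeanFieldFlow D I μ₀ Θ) (hp : p.Regular D Ω)
    (hD : IsOpen D) (hdata : ∀ l, p.data l ∈ Ω) (hK : IsCompact μ₀.support) {T : ℝ} (hT : 0 ≤ T)
    (hI : Icc 0 T ⊆ I) :
    IsCharacteristics D μ₀.support T p.obs p.field Θ (p.meanNet μ₀ Θ) where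
  isOpen := hD
  isCompact := hK
  nonneg := hT
  contDiffOn_obs := hp.contDiffOn_obs hD hdata
  contDiffOn_field := hp.contDiffOn_field hD hdata
  continuousOn := hΘ.continuous.mono (prod_mono_left hI)
  mem t ht := hΘ.mem t (hI ht)
  ode t ht θ hθ := by
    have h1 := hΘ.ode t (hI ht) θ hθ
    rw [hp.gradV_eq hD hdata (fun l => hΘ.integrable_unit hp hD hK (hI ht) (hdata l))
      (hΘ.mem t (hI ht) θ hθ), neg_neg] at h1
    exact h1.mono hI
  continuousOn_mean := by
    have hg : ContinuousOn (fun q : Euc k × Icc 0 T => p.obs (Θ q.2 q.1))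
        (μ₀.support ×ˢ univ) :=
      (hp.contDiffOn_obs hD hdata).continuousOn.comp (hΘ.continuous.comp
        (f := fun q : Euc k × Icc 0 T => ((q.2 : ℝ), q.1)) (by fun_prop)
        fun q hq => ⟨hI q.2.2, hq.1⟩) fun q hq => hΘ.mem _ (hI q.2.2) _ hq.1
    rw [continuousOn_iff_continuous_domRestrict]
    refine (continuous_integral_of_continuousOn hK Measure.support_mem_ae hg).congr fun t => ?_
    exact (hΘ.meanNet_eq hp hD hdata hK (hI t.2)).symm

lemma fieldDeriv_eq (hΘ : p.IsMeanFieldFlow D I μ₀ Θ) (hp : p.Regular D Ω)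
    (hD : IsOpen D) (hdata : ∀ l, p.data l ∈ Ω) (hK : IsCompact μ₀.support) {t : ℝ} (ht : t ∈ I)
    {θ : Euc k} (hθ : θ ∈ μ₀.support) :
    fieldDeriv p.field Θ (p.meanNet μ₀ Θ) t θ = -p.hessV (Θ t θ) (mfMeasure μ₀ Θ t) := by
  rw [hp.hessV_eq hD hdata (fun l => hΘ.integrable_unit hp hD hK ht (hdata l))
    (hΘ.mem t ht θ hθ), neg_neg]
  rfl

lemma isFundamental (hΘ : p.IsMeanFieldFlow D I μ₀ Θ) (hJ : p.IsJacobian I μ₀ Θ J)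
    (hp : p.Regular D Ω) (hD : IsOpen D) (hdata : ∀ l, p.data l ∈ Ω) (hK : IsCompact μ₀.support)
    {T : ℝ} (hT : 0 ≤ T) (hI : Icc 0 T ⊆ I) :
    IsFundamental μ₀.support T (fieldDeriv p.field Θ (p.meanNet μ₀ Θ)) fun t => J t 0 where
  isCompact := hK
  nonneg := hT
  continuousOn := (hΘ.isCharacteristics hp hD hdata hK hT hI).continuousOn_fieldDeriv
  init := hJ.init 0 (hI ⟨le_rfl, hT⟩)
  ode t ht θ hθ := by
    have h1 := hJ.ode 0 (hI ⟨le_rfl, hT⟩) t (hI ht) ht.1 θ hθ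
    rw [← ContinuousLinearMap.neg_comp, ← hΘ.fieldDeriv_eq hp hD hdata hK (hI ht) hθ] at h1
    exact h1.mono fun s hs => ⟨hI hs, hs.1⟩

lemma isMeanField (hΘ : p.IsMeanFieldFlow D I μ₀ Θ) (hJ : p.IsJacobian I μ₀ Θ J)
    (hp : p.Regular D Ω) (hD : IsOpen D) (hdata : ∀ l, p.data l ∈ Ω) (hK : IsCompact μ₀.support)
    (hI : I.OrdConnected) (h0I : (0 : ℝ) ∈ I) (hI0 : I ⊆ Ici 0) :
    IsMeanField D μ₀.support I μ₀ p.obs p.field Θ (p.meanNet μ₀ Θ) fun t => J t 0 where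
  ordConnected := hI
  zero_mem := h0I
  subset := hI0
  continuousOn := hΘ.continuous
  ae_mem := Measure.support_mem_ae
  characteristics _ hT := hΘ.isCharacteristics hp hD hdata hK (hI0 hT) (hI.out h0I hT)
  fundamental _ hT := hΘ.isFundamental hJ hp hD hdata hK (hI0 hT) (hI.out h0I hT)
  mean _ ht := hΘ.meanNet_eq hp hD hdata hK ht

/-- The Jacobian of the flow, normalized at time `s`. -/
lemma jacobian_eq (hΘ : p.IsMeanFieldFlow D I μ₀ Θ) (hJ : p.IsJacobian I μ₀ Θ J)
    (hp : p.Regular D Ω) (hD : IsOpen D) (hdata : ∀ l, p.data l ∈ Ω) (hK : IsCompact μ₀.support)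
    {s t : ℝ} (hs : 0 ≤ s) (hst : s ≤ t) (hI : Icc 0 t ⊆ I) {θ : Euc k} (hθ : θ ∈ μ₀.support) :
    J t s θ = (J t 0 θ).comp (Ring.inverse (J s 0 θ)) := by
  refine (hΘ.isFundamental hJ hp hD hdata hK (hs.trans hst) hI).eq_comp_inverse ⟨hs, hst⟩ hθ
    (Q := fun u => J u s θ) (hJ.init s (hI ⟨hs, hst⟩) θ hθ) (fun u hu => ?_) ⟨hst, le_rfl⟩
  have huI : u ∈ I := hI ⟨hs.trans hu.1, hu.2⟩
  have h1 := hJ.ode s (hI ⟨hs, hst⟩) u huI hu.1 θ hθ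
  rw [← ContinuousLinearMap.neg_comp, ← hΘ.fieldDeriv_eq hp hD hdata hK huI hθ] at h1
  exact h1.mono fun r hr => ⟨hI ⟨hs.trans hr.1, hr.2⟩, hr.1⟩

/-- The mean response of the unit at `x` to the value of the network at a data point is given by
the kernel `Γ`. -/
lemma meanResponse_single (hΘ : p.IsMeanFieldFlow D I μ₀ Θ) (hJ : p.IsJacobian I μ₀ Θ J)
    (hp : p.Regular D Ω) (hD : IsOpen D) (hdata : ∀ l, p.data l ∈ Ω) (hK : IsCompact μ₀.support)
    {s t : ℝ} (hs : 0 ≤ s) (hst : s ≤ t) (hI : Icc 0 t ⊆ I) {x : Euc d} (hx : x ∈ Ω)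
    (l : Fin n) :
    meanResponse p.field Θ (p.meanNet μ₀ Θ) (fun t => J t 0) μ₀ (fun z => p.φ z x) t s
      (Pi.single l 1) = -((n : ℝ)⁻¹ * p.Γ μ₀ Θ J t s x (p.data l)) := by
  have hst' : s ∈ Icc 0 t := ⟨hs, hst⟩
  have ht' : t ∈ Icc 0 t := ⟨hs.trans hst, le_rfl⟩
  have hc := (hΘ.isCharacteristics hp hD hdata hK ht'.1 hI).continuousOn_responseKernel
    (hΘ.isFundamental hJ hp hD hdata hK ht'.1 hI) (hp.contDiffOn_unit hD hx)
  have hi : Integrable (responseKernel p.field Θ (p.meanNet μ₀ Θ) (fun t => J t 0)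
      (fun z => p.φ z x) t s) μ₀ := integrable_of_continuousOn hK Measure.support_mem_ae
    (hc.comp (f := fun θ => (θ, (⟨t, ht'⟩ : Icc 0 t), (⟨s, hst'⟩ : Icc 0 t)))
      (by fun_prop) fun θ hθ => ⟨hθ, mem_univ _⟩)
  rw [meanResponse, ContinuousLinearMap.integral_apply hi, Γ, ← integral_const_mul,
    ← integral_neg]
  have h0 : ∀ᵐ θ ∂μ₀, θ ∈ μ₀.support := Measure.support_mem_ae
  refine integral_congr_ae (h0.mono fun θ hθ => ?_)
  have h1 := hp.fderiv_field_inr hD hdata (p.meanNet μ₀ Θ s) (hΘ.mem s (hI hst') θ hθ) l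
  simp only [responseKernel, ContinuousLinearMap.comp_apply, meanDeriv,
    ContinuousLinearMap.inr_apply, h1, map_neg, map_smul, smul_eq_mul]
  rw [hΘ.jacobian_eq hJ hp hD hdata hK hs hst hI hθ,
    show gradient (fun z => p.φ z x) (Θ t θ) = (InnerProductSpace.toDual ℝ (Euc k)).symm
      (fderiv ℝ (fun z => p.φ z x) (Θ t θ)) from rfl, InnerProductSpace.toDual_symm_apply]
  rfl

lemma integral_Γ_mul (hΘ : p.IsMeanFieldFlow D I μ₀ Θ) (hJ : p.IsJacobian I μ₀ Θ J)
    (hp : p.Regular D Ω) (hD : IsOpen D) (hdata : ∀ l, p.data l ∈ Ω) (hK : IsCompact μ₀.support)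
    {s t : ℝ} (hs : 0 ≤ s) (hst : s ≤ t) (hI : Icc 0 t ⊆ I) {x : Euc d} (hx : x ∈ Ω)
    (u : Euc d → ℝ) :
    ∫ x', p.Γ μ₀ Θ J t s x x' * u x' ∂p.ν =
      -meanResponse p.field Θ (p.meanNet μ₀ Θ) (fun t => J t 0) μ₀ (fun z => p.φ z x) t s
        (fun l => u (p.data l)) := by
  rw [integral_ν, pi_eq_sum_univ' (fun l => u (p.data l)), map_sum, Finset.mul_sum,
    ← Finset.sum_neg_distrib]
  refine Finset.sum_congr rfl fun l _ => ?_
  rw [map_smul, smul_eq_mul, hΘ.meanResponse_single hJ hp hD hdata hK hs hst hI hx]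
  ring

end IsMeanFieldFlow

end Problem

end

end MeanFieldCLT

open MeanFieldCLT MeasureTheory ProbabilityTheory Set Filter Topology

theorem corollary2 {k d n : ℕ} (hn : 0 < n) (p : MeanFieldCLT.Problem k d n)
    (D : Set (MeanFieldCLT.Euc k)) (hD : IsOpen D)
    (Ω : Set (MeanFieldCLT.Euc d)) (hΩ : IsCompact Ω) (hdata : ∀ l, p.data l ∈ Ω)
    (hp : p.Regular D Ω)
    -- the initial law and the i.i.d. initial parameters
    (μ₀ : MeasureTheory.Measure (MeanFieldCLT.Euc k)) [MeasureTheory.IsProbabilityMeasure μ₀]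
    (hμ₀ : IsCompact μ₀.support) (hμ₀D : μ₀.support ⊆ D)
    {S₀ : Type*} [MeasurableSpace S₀] (P : MeasureTheory.Measure S₀)
    [MeasureTheory.IsProbabilityMeasure P] (θ₀ : ℕ → S₀ → MeanFieldCLT.Euc k)
    (hlaw : ∀ i, ProbabilityTheory.HasLaw (θ₀ i) μ₀ P)
    (hindep : ProbabilityTheory.iIndepFun θ₀ P)
    -- the time interval, the particle dynamics and the mean-field dynamics
    (I : Set ℝ) (hI : I.OrdConnected) (h0I : (0 : ℝ) ∈ I) (hI0 : I ⊆ Set.Ici 0)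
    (X : (m : ℕ) → Fin m → ℝ → S₀ → MeanFieldCLT.Euc k)
    (hXmeas : ∀ m i, ∀ t ∈ I, AEMeasurable (X m i t) P)
    (hX : ∀ m, ∀ᵐ ω ∂P, p.IsParticleFlow D I (fun i : Fin m => θ₀ i ω) (fun i t => X m i t ω))
    (Θ : ℝ → MeanFieldCLT.Euc k → MeanFieldCLT.Euc k) (hΘ : p.IsMeanFieldFlow D I μ₀ Θ)
    (J : ℝ → ℝ → MeanFieldCLT.Euc k → MeanFieldCLT.Euc k →L[ℝ] MeanFieldCLT.Euc k)
    (hJ : p.IsJacobian I μ₀ Θ J)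
    -- the Gaussian random measure
    {S : Type*} [MeasurableSpace S] (Q : MeasureTheory.Measure S)
    [MeasureTheory.IsProbabilityMeasure Q] (ω₀ : (MeanFieldCLT.Euc k → ℝ) → S → ℝ)
    (hω₀ : MeanFieldCLT.IsGaussianFluctuation μ₀ Q ω₀) :
    ∃ gbar g : ℝ → MeanFieldCLT.Euc d → S → ℝ,
      (∀ t ∈ I, ∀ x ∈ Ω, gbar t x =ᵐ[Q] ω₀ (fun θ => p.φ (Θ t θ) x)) ∧
      (∀ x ∈ Ω, ∀ᵐ σ ∂Q, ContinuousOn (fun t => gbar t x σ) I ∧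
        ContinuousOn (fun t => g t x σ) I ∧
        p.SolvesVolterra I μ₀ Θ J (fun t y => gbar t y σ) (fun t y => g t y σ) x) ∧
      (∀ t ∈ I, ∀ x ∈ Ω, MeasureTheory.TendstoInDistribution
        (fun (m : ℕ) (ω : S₀) => p.deviation μ₀ Θ (fun i t => X m i t ω) t x)
        Filter.atTop (g t x) (fun _ => P) Q) := by
  have h := hΘ.isMeanField hJ hp hD hdata hμ₀ hI h0I hI0
  have hω := hω₀.isFluctuationField hμ₀
  have hψ : ∀ {x : Euc d}, x ∈ Ω → ContDiffOn ℝ 1 (fun z => p.φ z x) D :=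
    fun hx => hp.contDiffOn_unit hD hx
  classical
  -- the continuous versions of the fluctuations along the characteristics
  let gbar : ℝ → Euc d → S → ℝ := fun t x σ =>
    if hx : x ∈ Ω then (h.isC1Curve (hψ hx)).version ω₀ t σ else 0
  let κ {F : Type} [NormedAddCommGroup F] [NormedSpace ℝ F] (ψ : Euc k → F) :=
    meanResponse p.field Θ (p.meanNet μ₀ Θ) (fun t => J t 0) μ₀ ψ
  -- the fluctuations at the data points solve a closed equation, which gives the others
  let v : S → ℝ → Fin n → ℝ := fun σ s l => gbar s (p.data l) σ
  let u : S → ℝ → Fin n → ℝ := fun σ => solution (κ p.obs) (v σ)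
  let g : ℝ → Euc d → S → ℝ := fun t x σ =>
    gbar t x σ + ∫ s in (0 : ℝ)..t, κ (fun z => p.φ z x) t s (u σ s)
  have hgbar : ∀ {x : Euc d} (hx : x ∈ Ω) t σ,
      gbar t x σ = (h.isC1Curve (hψ hx)).version ω₀ t σ := fun hx t σ => dif_pos hx
  have hcont : ∀ x ∈ Ω, ∀ᵐ σ ∂Q, ContinuousOn (fun t => gbar t x σ) I := fun x hx => by
    filter_upwards [(h.isC1Curve (hψ hx)).ae_continuousOn_version hω] with σ hσ
    simpa only [hgbar hx] using hσ
  refine ⟨gbar, g, fun t ht x hx => ?_, fun x hx => ?_, fun t ht x hx => ?_⟩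
  · filter_upwards [(h.isC1Curve (hψ hx)).ae_version_eq hω ht] with σ hσ
    rw [hgbar hx, hσ]
  · filter_upwards [hcont x hx, ae_all_iff.2 fun l => hcont _ (hdata l)] with σ hσ hvσ
    have hv : ContinuousOn (v σ) I := continuousOn_pi.2 hvσ
    have hdat : ∀ s ∈ I, (fun l => g s (p.data l) σ) = u σ s := fun s hs => by
      funext l
      exact (h.solution_apply_eq hv hs l).symm
    have hker : ∀ t ∈ I, ∀ s ∈ Icc 0 t, ∫ x', p.Γ μ₀ Θ J t s x x' * g s x' σ ∂p.ν =
        -κ (fun z => p.φ z x) t s (u σ s) := fun t ht s hs => by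
      rw [hΘ.integral_Γ_mul hJ hp hD hdata hμ₀ hs.1 hs.2 (h.Icc_subset ht) hx
        (fun y => g s y σ), hdat s (h.Icc_subset ht hs)]
    refine ⟨hσ, hσ.add (continuousOn_of_forall_Icc hI0 fun T hT => ?_), fun t ht => ?_,
      fun t ht => ?_⟩
    · exact continuousOn_integral_solution (hI0 hT)
        (h.continuousOn_meanResponse h.contDiffOn_obs hT) (hv.mono (h.Icc_subset hT))
        (h.continuousOn_meanResponse (hψ hx) hT)
    · have h1 := (intervalIntegrable_kernel_solution (hI0 ht)
        (h.continuousOn_meanResponse h.contDiffOn_obs ht) (hv.mono (h.Icc_subset ht))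
        (h.continuousOn_meanResponse (hψ hx) ht)).neg
      refine h1.congr fun s hs => ?_
      rw [uIoc_of_le (hI0 ht)] at hs
      exact (hker t ht s (Ioc_subset_Icc_self hs)).symm
    · rw [intervalIntegral.integral_congr (g := fun s => -κ (fun z => p.φ z x) t s (u σ s))
        fun s hs => hker t ht s (by rwa [uIcc_of_le (hI0 ht)] at hs),
        intervalIntegral.integral_neg]
      exact add_neg_cancel_right _ _
  · have hξ : IsSample μ₀.support μ₀ P θ₀ := ⟨hμ₀, Measure.support_mem_ae, hlaw, hindep⟩
    have hinf := h.continuousOn_influence (hψ hx) ht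
    have hpart : ∀ m, ∀ᵐ σ ∂P, IsParticleSystem t p.obs p.field (fun i t => X m i t σ) ∧
        (∀ i, ∀ s ∈ Icc 0 t, X m i s σ ∈ D) ∧ ∀ i : Fin m, X m i 0 σ = Θ 0 (θ₀ i σ) := by
      intro m
      filter_upwards [hX m, hξ.ae_mem] with σ hσ hmem
      refine ⟨⟨fun i s hs => ?_⟩, fun i s hs => hσ.mem i s (h.Icc_subset ht hs), fun i => ?_⟩
      · have hs' := h.Icc_subset ht hs
        -- the empirical measure is finite, since there is at least the particle `i`
        have hm : m ≠ 0 := (Fin.pos i).ne'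
        have h1 := hσ.ode i s hs'
        rw [hp.gradV_eq hD hdata (fun l => integrable_empiricalMeasure hm _ _)
          (hσ.mem i s hs'), neg_neg] at h1
        have h2 : (fun l => p.net (empiricalMeasure fun j => X m j s σ) (p.data l)) =
            avg fun j => p.obs (X m j s σ) := by
          funext l
          rw [Problem.net, integral_empiricalMeasure, avg, avg, Pi.smul_apply, Finset.sum_apply]
          rfl
        rw [h2] at h1
        exact h1.mono (h.Icc_subset ht)
      · rw [hσ.init, hΘ.init _ (hmem i)]
    have key := h.tendstoInDistribution hξ (hψ hx) ht (fun m i => hXmeas m i t ht) hpart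
      (hω₀.hasGaussianLaw hinf) (hω₀.mean _ hinf) (hω₀.cov _ _ hinf hinf)
    refine key.congr (fun m => Eventually.of_forall fun σ => ?_) ?_
    · simp only [Problem.deviation]
      rw [hΘ.net_eq hp hD hμ₀ ht hx, Problem.net, integral_empiricalMeasure]
    · filter_upwards [h.ae_influence_eq hω (hψ hx) ht] with σ hσ
      rw [hσ]
      simp only [g, u, v, hgbar hx, hgbar (hdata _)]
      rfl
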